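/- Let $k$ be a field of characteristic $p>2$, let $a=(p-1)/2$, and let $d\ge 0$ be an integer. For a local ring $(R,\mathfrak m)$ of prime characteristic $p$, let $$e_{HK}(R)=\lim_{e\to\infty}\frac{\lambda\bigl(R/\mathfrak m^{[p^e]}\bigr)}{p^{e\dim R}}$$ be its Hilbert--Kunz multiplicity, where $\lambda$ denotes length and $\mathfrak m^{[p^e]}$ is the ideal generated by the $p^e$-th powers of all elements of $\mathfrak m$. For $n\ge 0$ let $$F_n=\{x\in[0,1]^n : x_i+x_{i+1}\le 1 \text{ for } 1\le i\le n-1\},\qquad E_n=\{x\in[-1,1]^n : |x_i|+|x_{i+1}|\le 1 \text{ for } 1\le i\le n-1\}$$ be the $n$-dimensional Fibonacci polytope and the $n$-dimensional extended Fibonacci polytope (for $n=0$ both are a single point), and for an integer $c\ge 0$ and $P\subset\mathbb R^n$ let $|cP|$ be the number of integer points of the dilate $cP$. In the two degenerate cases $d=1$ and $d=0$ put $|aE_{-1}|=1$ and $|aE_{-2}|=0$. Then the limit defining the Hilbert--Kunz multiplicity of $k[[x_0,\dots,x_d]]/(x_0^2+\cdots+x_d^2)$ exists (the lengths and the dimension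 being finite), and $$e_{HK}\bigl(k[[x_0,\dots,x_d]]/(x_0^2+\cdots+x_d^2)\bigr)=1+\frac{2^d\,|(a-1)F_d|}{(2a+1)^d-|aE_{d-2}|}.$$ -/

import Mathlib

open scoped Pointwise Topology

/-- The number `|cP|` of integer points in the dilate `c • P` of a subset `P` of `ℝⁿ`. -/
noncomputable def latticeCount {n : ℕ} (c : ℕ) (P : Set (Fin n → ℝ)) : ℕ :=
  Set.ncard {z : Fin n → ℤ | (fun i => (z i : ℝ)) ∈ (c : ℝ) • P}

/-- The `n`-dimensional Fibonacci polytope: the points of `[0,1]ⁿ` with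
`xᵢ + xᵢ₊₁ ≤ 1` for all consecutive indices. -/
def fibonacciPolytope (n : ℕ) : Set (Fin n → ℝ) :=
  {x | (∀ i, x i ∈ Set.Icc (0 : ℝ) 1) ∧
    ∀ i j : Fin n, (j : ℕ) = (i : ℕ) + 1 → x i + x j ≤ 1}

/-- The extended `n`-dimensional Fibonacci polytope: the points of `[-1,1]ⁿ` with
`|xᵢ| + |xᵢ₊₁| ≤ 1` for all consecutive indices. -/
def extFibonacciPolytope (n : ℕ) : Set (Fin n → ℝ) :=
  {x | (∀ i, x i ∈ Set.Icc (-1 : ℝ) 1) ∧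
    ∀ i j : Fin n, (j : ℕ) = (i : ℕ) + 1 → |x i| + |x j| ≤ 1}

/-- The number `|a E_{d-2}|` as a function of `a` and `d`. For `d ≥ 2` it counts the integer points
of the `a`-th dilate of the extended Fibonacci polytope of dimension `d - 2`. In the two degenerate
cases of a negative dimension, `E_{-1}` is a point and `E_{-2}` is empty. -/
noncomputable def extFibonacciCountSubTwo (a : ℕ) : ℕ → ℕ
  | 0 => 0
  | 1 => 1
  | n + 2 => latticeCount a (extFibonacciPolytope n)

/-- The ideal `I^{[q]}` generated by the `q`-th powers of all elements of `I`. -/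
def frobeniusPowerIdeal {R : Type*} [CommRing R] (I : Ideal R) (q : ℕ) : Ideal R :=
  Ideal.span ((fun x : R => x ^ q) '' (I : Set R))

/-- `L` is the Hilbert--Kunz multiplicity of the local ring `(R, 𝔪)` of prime characteristic `p`:
the dimension `n` of `R` is finite, all quotients `R ⧸ 𝔪^{[p^e]}` have finite length, and
`length (R ⧸ 𝔪^{[p^e]}) / p^(e n)` converges to `L` as `e → ∞`. -/
structure HasHilbertKunzMultiplicity (R : Type*) [CommRing R] [IsLocalRing R] (p : ℕ) (L : ℝ) :
    Prop where
  prime : p.Prime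
  charP : CharP R p
  length_ne_top : ∀ e : ℕ,
    Module.length R (R ⧸ frobeniusPowerIdeal (IsLocalRing.maximalIdeal R) (p ^ e)) ≠ ⊤
  tendsto : ∃ n : ℕ, ringKrullDim R = n ∧
    Filter.Tendsto
      (fun e : ℕ =>
        ((Module.length R
          (R ⧸ frobeniusPowerIdeal (IsLocalRing.maximalIdeal R) (p ^ e))).toNat : ℝ)
          / (p : ℝ) ^ (e * n))
      Filter.atTop (𝓝 L)

/-- The power series `x₀² + ⋯ + x_d²`. -/
noncomputable def sumSquares (k : Type*) [Field k] (d : ℕ) : MvPowerSeries (Fin (d + 1)) k :=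
  ∑ i, MvPowerSeries.X i ^ 2

/-- The ring `k[[x₀, …, x_d]] / (x₀² + ⋯ + x_d²)`. -/
abbrev QuadricRing (k : Type*) [Field k] (d : ℕ) : Type _ :=
  MvPowerSeries (Fin (d + 1)) k ⧸ Ideal.span {sumSquares k d}

instance QuadricRing.instNontrivial (k : Type*) [Field k] (d : ℕ) :
    Nontrivial (QuadricRing k d) := by
  rw [Ideal.Quotient.nontrivial_iff, Ne, Ideal.span_singleton_eq_top]
  intro h
  have h2 := MvPowerSeries.isUnit_constantCoeff _ h
  simp [sumSquares] at h2

instance QuadricRing.instIsLocalRing (k : Type*) [Field k] (d : ℕ) :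
    IsLocalRing (QuadricRing k d) :=
  IsLocalRing.of_surjective' (Ideal.Quotient.mk _) Ideal.Quotient.mk_surjective

/-!
Write `q = p ^ e`. Modulo the `q`-th powers of the variables, the power series ring is the
`(d + 1)`-fold tensor power of `U_q = k[x] ⧸ (x ^ q)`, and multiplication by `x₀² + ⋯ + x_d²`
becomes the operator `T` obtained from `x ^ 2` on each factor. Hence the length in question is the
dimension of the cokernel, equivalently of the kernel, of `T` on this tensor power
(`length_quotient_frobeniusPowerIdeal`). Everything therefore takes place in the representation ring
of finite-dimensional `k[T]`-modules, in which `T` acts on tensor products by `T ⊗ 1 + 1 ⊗ T`: the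
problem is to compute `rk (u_q ^ (d + 1))`, where `u_q` is the class of `U_q` and `rk` is additive
and takes the value `1` on the class `δ_n` of every Jordan block of size `n ≥ 1`. The products of
Jordan blocks that matter are decomposed by exhibiting generators of the blocks in
`k[x, y] ⧸ (x ^ m, y ^ n)` with `T = x + y` (`delta_mul_delta_eq_sum`).

Since `u_q = δ_{(q + 1) / 2} + δ_{(q - 1) / 2}`, the class `v_q = u_q - δ_q` is annihilated by
`δ_q`, so that `rk (u_q ^ (d + 1)) = q ^ d + rk (v_q ^ (d + 1))`.

The passage from `q > 1` to `q p` rests on the functor which induces modules along `T ↦ T ^ q`. Let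
`w` be the class of the module induced by `U_p`. By the projection formula
`w * (u_{qp} - w) = 0` and `rk (w ^ (d + 1)) = q ^ d * rk (u_p ^ (d + 1))`, while
`u_{qp} - w = ε_{qa} v_q` with `ε_n = δ_{n + 1} - δ_n`. The elements `ε_{qj} v_q ^ (d + 1)`,
`0 ≤ j ≤ 2a`, satisfy a recursion of Chebyshev type (`eps_mul_eps`), whose solution is that `ε_{qa}`
acts on them by the adjacency matrix of the relation `|l| + |m| ≤ a` on the integers `l, m` with
`-a ≤ l, m ≤ a` (`mul_eq_sum_diamond`). Only the element with `j = 0` has nonzero rank, so counting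
paths gives `rk ((ε_{qa} v_q) ^ (d + 1)) = |a E_{d-2}| * rk (v_q ^ (d + 1))`.

Similarly `v_p = δ_a (1 - τ)` with the involution `τ = δ_p - δ_{p - 1}`, and `δ_a` acts on the
elements `ε_l (1 - τ)`, `0 ≤ l < a`, by the adjacency matrix of the relation `l + m ≤ a - 1`; this
gives `rk (v_p ^ (d + 1)) = 2 ^ d * |(a - 1) F_d|` (`rk_vir_pow`).

The two computations combine into a linear recursion for `rk (u_q ^ (d + 1)) - q ^ d`, with the
closed form `rk_cls_sqMod_pow`, from which the limit is read off.
-/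

universe u

/-! ### Finite-dimensional `k[T]`-modules and their tensor products -/

/-- A finite-dimensional vector space over `k` with an endomorphism `T`, that is, a `k[T]`-module of
finite dimension over `k`. -/
structure EndoMod (k : Type u) [Field k] where
  /-- the underlying vector space -/
  carrier : Type u
  [addCommGroup : AddCommGroup carrier]
  [module : Module k carrier]
  [finite : Module.Finite k carrier]
  /-- the endomorphism -/
  T : Module.End k carrier

namespace EndoMod

attribute [instance] EndoMod.addCommGroup EndoMod.module EndoMod.finite

variable {k : Type u} [Field k]

open TensorProduct

/-- Isomorphism of `k[T]`-modules. -/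
def Iso (M N : EndoMod k) : Prop :=
  ∃ e : M.carrier ≃ₗ[k] N.carrier, ∀ v, e (M.T v) = N.T (e v)

/-- The direct sum of two `k[T]`-modules. -/
def prod (M N : EndoMod k) : EndoMod k where
  carrier := M.carrier × N.carrier
  T := LinearMap.prodMap M.T N.T

/-- The tensor product over `k`, on which `T` acts as `T ⊗ 1 + 1 ⊗ T`. -/
noncomputable def tensor (M N : EndoMod k) : EndoMod k where
  carrier := M.carrier ⊗[k] N.carrier
  T := M.T.rTensor N.carrier + N.T.lTensor M.carrier

/-- The unit for the tensor product: `k` with `T = 0`. -/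
def unit (k : Type u) [Field k] : EndoMod k where
  carrier := k
  T := 0

/-- The direct sum of a finite family of `k[T]`-modules. -/
def pi {ι : Type} [Fintype ι] (M : ι → EndoMod k) : EndoMod k where
  carrier := ∀ i, (M i).carrier
  T := LinearMap.pi fun i => (M i).T ∘ₗ LinearMap.proj i

/-- A finite-dimensional commutative `k`-algebra, on which `T` acts as multiplication by `t`. -/
noncomputable def ofAlg (A : Type u) [CommRing A] [Algebra k A] [Module.Finite k A] (t : A) :
    EndoMod k where
  carrier := A
  T := LinearMap.mulLeft k t

theorem Iso.refl (M : EndoMod k) : Iso M M := ⟨LinearEquiv.refl _ _, fun _ => rfl⟩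

theorem Iso.symm {M N : EndoMod k} (h : Iso M N) : Iso N M := by
  obtain ⟨e, he⟩ := h
  refine ⟨e.symm, fun v => ?_⟩
  rw [LinearEquiv.symm_apply_eq, he, LinearEquiv.apply_symm_apply]

theorem Iso.trans {M N P : EndoMod k} (h : Iso M N) (h' : Iso N P) : Iso M P := by
  obtain ⟨e, he⟩ := h
  obtain ⟨f, hf⟩ := h'
  exact ⟨e.trans f, fun v => by simp [he, hf]⟩

theorem tensor_T_tmul (M N : EndoMod k) (m : M.carrier) (n : N.carrier) :
    (tensor M N).T (m ⊗ₜ[k] n) = M.T m ⊗ₜ n + m ⊗ₜ N.T n := rfl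

/-- To check that a linear map out of a tensor product commutes with `T`, pure tensors suffice. -/
theorem tensor_comm_of_tmul {M N P : EndoMod k} (f : M.carrier ⊗[k] N.carrier →ₗ[k] P.carrier)
    (h : ∀ m n, f (M.T m ⊗ₜ n + m ⊗ₜ N.T n) = P.T (f (m ⊗ₜ n))) (v : (tensor M N).carrier) :
    f ((tensor M N).T v) = P.T (f v) := by
  suffices H : f ∘ₗ (tensor M N).T = P.T ∘ₗ f from LinearMap.congr_fun H v
  exact TensorProduct.ext' fun m n => h m n

theorem tensor_congr {M M' N N' : EndoMod k} (h : Iso M M') (h' : Iso N N') :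
    Iso (tensor M N) (tensor M' N') := by
  obtain ⟨e, he⟩ := h
  obtain ⟨f, hf⟩ := h'
  refine ⟨TensorProduct.congr e f, tensor_comm_of_tmul (P := tensor M' N')
    (TensorProduct.congr e f).toLinearMap fun m n => ?_⟩
  change TensorProduct.congr e f (M.T m ⊗ₜ n + m ⊗ₜ N.T n) =
    M'.T (e m) ⊗ₜ f n + e m ⊗ₜ N'.T (f n)
  simp [he, hf]

theorem tensor_comm (M N : EndoMod k) : Iso (tensor M N) (tensor N M) := by
  refine ⟨TensorProduct.comm k _ _, tensor_comm_of_tmul (P := tensor N M)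
    (TensorProduct.comm k _ _).toLinearMap fun m n => ?_⟩
  change TensorProduct.comm k _ _ (M.T m ⊗ₜ n + m ⊗ₜ N.T n) = N.T n ⊗ₜ m + n ⊗ₜ M.T m
  simp [add_comm]

theorem tensor_assoc (M N P : EndoMod k) :
    Iso (tensor (tensor M N) P) (tensor M (tensor N P)) := by
  refine ⟨TensorProduct.assoc k _ _ _, fun v => ?_⟩
  suffices H : (TensorProduct.assoc k M.carrier N.carrier P.carrier).toLinearMap ∘ₗ
      (tensor (tensor M N) P).T = (tensor M (tensor N P)).T ∘ₗ
        (TensorProduct.assoc k M.carrier N.carrier P.carrier).toLinearMap from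
    LinearMap.congr_fun H v
  refine TensorProduct.ext_threefold fun m n q => ?_
  change TensorProduct.assoc k _ _ _
    ((M.T m ⊗ₜ n + m ⊗ₜ N.T n) ⊗ₜ[k] q + (m ⊗ₜ n) ⊗ₜ P.T q) =
      M.T m ⊗ₜ (n ⊗ₜ q) + m ⊗ₜ[k] (N.T n ⊗ₜ q + n ⊗ₜ P.T q)
  simp [add_tmul, tmul_add, add_assoc]

theorem unit_tensor (M : EndoMod k) : Iso (tensor (unit k) M) M := by
  refine ⟨TensorProduct.lid k _, tensor_comm_of_tmul (M := unit k) (P := M)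
    (TensorProduct.lid k _).toLinearMap fun m n => ?_⟩
  change TensorProduct.lid k M.carrier ((0 : k) ⊗ₜ[k] n + (show k from m) ⊗ₜ[k] M.T n) =
    M.T ((show k from m) • n)
  rw [zero_tmul, zero_add, TensorProduct.lid_tmul, map_smul]

theorem tensor_prod (M N N' : EndoMod k) :
    Iso (tensor M (prod N N')) (prod (tensor M N) (tensor M N')) := by
  refine ⟨TensorProduct.prodRight k k _ _ _, tensor_comm_of_tmul (N := prod N N')
    (P := prod (tensor M N) (tensor M N')) (TensorProduct.prodRight k k _ _ _).toLinearMap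
      fun m n => ?_⟩
  obtain ⟨n, n'⟩ := n
  change TensorProduct.prodRight k k _ _ _ (M.T m ⊗ₜ (n, n') + m ⊗ₜ (N.T n, N'.T n')) =
    (M.T m ⊗ₜ n + m ⊗ₜ N.T n, M.T m ⊗ₜ n' + m ⊗ₜ N'.T n')
  simp

/-! ### The representation ring -/

/-- The integer invariants of `k[T]`-modules that depend only on the isomorphism class and are
additive on direct sums. -/
def additiveInvariants (k : Type u) [Field k] : AddSubgroup (EndoMod k → ℤ) where
  carrier := {f | (∀ M N, Iso M N → f M = f N) ∧ ∀ M N, f (prod M N) = f M + f N}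
  zero_mem' := ⟨fun _ _ _ => rfl, fun _ _ => rfl⟩
  add_mem' := fun {f g} hf hg => ⟨fun M N h => by simp [hf.1 M N h, hg.1 M N h],
    fun M N => by simp only [Pi.add_apply, hf.2, hg.2]; ring⟩
  neg_mem' := fun {f} hf => ⟨fun M N h => by simp [hf.1 M N h],
    fun M N => by simp only [Pi.neg_apply, hf.2]; ring⟩

instance : CoeFun (additiveInvariants k) fun _ => EndoMod k → ℤ := ⟨fun f => f.1⟩

theorem inv_iso (f : additiveInvariants k) {M N : EndoMod k} (h : Iso M N) : f M = f N :=
  f.2.1 M N h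

theorem inv_prod (f : additiveInvariants k) (M N : EndoMod k) : f (prod M N) = f M + f N :=
  f.2.2 M N

theorem inv_ext {f g : additiveInvariants k} (h : ∀ M, f M = g M) : f = g :=
  Subtype.ext (funext h)

/-- Pulling back additive invariants along an operation on `k[T]`-modules which preserves
isomorphism and direct sums. -/
def pullback (Φ : EndoMod k → EndoMod k) (h : ∀ M N, Iso M N → Iso (Φ M) (Φ N))
    (h' : ∀ M N, Iso (Φ (prod M N)) (prod (Φ M) (Φ N))) :
    AddMonoid.End (additiveInvariants k) where
  toFun f := ⟨fun M => f (Φ M), fun M N e => inv_iso f (h M N e), fun M N => by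
    change f (Φ (prod M N)) = f (Φ M) + f (Φ N)
    rw [inv_iso f (h' M N), inv_prod]⟩
  map_zero' := rfl
  map_add' _ _ := rfl

/-- The operator on additive invariants given by tensoring with `M`. -/
noncomputable def tensorOp (M : EndoMod k) : AddMonoid.End (additiveInvariants k) :=
  pullback (fun N => tensor M N) (fun _ _ h => tensor_congr (Iso.refl _) h) (tensor_prod M)

theorem tensorOp_mul (M N : EndoMod k) : tensorOp M * tensorOp N = tensorOp (tensor M N) := by
  refine AddMonoidHom.ext fun f => inv_ext fun P => ?_
  change f (tensor N (tensor M P)) = f (tensor (tensor M N) P)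
  exact inv_iso f (((tensor_assoc N M P).symm).trans
    (tensor_congr (tensor_comm N M) (Iso.refl P)))

theorem tensorOp_congr {M N : EndoMod k} (h : Iso M N) : tensorOp M = tensorOp N :=
  AddMonoidHom.ext fun f => inv_ext fun P => inv_iso f (tensor_congr h (Iso.refl P))

theorem tensorOp_comm (M N : EndoMod k) : tensorOp M * tensorOp N = tensorOp N * tensorOp M := by
  rw [tensorOp_mul, tensorOp_mul, tensorOp_congr (tensor_comm M N)]

theorem tensorOp_unit : tensorOp (unit k) = 1 :=
  AddMonoidHom.ext fun f => inv_ext fun P => inv_iso f (unit_tensor P)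

theorem tensorOp_prod (M N : EndoMod k) : tensorOp (prod M N) = tensorOp M + tensorOp N := by
  refine AddMonoidHom.ext fun f => inv_ext fun P => ?_
  change f (tensor (prod M N) P) = f (tensor M P) + f (tensor N P)
  rw [inv_iso f ((tensor_comm _ _).trans (tensor_prod P M N)), inv_prod,
    inv_iso f (tensor_comm P M), inv_iso f (tensor_comm P N)]

/-- The representation ring of finite-dimensional `k[T]`-modules under direct sum and tensor
product, realized as the commutative ring of operators on additive invariants generated by the
operations of tensoring with a fixed module. -/
def RepRing (k : Type u) [Field k] : Type (u + 1) :=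
  Subring.closure (Set.range (tensorOp (k := k)))

noncomputable instance : CommRing (RepRing k) :=
  { (inferInstance : Ring (Subring.closure (Set.range (tensorOp (k := k))))) with
    mul_comm := by
      have := Subring.isMulCommutative_closure (s := Set.range (tensorOp (k := k))) (by
        rintro _ ⟨M, rfl⟩ _ ⟨N, rfl⟩
        exact tensorOp_comm M N)
      exact this.is_comm.comm }

/-- The class of a module in the representation ring. -/
noncomputable def cls (M : EndoMod k) : RepRing k :=
  ⟨tensorOp M, Subring.subset_closure ⟨M, rfl⟩⟩

/-- The inclusion of the representation ring in the ring of operators on additive invariants. -/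
noncomputable def toOp : RepRing k →+* AddMonoid.End (additiveInvariants k) :=
  (Subring.closure (Set.range (tensorOp (k := k)))).subtype

theorem toOp_injective : Function.Injective (toOp (k := k)) := Subtype.val_injective

@[simp]
theorem toOp_cls (M : EndoMod k) : toOp (cls M) = tensorOp M := rfl

theorem cls_congr {M N : EndoMod k} (h : Iso M N) : cls M = cls N :=
  toOp_injective (tensorOp_congr h)

theorem cls_tensor (M N : EndoMod k) : cls (tensor M N) = cls M * cls N :=
  toOp_injective (tensorOp_mul M N).symm

theorem cls_prod (M N : EndoMod k) : cls (prod M N) = cls M + cls N :=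
  toOp_injective (tensorOp_prod M N)

theorem cls_unit : cls (unit k) = 1 := toOp_injective tensorOp_unit

/-- The dimension of the kernel of `T`, which for nilpotent `T` is the number of Jordan blocks, as
an additive invariant. -/
noncomputable def kerDim : additiveInvariants k where
  val M := Module.finrank k (LinearMap.ker M.T)
  property := by
    refine ⟨?_, ?_⟩
    · rintro M N ⟨e, he⟩
      have : LinearMap.ker N.T = (LinearMap.ker M.T).map (e : M.carrier →ₗ[k] N.carrier) := by
        ext v
        rw [Submodule.mem_map_equiv, LinearMap.mem_ker, LinearMap.mem_ker,
          ← (e.map_eq_zero_iff (x := M.T _)), he, LinearEquiv.apply_symm_apply]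
      change (Module.finrank k (LinearMap.ker M.T) : ℤ) = Module.finrank k (LinearMap.ker N.T)
      rw [this]
      congr 1
      exact (LinearEquiv.finrank_map_eq e _).symm
    · intro M N
      change (Module.finrank k (LinearMap.ker (LinearMap.prodMap M.T N.T)) : ℤ) = _
      rw [LinearMap.ker_prodMap, ← Nat.cast_add, ← Module.finrank_prod]
      exact congrArg _ (LinearEquiv.finrank_eq
        { toFun := fun x => (⟨x.1.1, x.2.1⟩, ⟨x.1.2, x.2.2⟩)
          invFun := fun x => ⟨(x.1.1, x.2.1), ⟨x.1.2, x.2.2⟩⟩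
          map_add' := fun _ _ => rfl
          map_smul' := fun _ _ => rfl })

/-- The additive extension of `kerDim` to the representation ring. -/
noncomputable def rk : RepRing k →+ ℤ where
  toFun x := (toOp x kerDim) (unit k)
  map_zero' := by simp
  map_add' x y := by
    rw [map_add]
    rfl

theorem rk_cls (M : EndoMod k) : rk (cls M) = Module.finrank k (LinearMap.ker M.T) :=
  inv_iso kerDim ((tensor_comm _ _).trans (unit_tensor M))

/-! ### Jordan blocks -/

open Polynomial

theorem cls_of_subsingleton (M : EndoMod k) [Subsingleton M.carrier] : cls M = 0 := by
  have h : Iso (prod M M) M :=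
    ⟨{ toFun := fun x => x.1
       invFun := fun x => (x, x)
       left_inv := fun x => Prod.ext rfl (Subsingleton.elim _ _)
       right_inv := fun _ => rfl
       map_add' := fun _ _ => rfl
       map_smul' := fun _ _ => rfl }, fun _ => rfl⟩
  have h1 := cls_congr h
  rw [cls_prod] at h1
  simpa using h1

theorem cls_pi {ι : Type} [Fintype ι] (M : ι → EndoMod k) : cls (pi M) = ∑ i, cls (M i) := by
  refine Fintype.induction_empty_option
    (P := fun ι _ => ∀ M : ι → EndoMod k, cls (pi M) = ∑ i, cls (M i)) ?_ ?_ ?_ ι M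
  · intro α β _ e ih M
    let := Fintype.ofEquiv β e.symm
    have h := ih (fun i => M (e i))
    rw [← e.sum_comp, ← h]
    exact cls_congr ⟨(LinearEquiv.piCongrLeft k (fun i => (M i).carrier) e).symm, fun _ => rfl⟩
  · intro M
    have : Subsingleton (pi M).carrier :=
      inferInstanceAs (Subsingleton (∀ i : PEmpty, (M i).carrier))
    simp [cls_of_subsingleton]
  · intro α _ ih M
    rw [Fintype.sum_option, ← ih (fun i => M (some i)), ← cls_prod]
    exact cls_congr ⟨LinearEquiv.piOptionEquivProd k (M := fun i => (M i).carrier), fun _ => rfl⟩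

theorem finite_quotient_X_pow (n : ℕ) : Module.Finite k (k[X] ⧸ Ideal.span {(X : k[X]) ^ n}) :=
  (monic_X_pow n).finite_quotient

instance (n : ℕ) : Module.Finite k (k[X] ⧸ Ideal.span {(X : k[X]) ^ n}) := finite_quotient_X_pow n

/-- The cyclic module `k[x] ⧸ (x ^ n)`, on which `T` acts as a single nilpotent Jordan block of
size `n`. -/
noncomputable def jordan (k : Type u) [Field k] (n : ℕ) : EndoMod k :=
  ofAlg (k[X] ⧸ Ideal.span {(X : k[X]) ^ n}) (Ideal.Quotient.mk _ X)

theorem finrank_jordan (n : ℕ) : Module.finrank k (k[X] ⧸ Ideal.span {(X : k[X]) ^ n}) = n := by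
  rw [finrank_quotient_span_eq_natDegree, natDegree_X_pow]

/-- The standard generator of a Jordan block. -/
noncomputable def jordanOne (k : Type u) [Field k] (n : ℕ) : (jordan k n).carrier :=
  Ideal.Quotient.mk (Ideal.span {(X : k[X]) ^ n}) 1

theorem jordan_eq_smul_add (n : ℕ) (v : (jordan k n).carrier) :
    ∃ (c : k) (w : (jordan k n).carrier), v = c • jordanOne k n + (jordan k n).T w := by
  obtain ⟨v, rfl⟩ : ∃ f, Ideal.Quotient.mk (Ideal.span {(X : k[X]) ^ n}) f = v :=
    Ideal.Quotient.mk_surjective _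
  refine ⟨v.coeff 0, Ideal.Quotient.mk (Ideal.span {(X : k[X]) ^ n}) v.divX, ?_⟩
  change Ideal.Quotient.mk (Ideal.span {(X : k[X]) ^ n}) v =
    Ideal.Quotient.mk (Ideal.span {(X : k[X]) ^ n}) (v.coeff 0 • 1 + X * v.divX)
  rw [smul_eq_C_mul, mul_one, add_comm, X_mul_divX_add]

/-- The universal property of the cyclic module `k[x] ⧸ (x ^ n)`. -/
theorem exists_jordan_lift (M : EndoMod k) (n : ℕ) (g : M.carrier) (hg : (M.T ^ n) g = 0) :
    ∃ f : (jordan k n).carrier →ₗ[k] M.carrier, (∀ v, f ((jordan k n).T v) = M.T (f v)) ∧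
      f (jordanOne k n) = g := by
  let F : k[X] →ₗ[k] M.carrier := (LinearMap.applyₗ g) ∘ₗ (aeval M.T).toLinearMap
  have hF : ∀ q ∈ (Ideal.span {(X : k[X]) ^ n}).toAddSubgroup, F.toAddMonoidHom q = 0 := by
    intro q hq
    obtain ⟨c, rfl⟩ := Ideal.mem_span_singleton.1 hq
    change (aeval M.T (X ^ n * c)) g = 0
    rw [mul_comm, map_mul, map_pow, aeval_X, Module.End.mul_apply, hg, map_zero]
  let f : (k[X] ⧸ Ideal.span {(X : k[X]) ^ n}) →ₗ[k] M.carrier :=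
    { (QuotientAddGroup.lift _ F.toAddMonoidHom hF) with
      map_smul' := by
        intro c x
        obtain ⟨x, rfl⟩ := Ideal.Quotient.mk_surjective x
        exact F.map_smul c x }
  refine ⟨f, fun v => ?_, ?_⟩
  · obtain ⟨v, rfl⟩ := Ideal.Quotient.mk_surjective v
    change (aeval M.T (X * v)) g = M.T ((aeval M.T v) g)
    rw [map_mul, aeval_X, Module.End.mul_apply]
  · change (aeval M.T (1 : k[X])) g = g
    rw [map_one, Module.End.one_apply]

/-- The class of the Jordan block of size `n` in the representation ring. -/
noncomputable def delta (k : Type u) [Field k] (n : ℕ) : RepRing k := cls (jordan k n)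

/-- A criterion for Jordan types: if `T` is nilpotent, if the `g i` span modulo the image of `T`, if
`g i` is annihilated by `T ^ n i`, and if the `n i` sum to the dimension, then the `n i` are the
sizes of the Jordan blocks. By nilpotence the `g i` generate the `k[T]`-module, so that the
surjection from the sum of Jordan blocks is an isomorphism for dimension reasons. -/
theorem cls_eq_sum_delta (M : EndoMod k) (hT : IsNilpotent M.T) {ι : Type} [Fintype ι] (n : ι → ℕ)
    (g : ι → M.carrier) (hkill : ∀ i, (M.T ^ n i) (g i) = 0)
    (hspan : ∀ v, ∃ c : ι → k, ∃ w, v = ∑ i, c i • g i + M.T w)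
    (hdim : ∑ i, n i = Module.finrank k M.carrier) : cls M = ∑ i, delta k (n i) := by
  choose f hf hf' using fun i => exists_jordan_lift M (n i) (g i) (hkill i)
  rw [show ∑ i, delta k (n i) = cls (pi fun i => jordan k (n i)) from (cls_pi _).symm]
  let F : (∀ i, (jordan k (n i)).carrier) →ₗ[k] M.carrier :=
    ∑ i, f i ∘ₗ LinearMap.proj i
  have hFv : ∀ v, F v = ∑ i, f i (v i) := fun v => by simp [F]
  have hF : ∀ v, F ((pi fun i => jordan k (n i)).T v) = M.T (F v) := by
    intro v
    refine (hFv fun i => (jordan k (n i)).T (v i)).trans ?_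
    rw [hFv v, map_sum]
    exact Finset.sum_congr rfl fun i _ => hf i (v i)
  have hg : ∀ i, g i ∈ LinearMap.range F := by
    classical
    intro i
    refine ⟨Pi.single i (jordanOne k (n i)), ?_⟩
    rw [hFv, Finset.sum_eq_single i, Pi.single_eq_same, hf' i]
    · intro j _ hj
      rw [Pi.single_eq_of_ne hj, map_zero]
    · simp
  have hTF : ∀ v ∈ LinearMap.range F, M.T v ∈ LinearMap.range F := by
    rintro _ ⟨v, rfl⟩
    exact ⟨_, hF v⟩
  have hpow : ∀ r : ℕ, ∀ v, ∃ w, v - (M.T ^ r) w ∈ LinearMap.range F := by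
    intro r
    induction r with
    | zero => exact fun v => ⟨v, by simp⟩
    | succ r ih =>
      intro v
      obtain ⟨c, w, rfl⟩ := hspan v
      obtain ⟨w', hw'⟩ := ih w
      refine ⟨w', ?_⟩
      rw [pow_succ', Module.End.mul_apply, add_sub_assoc, ← map_sub]
      exact add_mem (sum_mem fun i _ => Submodule.smul_mem _ _ (hg i)) (hTF _ hw')
  have hsurj : Function.Surjective F := by
    intro v
    obtain ⟨r, hr⟩ := hT
    obtain ⟨w, hw⟩ := hpow r v
    rw [hr, LinearMap.zero_apply, sub_zero] at hw
    exact hw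
  have hfin : Module.finrank k (∀ i, (jordan k (n i)).carrier) = Module.finrank k M.carrier := by
    rw [Module.finrank_pi_fintype, ← hdim]
    exact Finset.sum_congr rfl fun i _ => finrank_jordan (n i)
  exact (cls_congr ⟨LinearEquiv.ofBijective F
    ⟨(LinearMap.injective_iff_surjective_of_finrank_eq_finrank hfin).2 hsurj, hsurj⟩, hF⟩).symm

theorem delta_zero : delta k 0 = 0 := by
  have : Subsingleton (jordan k 0).carrier := by
    have h : Module.finrank k (jordan k 0).carrier = 0 := finrank_jordan 0
    exact Module.finrank_zero_iff.1 h
  exact cls_of_subsingleton _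

theorem delta_one : delta k 1 = 1 := by
  rw [← cls_unit, cls_eq_sum_delta (unit k) ⟨1, by rw [pow_one]; rfl⟩ (fun _ : Unit => 1)
    (fun _ => (1 : k)) (fun _ => rfl) ?_ ?_]
  · simp
  · intro v
    refine ⟨fun _ => (show k from v), 0, ?_⟩
    change (show k from v) = ∑ i : Unit, (show k from v) * (1 : k) + 0
    rw [Fintype.sum_unique, mul_one, add_zero]
  · change ∑ i : Unit, 1 = Module.finrank k k
    simp

theorem ofAlg_T_pow {A : Type u} [CommRing A] [Algebra k A] [Module.Finite k A] (t : A) (n : ℕ)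
    (v : A) : ((ofAlg (k := k) A t).T ^ n) v = t ^ n * v := by
  change (LinearMap.mulLeft k t ^ n) v = _
  rw [LinearMap.pow_mulLeft]
  rfl

theorem jordan_T_pow (n : ℕ) : (jordan k n).T ^ n = 0 := by
  refine LinearMap.ext fun (v : k[X] ⧸ Ideal.span {(X : k[X]) ^ n}) => ?_
  have h : (Ideal.Quotient.mk (Ideal.span {(X : k[X]) ^ n}) X) ^ n * v = 0 := by
    rw [← map_pow, Ideal.Quotient.eq_zero_iff_mem.2 (Ideal.mem_span_singleton_self _), zero_mul]
  exact (ofAlg_T_pow _ n v).trans h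

/-- A `T`-stable subspace of a Jordan block containing the generator is everything. -/
theorem jordan_induction {n : ℕ} {S : Submodule k (jordan k n).carrier} (h1 : jordanOne k n ∈ S)
    (hT : ∀ v ∈ S, (jordan k n).T v ∈ S) (v : (jordan k n).carrier) : v ∈ S := by
  have hpow : ∀ r : ℕ, ∀ v, ∃ w, v - ((jordan k n).T ^ r) w ∈ S := by
    intro r
    induction r with
    | zero => exact fun v => ⟨v, by simp⟩
    | succ r ih =>
      intro v
      obtain ⟨c, w, rfl⟩ := jordan_eq_smul_add n v
      obtain ⟨w', hw'⟩ := ih w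
      refine ⟨w', ?_⟩
      rw [pow_succ', Module.End.mul_apply, add_sub_assoc, ← map_sub]
      exact add_mem (S.smul_mem c h1) (hT _ hw')
  obtain ⟨w, hw⟩ := hpow n v
  rwa [jordan_T_pow, LinearMap.zero_apply, sub_zero] at hw

/-- A Jordan block has one-dimensional kernel, unless it is empty. -/
theorem rk_delta {n : ℕ} (hn : n ≠ 0) : rk (delta k n) = 1 := by
  have hfin : Module.finrank k (jordan k n).carrier = n := finrank_jordan n
  rw [delta, rk_cls]
  -- the kernel and the cokernel have the same dimension, and the cokernel is spanned by `1`
  have hle : Module.finrank k (LinearMap.ker (jordan k n).T) ≤ 1 := by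
    have h1 := LinearMap.finrank_range_add_finrank_ker (jordan k n).T
    have h2 := Submodule.finrank_add_le_finrank_add_finrank (LinearMap.range (jordan k n).T)
      (Submodule.span k {jordanOne k n})
    have h3 : LinearMap.range (jordan k n).T ⊔ Submodule.span k {jordanOne k n} = ⊤ := by
      refine eq_top_iff.2 fun v _ => ?_
      obtain ⟨c, w, rfl⟩ := jordan_eq_smul_add n v
      rw [add_comm]
      exact Submodule.add_mem_sup ⟨w, rfl⟩
        (Submodule.smul_mem _ c (Submodule.mem_span_singleton_self _))
    have h4 : Module.finrank k (Submodule.span k {jordanOne k n}) ≤ 1 := by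
      simpa using finrank_span_le_card (R := k) ({jordanOne k n} : Set (jordan k n).carrier)
    rw [h3, finrank_top] at h2
    omega
  have hpos : 0 < Module.finrank k (LinearMap.ker (jordan k n).T) := by
    rw [Nat.pos_iff_ne_zero]
    intro h
    have hker : Function.Injective (jordan k n).T :=
      LinearMap.ker_eq_bot.1 (Submodule.finrank_eq_zero.1 h)
    have hinj : Function.Injective ((jordan k n).T ^ n) := by
      rw [Module.End.coe_pow]
      exact hker.iterate n
    have : Subsingleton (jordan k n).carrier :=
      ⟨fun v w => hinj (by rw [jordan_T_pow, LinearMap.zero_apply, LinearMap.zero_apply])⟩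
    exact hn (by rw [← hfin, Module.finrank_zero_of_subsingleton])
  have : Module.finrank k (LinearMap.ker (jordan k n).T) = 1 := by omega
  rw [this]
  rfl

/-! ### Products of Jordan blocks -/

/-- Modulo `x + y`, every element of an algebra generated by `x` and `y` is a polynomial in `y`. -/
theorem exists_aeval_add_mul {B C : Type u} [CommRing B] [Algebra k B] [CommRing C] [Algebra k C]
    {b : B} {c : C} (hb : ∀ v, ∃ f : k[X], v = aeval b f) (hc : ∀ v, ∃ f : k[X], v = aeval c f)
    (v : B ⊗[k] C) :
    ∃ (f : k[X]) (w : B ⊗[k] C), v = aeval ((1 : B) ⊗ₜ[k] c) f + (b ⊗ₜ 1 + 1 ⊗ₜ c) * w := by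
  induction v using TensorProduct.induction_on with
  | zero => exact ⟨0, 0, by rw [map_zero, mul_zero, add_zero]⟩
  | add v w hv hw =>
    obtain ⟨f, b, rfl⟩ := hv
    obtain ⟨g, c, rfl⟩ := hw
    exact ⟨f + g, b + c, by rw [map_add]; ring⟩
  | tmul v w =>
    obtain ⟨f, rfl⟩ := hb v
    obtain ⟨g, rfl⟩ := hc w
    have h1 : (aeval b f) ⊗ₜ[k] (1 : C) = aeval (b ⊗ₜ[k] (1 : C)) f :=
      (aeval_algHom_apply (Algebra.TensorProduct.includeLeft : B →ₐ[k] B ⊗[k] C) b f).symm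
    have h2 : (1 : B) ⊗ₜ[k] (aeval c g) = aeval ((1 : B) ⊗ₜ[k] c) g :=
      (aeval_algHom_apply (Algebra.TensorProduct.includeRight : C →ₐ[k] B ⊗[k] C) c g).symm
    set x : B ⊗[k] C := b ⊗ₜ 1
    set y : B ⊗[k] C := 1 ⊗ₜ c
    obtain ⟨d, hd⟩ : x + y ∣ aeval x f - aeval (-y) f := by
      have := sub_dvd_eval_sub x (-y) (f.map (algebraMap k (B ⊗[k] C)))
      rwa [sub_neg_eq_add, eval_map_algebraMap, eval_map_algebraMap] at this
    refine ⟨f.comp (-X) * g, d * aeval y g, ?_⟩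
    have h3 : (aeval b f) ⊗ₜ[k] (aeval c g) = aeval x f * aeval y g := by
      rw [← h1, ← h2, Algebra.TensorProduct.tmul_mul_tmul, mul_one, one_mul]
    rw [h3, map_mul, aeval_comp, map_neg, aeval_X, ← mul_assoc, ← hd]
    ring

/-- The criterion `cls_eq_sum_delta` in an algebra which modulo `x + y` is generated by the
nilpotent element `y`, for `T = x + y`. -/
theorem cls_ofAlg_eq_sum_delta {A : Type u} [CommRing A] [Algebra k A] [Module.Finite k A]
    {x y : A} (hgen : ∀ v : A, ∃ (f : k[X]) (b : A), v = aeval y f + (x + y) * b) {m n N : ℕ}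
    (hx : x ^ m = 0) (hy : y ^ n = 0) (hN0 : N ≠ 0) (hN : N = m ∨ N = n) (l : ℕ → ℕ)
    (H : ∀ s < N, ∃ (g b : A) (c : ℤ), (c : k) ≠ 0 ∧ g = c * y ^ s + (x + y) * b ∧
        (x + y) ^ l s * g = 0)
    (hsum : ∑ s ∈ Finset.range N, l s = Module.finrank k A) :
    cls (ofAlg (k := k) A (x + y)) = ∑ s ∈ Finset.range N, delta k (l s) := by
  choose g b c hc hg hkill using H
  rw [← Fin.sum_univ_eq_sum_range (fun s => delta k (l s))]
  refine cls_eq_sum_delta (ofAlg A (x + y)) ?_ (fun s : Fin N => l s) (fun s => g s s.2) ?_ ?_ ?_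
  · have hnil : IsNilpotent (x + y) := (Commute.all _ _).isNilpotent_add ⟨m, hx⟩ ⟨n, hy⟩
    obtain ⟨r, hr⟩ := hnil
    refine ⟨r, LinearMap.ext fun (v : A) => ?_⟩
    have h : (x + y) ^ r * v = 0 := by rw [hr, zero_mul]
    exact (ofAlg_T_pow _ r v).trans h
  · intro s
    exact (ofAlg_T_pow _ _ _).trans (hkill s s.2)
  · intro (v : A)
    obtain ⟨f, w, hw⟩ := hgen v
    -- `y ^ N` vanishes modulo `x + y`
    obtain ⟨z, hz⟩ : x + y ∣ y ^ N := by
      rcases hN with rfl | rfl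
      · have := sub_dvd_pow_sub_pow y (-x) N
        rwa [neg_pow, hx, mul_zero, sub_zero, sub_neg_eq_add, add_comm] at this
      · rw [hy]
        exact dvd_zero _
    have hf : aeval y f = ∑ s : Fin N, f.coeff s • y ^ (s : ℕ) +
        (x + y) * (z * aeval y (f /ₘ X ^ N)) := by
      rw [← mul_assoc, ← hz]
      conv_lhs => rw [← modByMonic_add_div f (X ^ N : k[X])]
      rw [map_add, map_mul, map_pow, aeval_X]
      congr 1
      rw [aeval_eq_sum_range' (n := N), Fin.sum_univ_eq_sum_range (fun s => f.coeff s • y ^ s)]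
      · refine Finset.sum_congr rfl fun s hs => ?_
        conv_rhs => rw [← modByMonic_add_div f (X ^ N : k[X])]
        rw [coeff_add, coeff_X_pow_mul', if_neg (by simpa using hs), add_zero]
      · refine (natDegree_modByMonic_lt _ (monic_X_pow N) fun h => hN0 ?_).trans_eq
          (natDegree_X_pow N)
        rw [← natDegree_X_pow (R := k) N, h, natDegree_one]
    have hys : ∀ s : Fin N, y ^ (s : ℕ) = (c s s.2 : k)⁻¹ • (g s s.2 - (x + y) * b s s.2) := by
      intro s
      rw [hg s s.2, add_sub_cancel_right, eq_inv_smul_iff₀ (hc s s.2), Algebra.smul_def,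
        map_intCast]
    refine ⟨fun s => f.coeff s * (c s s.2 : k)⁻¹,
      (w + z * aeval y (f /ₘ X ^ N) - ∑ s : Fin N, (f.coeff s * (c s s.2 : k)⁻¹) • b s s.2 : A), ?_⟩
    change v = ∑ s : Fin N, (f.coeff s * (c s s.2 : k)⁻¹) • g s s.2 +
      (x + y) * (w + z * aeval y (f /ₘ X ^ N) -
        ∑ s : Fin N, (f.coeff s * (c s s.2 : k)⁻¹) • b s s.2)
    have hsum : ∑ s : Fin N, f.coeff s • y ^ (s : ℕ) =
        ∑ s : Fin N, (f.coeff s * (c s s.2 : k)⁻¹) • g s s.2 -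
          (x + y) * ∑ s : Fin N, (f.coeff s * (c s s.2 : k)⁻¹) • b s s.2 := by
      rw [Finset.mul_sum, ← Finset.sum_sub_distrib]
      refine Finset.sum_congr rfl fun s _ => ?_
      rw [hys s, smul_smul, smul_sub, mul_smul_comm]
    rw [hw, hf, hsum]
    ring
  · rw [Fin.sum_univ_eq_sum_range l, hsum]
    rfl

/-- The product of two Jordan blocks is computed in the algebra `A = k[x, y] ⧸ (x ^ m, y ^ n)`, in
which `T` is `x + y`: since `A ⧸ (x + y)` is spanned by the `y ^ s` with `s < N`, it is enough to
find for each such `s` an element congruent to a nonzero multiple of `y ^ s` which is annihilated by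
the appropriate power of `x + y`. -/
theorem delta_mul_delta_eq_sum {m n N : ℕ} (hN0 : N ≠ 0) (hN : N = m ∨ N = n) (l : ℕ → ℕ)
    (H : ∀ (A : Type u) [CommRing A] [Algebra k A] (x y : A), x ^ m = 0 → y ^ n = 0 →
      ∀ s < N, ∃ (g b : A) (c : ℤ), (c : k) ≠ 0 ∧ g = c * y ^ s + (x + y) * b ∧
        (x + y) ^ l s * g = 0)
    (hsum : ∑ s ∈ Finset.range N, l s = m * n) :
    delta k m * delta k n = ∑ s ∈ Finset.range N, delta k (l s) := by
  have key : ∀ (B C : Type u) [CommRing B] [CommRing C] [Algebra k B] [Algebra k C]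
      [Module.Finite k B] [Module.Finite k C] (b : B) (c : C),
      (∀ v, ∃ f : k[X], v = aeval b f) → (∀ v, ∃ f : k[X], v = aeval c f) → b ^ m = 0 → c ^ n = 0 →
      Module.finrank k B = m → Module.finrank k C = n →
      cls (ofAlg (k := k) B b) * cls (ofAlg (k := k) C c) =
        ∑ s ∈ Finset.range N, delta k (l s) := by
    intro B C _ _ _ _ _ _ b c hb hc hbm hcn hB hC
    have hx : (b ⊗ₜ[k] (1 : C)) ^ m = 0 := by
      rw [Algebra.TensorProduct.tmul_pow, hbm, zero_tmul]
    have hy : ((1 : B) ⊗ₜ[k] c) ^ n = 0 := by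
      rw [Algebra.TensorProduct.tmul_pow, hcn, tmul_zero]
    rw [← cls_ofAlg_eq_sum_delta (exists_aeval_add_mul hb hc) hx hy hN0 hN l (H _ _ _ hx hy)
      (by rw [hsum, Module.finrank_tensorProduct, hB, hC]), ← cls_tensor]
    refine cls_congr ⟨LinearEquiv.refl k (B ⊗[k] C), tensor_comm_of_tmul (M := ofAlg B b)
      (N := ofAlg C c) (P := ofAlg (B ⊗[k] C) (b ⊗ₜ 1 + 1 ⊗ₜ c))
      (LinearEquiv.refl k (B ⊗[k] C)).toLinearMap ?_⟩
    intro (v : B) (w : C)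
    change (b * v) ⊗ₜ[k] w + v ⊗ₜ[k] (c * w) =
      (b ⊗ₜ[k] (1 : C) + (1 : B) ⊗ₜ[k] c) * (v ⊗ₜ[k] w)
    rw [add_mul, Algebra.TensorProduct.tmul_mul_tmul, Algebra.TensorProduct.tmul_mul_tmul, one_mul,
      one_mul]
  have hpow : ∀ r : ℕ, (Ideal.Quotient.mk (Ideal.span {(X : k[X]) ^ r}) X) ^ r = 0 := by
    intro r
    rw [← map_pow, Ideal.Quotient.eq_zero_iff_mem.2 (Ideal.mem_span_singleton_self _)]
  have hgen : ∀ r : ℕ, ∀ v : k[X] ⧸ Ideal.span {(X : k[X]) ^ r},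
      ∃ f : k[X], v = aeval (Ideal.Quotient.mk (Ideal.span {(X : k[X]) ^ r}) X) f := by
    intro r v
    obtain ⟨f, rfl⟩ := Ideal.Quotient.mk_surjective v
    refine ⟨f, ?_⟩
    have := aeval_algHom_apply (Ideal.Quotient.mkₐ k (Ideal.span {(X : k[X]) ^ r})) X f
    rw [aeval_X_left_apply] at this
    exact this.symm
  exact key _ _ _ _ (hgen m) (hgen n) (hpow m) (hpow n) (finrank_jordan m) (finrank_jordan n)

/-! ### Jordan blocks of size close to a multiple of a power of the characteristic -/

variable (k) in
theorem add_pow_primePow {A : Type u} [CommRing A] [Algebra k A] (p : ℕ) [Fact p.Prime]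
    [CharP k p] (e : ℕ) (x y : A) : (x + y) ^ p ^ e = x ^ p ^ e + y ^ p ^ e := by
  rcases subsingleton_or_nontrivial A with h | h
  · exact Subsingleton.elim _ _
  · have : CharP A p := charP_of_injective_algebraMap (algebraMap k A).injective p
    exact add_pow_char_pow x y p e

theorem mul_add_pow_of_mul_eq_zero {A : Type u} [CommRing A] {c x : A} (h : c * x = 0) (y : A)
    (n : ℕ) : c * (x + y) ^ n = c * y ^ n := by
  induction n with
  | zero => simp
  | succ n ih => rw [pow_succ, ← mul_assoc, ih, pow_succ]; linear_combination y ^ n * h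

theorem add_pow_succ_of_sq_eq_zero {A : Type u} [CommRing A] {x : A} (h : x ^ 2 = 0) (y : A)
    (n : ℕ) : (x + y) ^ (n + 1) = y ^ (n + 1) + (n + 1) * x * y ^ n := by
  induction n with
  | zero => simp; ring
  | succ n ih => rw [pow_succ, ih]; push_cast; linear_combination (n + 1) * y ^ n * h

section

variable (p : ℕ) [hp : Fact p.Prime] [CharP k p] (e : ℕ)

/-- The block of size `q * i` absorbs blocks of size at most `q = p ^ e`. -/
theorem delta_mul_mul_delta (i : ℕ) {l : ℕ} (hl : l ≤ p ^ e) :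
    delta k (p ^ e * i) * delta k l = l * delta k (p ^ e * i) := by
  rcases Nat.eq_zero_or_pos l with rfl | hl0
  · simp [delta_zero]
  rw [delta_mul_delta_eq_sum (N := l) (by omega) (Or.inr rfl) (fun _ => p ^ e * i)]
  · simp
  · intro A _ _ x y hx hy s _
    refine ⟨y ^ s, 0, 1, by simp, by simp, ?_⟩
    rw [pow_mul, add_pow_primePow k p, pow_eq_zero_of_le hl hy, add_zero, ← pow_mul, hx, zero_mul]
  · simp [mul_comm]

/-- The blocks are generated by the `y ^ s`, the largest one by `1`. -/
theorem delta_mul_delta_mul_add_one (j : ℕ) :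
    delta k (p ^ e) * delta k (p ^ e * j + 1) =
      delta k (p ^ e * (j + 1)) + (p ^ e - 1 : ℕ) * delta k (p ^ e * j) := by
  have hq : 0 < p ^ e := pow_pos hp.out.pos e
  rw [delta_mul_delta_eq_sum (N := p ^ e) hq.ne' (Or.inl rfl)
    (fun s => if s = 0 then p ^ e * (j + 1) else p ^ e * j)]
  · obtain ⟨q, hq'⟩ : ∃ q, p ^ e = q + 1 := ⟨p ^ e - 1, by omega⟩
    rw [hq', Finset.sum_range_succ']
    simp [add_comm]
  · intro A _ _ x y hx hy s _
    refine ⟨y ^ s, 0, 1, by simp, by simp, ?_⟩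
    split_ifs with h
    · rw [h, pow_zero, mul_one, pow_mul, add_pow_primePow k p, hx, zero_add, ← pow_mul]
      exact pow_eq_zero_of_le (by rw [mul_add, mul_one]; omega) hy
    · rw [pow_mul, add_pow_primePow k p, hx, zero_add, ← pow_mul, ← pow_add]
      exact pow_eq_zero_of_le (by omega) hy
  · obtain ⟨q, hq'⟩ : ∃ q, p ^ e = q + 1 := ⟨p ^ e - 1, by omega⟩
    rw [hq', Finset.sum_range_succ']
    simp
    ring

/-- The blocks are generated by `1`, the elements `x * y ^ s` and, for the smallest one,
`y ^ q - j * x ^ q` with `q = p ^ e`. -/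
theorem delta_add_one_mul_delta_mul {j : ℕ} (hj : ((j + 1 : ℕ) : k) ≠ 0) :
    delta k (p ^ e + 1) * delta k (p ^ e * (j + 1)) =
      delta k (p ^ e * (j + 2)) + delta k (p ^ e * j) +
        (p ^ e - 1 : ℕ) * delta k (p ^ e * (j + 1)) := by
  have hq : 0 < p ^ e := pow_pos hp.out.pos e
  rw [delta_mul_delta_eq_sum (N := p ^ e + 1) (by omega) (Or.inl rfl)
    (fun s => if s = 0 then p ^ e * (j + 2) else
      if s = p ^ e then p ^ e * j else p ^ e * (j + 1))]
  · rw [Finset.sum_range_succ]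
    obtain ⟨q, hq'⟩ : ∃ q, p ^ e = q + 1 := ⟨p ^ e - 1, by omega⟩
    rw [hq', Finset.sum_range_succ',
      Finset.sum_congr rfl (g := fun _ => delta k ((q + 1) * (j + 1)))
      (by
        intro s hs
        have := Finset.mem_range.1 hs
        rw [if_neg (by omega), if_neg (by omega)])]
    simp
    ring
  · intro A _ _ x y hx hy s hs
    have hX : (x ^ p ^ e) ^ 2 = 0 := by
      rw [← pow_mul]; exact pow_eq_zero_of_le (by omega) hx
    have hXx : x ^ p ^ e * x = 0 := by rw [← pow_succ, hx]
    have hZ : ∀ i, (x + y) ^ (p ^ e * (i + 1)) =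
        (y ^ p ^ e) ^ (i + 1) + (i + 1) * x ^ p ^ e * (y ^ p ^ e) ^ i := by
      intro i
      rw [pow_mul, add_pow_primePow k p, add_pow_succ_of_sq_eq_zero hX]
    have hY : (y ^ p ^ e) ^ (j + 1) = 0 := by rw [← pow_mul, hy]
    rcases Nat.eq_zero_or_pos s with rfl | hs0
    · refine ⟨1, 0, 1, by simp, by simp, ?_⟩
      rw [if_pos rfl, hZ (j + 1)]
      linear_combination (y ^ p ^ e + (((j + 1 : ℕ) : A) + 1) * x ^ p ^ e) * hY
    rw [if_neg (by omega)]
    split_ifs with h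
    · subst h
      refine ⟨y ^ p ^ e - j * x ^ p ^ e, - j * (x + y) ^ (p ^ e - 1), (j + 1 : ℕ), ?_, ?_, ?_⟩
      · exact_mod_cast hj
      · have : (x + y) * (x + y) ^ (p ^ e - 1) = x ^ p ^ e + y ^ p ^ e := by
          rw [← pow_succ', Nat.sub_add_cancel hq, add_pow_primePow k p]
        push_cast
        linear_combination (j : A) * this
      · rcases Nat.eq_zero_or_pos j with rfl | hj0
        · simpa using hY
        · obtain ⟨i, rfl⟩ : ∃ i, j = i + 1 := ⟨j - 1, by omega⟩
          rw [hZ]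
          push_cast
          linear_combination hY - ((i : A) + 1) ^ 2 * (y ^ p ^ e) ^ i * hX
    · obtain ⟨i, rfl⟩ : ∃ i, s = i + 1 := ⟨s - 1, by omega⟩
      refine ⟨x * y ^ i, y ^ i, (-1 : ℤ), by simp, by push_cast; ring, ?_⟩
      rw [hZ]
      linear_combination x * y ^ i * hY + ((j : A) + 1) * (y ^ p ^ e) ^ j * y ^ i * hXx
  · rw [Finset.sum_range_succ]
    obtain ⟨q, hq'⟩ : ∃ q, p ^ e = q + 1 := ⟨p ^ e - 1, by omega⟩
    rw [hq', Finset.sum_range_succ', Finset.sum_congr rfl (g := fun _ => (q + 1) * (j + 1))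
      (by
        intro s hs
        have := Finset.mem_range.1 hs
        rw [if_neg (by omega), if_neg (by omega)])]
    simp
    ring

/-- The blocks are generated by `1` and the elements `x * y ^ s`. -/
theorem delta_mul_add_one_mul_delta (i : ℕ) {l : ℕ} (hl0 : l ≠ 0) (hl : l ≤ p ^ e) :
    delta k (p ^ e * i + 1) * delta k l =
      delta k (p ^ e * i + l) + (l - 1 : ℕ) * delta k (p ^ e * i) := by
  rw [delta_mul_delta_eq_sum (N := l) hl0 (Or.inr rfl)
    (fun s => if s = 0 then p ^ e * i + l else p ^ e * i)]
  · obtain ⟨r, rfl⟩ : ∃ r, l = r + 1 := ⟨l - 1, by omega⟩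
    rw [Finset.sum_range_succ']
    simp [add_comm]
  · intro A _ _ x y hx hy s _
    have hZ : (x + y) ^ (p ^ e * i) = x ^ (p ^ e * i) := by
      rw [pow_mul, add_pow_primePow k p, pow_eq_zero_of_le hl hy, add_zero, ← pow_mul]
    have hXx : x ^ (p ^ e * i) * x = 0 := by rw [← pow_succ, hx]
    rcases Nat.eq_zero_or_pos s with rfl | hs0
    · refine ⟨1, 0, 1, by simp, by simp, ?_⟩
      rw [if_pos rfl, pow_add, hZ, mul_add_pow_of_mul_eq_zero hXx, hy, mul_zero, zero_mul]
    · obtain ⟨s, rfl⟩ : ∃ i, s = i + 1 := ⟨s - 1, by omega⟩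
      refine ⟨x * y ^ s, y ^ s, (-1 : ℤ), by simp, by push_cast; ring, ?_⟩
      rw [if_neg (by omega), hZ, ← mul_assoc, hXx, zero_mul]
  · obtain ⟨r, rfl⟩ : ∃ r, l = r + 1 := ⟨l - 1, by omega⟩
    rw [Finset.sum_range_succ']
    simp
    ring

/-- The blocks are generated by `1` and `y - n * x`. -/
theorem delta_two_mul_delta {n : ℕ} (hn : ((n + 1 : ℕ) : k) ≠ 0) :
    delta k 2 * delta k (n + 1) = delta k (n + 2) + delta k n := by
  rw [delta_mul_delta_eq_sum (N := 2) (by omega) (Or.inl rfl)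
    (fun s => if s = 0 then n + 2 else n)]
  · simp [Finset.sum_range_succ]
  · intro A _ _ x y hx hy s hs
    interval_cases s
    · refine ⟨1, 0, 1, by simp, by simp, ?_⟩
      rw [if_pos rfl, add_pow_succ_of_sq_eq_zero hx]
      linear_combination (y + (((n + 1 : ℕ) : A) + 1) * x) * hy
    · refine ⟨y - n * x, -n, (n + 1 : ℕ), by exact_mod_cast hn, by push_cast; ring, ?_⟩
      rw [if_neg (by omega)]
      rcases Nat.eq_zero_or_pos n with rfl | hn0
      · simpa using hy
      · obtain ⟨i, rfl⟩ : ∃ i, n = i + 1 := ⟨n - 1, by omega⟩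
        rw [add_pow_succ_of_sq_eq_zero hx]
        push_cast
        linear_combination hy - ((i : A) + 1) ^ 2 * y ^ i * hx
  · simp [Finset.sum_range_succ]
    ring

/-- The relations in `k[x, y] ⧸ (x ^ (q + 1), y ^ (q * (i + 1) + 1))`, `q = p ^ e`, behind the
decomposition of the product of blocks of size `q + 1` and `q * (i + 1) + 1`. -/
theorem exists_generator_of_pow_add_one (he : e ≠ 0) {i : ℕ} (hi : ((i + 1 : ℕ) : k) ≠ 0)
    {A : Type u} [CommRing A] [Algebra k A] {x y : A} (hx : x ^ (p ^ e + 1) = 0)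
    (hy : y ^ (p ^ e * (i + 1) + 1) = 0) {n : ℕ}
    (h1 : ∃ (g b : A) (c : ℤ), (c : k) ≠ 0 ∧ g = c * y ^ 1 + (x + y) * b ∧ (x + y) ^ n * g = 0)
    (n0 : ℕ) (h0 : (x + y) ^ n0 = 0) {s : ℕ} (hs : s < p ^ e + 1) :
    ∃ (g b : A) (c : ℤ), (c : k) ≠ 0 ∧ g = c * y ^ s + (x + y) * b ∧
      (x + y) ^ (if s = 0 then n0 else if s = 1 then n else if s = p ^ e then p ^ e * i + 1
        else p ^ e * (i + 1)) * g = 0 := by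
  have hq : 1 < p ^ e := Nat.one_lt_pow he hp.out.one_lt
  have hX : (x ^ p ^ e) ^ 2 = 0 := by
    rw [← pow_mul]; exact pow_eq_zero_of_le (by omega) hx
  have hXx : x ^ p ^ e * x = 0 := by rw [← pow_succ, hx]
  have hZ1 : (x + y) * (x + y) ^ (p ^ e - 1) = x ^ p ^ e + y ^ p ^ e := by
    rw [← pow_succ', Nat.sub_add_cancel hq.le, add_pow_primePow k p]
  have hZ : ∀ i, (x + y) ^ (p ^ e * (i + 1)) =
      (y ^ p ^ e) ^ (i + 1) + (i + 1) * x ^ p ^ e * (y ^ p ^ e) ^ i := by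
    intro i
    rw [pow_mul, add_pow_primePow k p, add_pow_succ_of_sq_eq_zero hX]
  have hY : (y ^ p ^ e) ^ (i + 1) * y = 0 := by rw [← pow_mul, ← pow_succ, hy]
  rcases Nat.eq_zero_or_pos s with rfl | hs0
  · exact ⟨1, 0, 1, by simp, by simp, by rw [if_pos rfl, h0, zero_mul]⟩
  rw [if_neg (by omega)]
  split_ifs with h h
  · rw [h]
    exact h1
  · subst h
    refine ⟨y * (x + y) ^ (p ^ e - 1) - (i + 1) * x ^ p ^ e,
      y * (x + y) ^ (p ^ e - 2) - (i + 1) * (x + y) ^ (p ^ e - 1), (i + 1 : ℕ), ?_, ?_, ?_⟩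
    · exact_mod_cast hi
    · have : (x + y) * (x + y) ^ (p ^ e - 2) = (x + y) ^ (p ^ e - 1) := by
        rw [← pow_succ']
        congr 1
        omega
      push_cast
      linear_combination ((i : A) + 1) * hZ1 - y * this
    · rcases Nat.eq_zero_or_pos i with rfl | hi0
      · have h2 := hY
        simp only [mul_zero, zero_add, pow_one, Nat.cast_zero, one_mul] at h2 ⊢
        linear_combination y * hZ1 - hXx + h2
      · obtain ⟨r, rfl⟩ : ∃ r, i = r + 1 := ⟨i - 1, by omega⟩
        rw [pow_succ, hZ]
        have hY' : (y ^ p ^ e) ^ (r + 1) * y ^ p ^ e * y = 0 := by rw [← pow_succ, hY]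
        push_cast
        linear_combination
          ((y ^ p ^ e) ^ (r + 1) + (r + 1) * x ^ p ^ e * (y ^ p ^ e) ^ r) * y * hZ1 + hY'
          + ((r : A) + 1) * (y ^ p ^ e) ^ r * y * hX
          - ((y ^ p ^ e) ^ (r + 1) + (r + 1) * x ^ p ^ e * (y ^ p ^ e) ^ r) * (r + 2) * hXx
          - (r + 2) * (r + 1) * (y ^ p ^ e) ^ r * y * hX
  · obtain ⟨s, rfl⟩ : ∃ r, s = r + 2 := ⟨s - 2, by omega⟩
    refine ⟨x * y ^ (s + 1), y ^ (s + 1), (-1 : ℤ), by simp, by push_cast; ring, ?_⟩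
    rw [hZ]
    linear_combination x * y ^ s * hY + ((i : A) + 1) * (y ^ p ^ e) ^ i * y ^ (s + 1) * hXx

theorem sum_range_add_one_ite {M : Type*} [AddCommMonoid M] (he : e ≠ 0) (f : ℕ → M)
    (n0 n1 n2 n3 : ℕ) :
    ∑ s ∈ Finset.range (p ^ e + 1),
      f (if s = 0 then n0 else if s = 1 then n1 else if s = p ^ e then n2 else n3) =
        f n0 + f n1 + f n2 + (p ^ e - 2) • f n3 := by
  have hq : 1 < p ^ e := Nat.one_lt_pow he hp.out.one_lt
  obtain ⟨q, hq'⟩ : ∃ q, p ^ e = q + 2 := ⟨p ^ e - 2, by omega⟩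
  rw [hq', Finset.sum_range_succ, Finset.sum_range_succ', Finset.sum_range_succ',
    Finset.sum_congr rfl (g := fun _ => f n3)
    (by
      intro s hs
      have := Finset.mem_range.1 hs
      rw [if_neg (by omega), if_neg (by omega), if_neg (by omega)])]
  simp
  abel

/-- The product of the blocks of size `q + 1` and `q * (i + 1) + 1`, where `q = p ^ e > 1` and
`i + 1 < p - 1`. -/
theorem delta_add_one_mul_delta_mul_add_one (he : e ≠ 0) {i : ℕ} (hi : ((i + 1 : ℕ) : k) ≠ 0)
    (hi' : ((i + 2 : ℕ) : k) ≠ 0) :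
    delta k (p ^ e + 1) * delta k (p ^ e * (i + 1) + 1) =
      delta k (p ^ e * (i + 2) + 1) + delta k (p ^ e * (i + 2) - 1) + delta k (p ^ e * i + 1) +
        (p ^ e - 2) • delta k (p ^ e * (i + 1)) := by
  have hq : 1 < p ^ e := Nat.one_lt_pow he hp.out.one_lt
  rw [← sum_range_add_one_ite p e he (delta k), delta_mul_delta_eq_sum (N := p ^ e + 1) (by omega)
    (Or.inl rfl)]
  · intro A _ _ x y hx hy s hs
    have hX : (x ^ p ^ e) ^ 2 = 0 := by
      rw [← pow_mul]; exact pow_eq_zero_of_le (by omega) hx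
    have hXx : x ^ p ^ e * x = 0 := by rw [← pow_succ, hx]
    have hZ : ∀ i, (x + y) ^ (p ^ e * (i + 1)) =
        (y ^ p ^ e) ^ (i + 1) + (i + 1) * x ^ p ^ e * (y ^ p ^ e) ^ i := by
      intro i
      rw [pow_mul, add_pow_primePow k p, add_pow_succ_of_sq_eq_zero hX]
    have hY : (y ^ p ^ e) ^ (i + 1) * y = 0 := by rw [← pow_mul, ← pow_succ, hy]
    have hYY : (y ^ p ^ e) ^ (i + 2) = 0 := by
      rw [← pow_mul]
      exact pow_eq_zero_of_le (by rw [mul_add, mul_add]; omega) hy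
    refine exists_generator_of_pow_add_one p e he hi hx hy ?_ _ ?_ hs
    · refine ⟨y - (i + 1) * x, - (i + 1), (i + 2 : ℕ), by exact_mod_cast hi',
        by push_cast; ring, ?_⟩
      have hn : p ^ e * (i + 2) - 1 = p ^ e * (i + 1) + (p ^ e - 1) := by
        rw [show i + 2 = (i + 1) + 1 by ring, mul_add (p ^ e) (i + 1) 1]
        omega
      rw [hn, pow_add, hZ]
      have e1 : ((y ^ p ^ e) ^ (i + 1) * x) * (x + y) ^ (p ^ e - 1) =
          (y ^ p ^ e) ^ (i + 1) * x ^ p ^ e := by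
        have := mul_add_pow_of_mul_eq_zero hY x (p ^ e - 1)
        rw [add_comm] at this
        have h2 : x * x ^ (p ^ e - 1) = x ^ p ^ e := by
          rw [← pow_succ', Nat.sub_add_cancel hq.le]
        linear_combination x * this + (y ^ p ^ e) ^ (i + 1) * h2
      have e2 : x ^ p ^ e * y * (x + y) ^ (p ^ e - 1) = x ^ p ^ e * y ^ p ^ e := by
        have := mul_add_pow_of_mul_eq_zero hXx y (p ^ e - 1)
        have h2 : y * y ^ (p ^ e - 1) = y ^ p ^ e := by
          rw [← pow_succ', Nat.sub_add_cancel hq.le]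
        linear_combination y * this + x ^ p ^ e * h2
      linear_combination (x + y) ^ (p ^ e - 1) * hY
        - ((i : A) + 1) ^ 2 * (y ^ p ^ e) ^ i * (x + y) ^ (p ^ e - 1) * hXx
        - ((i : A) + 1) * e1 + ((i : A) + 1) * (y ^ p ^ e) ^ i * e2
    · rw [pow_succ, hZ]
      linear_combination (x + y) * hYY + (((i + 1 : ℕ) : A) + 1) * ((y ^ p ^ e) ^ (i + 1) * hXx +
        x ^ p ^ e * hY)
  · have := sum_range_add_one_ite p e he id
    simp only [id] at this
    rw [this]
    obtain ⟨q, hq'⟩ : ∃ q, p ^ e = q + 2 := ⟨p ^ e - 2, by omega⟩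
    have h3 : (q + 2) * (i + 2) - 1 + 1 = (q + 2) * (i + 2) :=
      Nat.sub_add_cancel (Nat.mul_pos (by omega) (by omega))
    rw [hq', Nat.add_sub_cancel, smul_eq_mul]
    linear_combination h3

/-- The product of the blocks of size `q + 1` and `q * (i + 1) + 1`, where `q = p ^ e > 1` and
`i + 1 = p - 1`. -/
theorem delta_add_one_mul_delta_mul_add_one' (he : e ≠ 0) {i : ℕ} (hi : i + 2 = p) :
    delta k (p ^ e + 1) * delta k (p ^ e * (i + 1) + 1) =
      2 * delta k (p ^ e * (i + 2)) + delta k (p ^ e * i + 1) +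
        (p ^ e - 2) • delta k (p ^ e * (i + 1)) := by
  have hq : 1 < p ^ e := Nat.one_lt_pow he hp.out.one_lt
  have hi' : ((i + 1 : ℕ) : k) ≠ 0 := by
    rw [Ne, CharP.cast_eq_zero_iff k p]
    exact Nat.not_dvd_of_pos_of_lt (by omega) (by omega)
  rw [two_mul, ← sum_range_add_one_ite p e he (delta k),
    delta_mul_delta_eq_sum (N := p ^ e + 1) (by omega) (Or.inl rfl)]
  · intro A _ _ x y hx hy s hs
    have h0 : (x + y) ^ (p ^ e * (i + 2)) = 0 := by
      have hpe : p ^ (e + 1) = p ^ e * (i + 2) := by rw [hi, pow_succ]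
      rw [← hpe, add_pow_primePow k p, hpe, pow_eq_zero_of_le _ hx, pow_eq_zero_of_le _ hy,
        add_zero]
      · rw [mul_add, mul_add]; omega
      · rw [mul_add]; omega
    refine exists_generator_of_pow_add_one p e he hi' hx hy
      ⟨y, 0, 1, by simp, by simp, by rw [h0, zero_mul]⟩ _ h0 hs
  · have := sum_range_add_one_ite p e he id
    simp only [id] at this
    rw [this]
    obtain ⟨q, hq'⟩ : ∃ q, p ^ e = q + 2 := ⟨p ^ e - 2, by omega⟩
    rw [hq', Nat.add_sub_cancel, smul_eq_mul]
    ring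

variable (k) in
theorem sum_add_pow_mul_pow {A : Type u} [CommRing A] [Algebra k A] (x y : A) :
    ∑ r ∈ Finset.range (p ^ e), (x + y) ^ r * y ^ (p ^ e - 1 - r) = x ^ (p ^ e - 1) := by
  have hq : 0 < p ^ e := pow_pos hp.out.pos e
  -- the identity holds in the polynomial ring, where `x` can be cancelled
  have h : ∑ r ∈ Finset.range (p ^ e), ((MvPolynomial.X 0 : MvPolynomial (Fin 2) k) +
      MvPolynomial.X 1) ^ r * (MvPolynomial.X 1) ^ (p ^ e - 1 - r) =
        (MvPolynomial.X 0) ^ (p ^ e - 1) := by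
    refine mul_right_cancel₀ (MvPolynomial.X_ne_zero (R := k) (0 : Fin 2)) ?_
    have h1 := geom_sum₂_mul ((MvPolynomial.X 0 : MvPolynomial (Fin 2) k) + MvPolynomial.X 1)
      (MvPolynomial.X 1) (p ^ e)
    rw [add_sub_cancel_right, add_pow_primePow k p, add_sub_cancel_right] at h1
    rw [h1, ← pow_succ, Nat.sub_add_cancel hq]
  have h2 := congrArg (MvPolynomial.aeval ![x, y]) h
  simpa using h2

/-- The smallest block is generated by `((x + y) ^ l - y ^ l) / x`, the others by the `y ^ s`. For
`q = p ^ e` the product of that element with `(x + y) ^ (q - l)` is `((x + y) ^ q - y ^ q) / x`,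
that is `x ^ (q - 1)`, up to multiples of `y ^ l`. -/
theorem delta_sub_one_mul_delta {l : ℕ} (hl0 : l ≠ 0) (hl : l ≤ p ^ e) :
    delta k (p ^ e - 1) * delta k l =
      delta k (p ^ e - l) + (l - 1 : ℕ) * delta k (p ^ e) := by
  have hq : 0 < p ^ e := pow_pos hp.out.pos e
  obtain ⟨r, rfl⟩ : ∃ r, l = r + 1 := ⟨l - 1, by omega⟩
  rw [delta_mul_delta_eq_sum (N := r + 1) hl0 (Or.inr rfl)
    (fun s => if s = r then p ^ e - (r + 1) else p ^ e)]
  · rw [Finset.sum_range_succ, if_pos rfl, Finset.sum_congr rfl (g := fun _ => delta k (p ^ e))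
      (fun s hs => by rw [if_neg (Finset.mem_range.1 hs).ne])]
    simp [add_comm]
  · intro A _ _ x y hx hy s hs
    split_ifs with h
    · subst h
      refine ⟨∑ i ∈ Finset.range (s + 1), (x + y) ^ i * y ^ (s - i),
        ∑ i ∈ Finset.range s, (x + y) ^ i * y ^ (s - (i + 1)), 1, by simp, ?_, ?_⟩
      · rw [Finset.sum_range_succ', Finset.mul_sum, add_comm]
        simp [pow_succ', mul_assoc]
      · have h1 := sum_add_pow_mul_pow k p e x y
        rw [hx] at h1
        obtain ⟨t, ht⟩ : ∃ t, p ^ e = t + (s + 1) := ⟨p ^ e - (s + 1), by omega⟩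
        rw [ht, Finset.sum_range_add, Finset.sum_eq_zero, zero_add] at h1
        · rw [ht, Nat.add_sub_cancel, Finset.mul_sum, ← h1]
          refine Finset.sum_congr rfl fun i _ => ?_
          rw [← mul_assoc, ← pow_add]
          congr 2
          omega
        · intro i hi
          have := Finset.mem_range.1 hi
          rw [pow_eq_zero_of_le (by omega) hy, mul_zero]
    · refine ⟨y ^ s, 0, 1, by simp, by simp, ?_⟩
      rw [add_pow_primePow k p, pow_eq_zero_of_le (by omega) hx, pow_eq_zero_of_le hl hy, add_zero,
        zero_mul]
  · rw [Finset.sum_range_succ, if_pos rfl, Finset.sum_congr rfl (g := fun _ => p ^ e)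
      (fun s hs => by rw [if_neg (Finset.mem_range.1 hs).ne])]
    obtain ⟨t, ht⟩ : ∃ t, p ^ e = t + (r + 1) := ⟨p ^ e - (r + 1), by omega⟩
    rw [ht, Nat.add_sub_cancel, ← add_assoc, Nat.add_sub_cancel]
    simp
    ring

end

/-! ### Induction and restriction along `T ↦ T ^ q` -/

theorem inv_pi {ι : Type} [Fintype ι] (M : ι → EndoMod k) (f : additiveInvariants k) :
    f (pi M) = ∑ i, f (M i) := by
  have h1 := congrArg (fun x => (toOp x f) (unit k)) (cls_pi M)
  have h2 : ∀ N : EndoMod k, (tensorOp N f) (unit k) = f N := fun N =>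
    inv_iso f ((tensor_comm _ _).trans (unit_tensor N))
  simp only [map_sum, toOp_cls, h2] at h1
  rw [h1]
  have h3 : ∀ s : Finset ι, ((∑ i ∈ s, tensorOp (M i)) f) (unit k) = ∑ i ∈ s, f (M i) := by
    intro s
    induction s using Finset.cons_induction with
    | empty => rfl
    | cons a s ha ih =>
      rw [Finset.sum_cons, Finset.sum_cons, ← ih, ← h2 (M a)]
      rfl
  exact h3 _

/-- Restriction of scalars along `k[T] → k[T]`, `T ↦ T ^ q`. -/
def res (q : ℕ) (M : EndoMod k) : EndoMod k where
  carrier := M.carrier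
  T := M.T ^ q

/-- Extension of scalars along `k[T] → k[T]`, `T ↦ T ^ (n + 1)`: the module `M ^ (n + 1)`, on which
`T` shifts the summands cyclically and acts as the original operator when passing from the last
summand to the first. -/
def ind (n : ℕ) (M : EndoMod k) : EndoMod k where
  carrier := Fin (n + 1) → M.carrier
  T :=
    { toFun := fun f => Fin.cons (α := fun _ => M.carrier) (M.T (f (Fin.last n))) (Fin.init f)
      map_add' := fun f g => by
        funext i
        refine Fin.cases ?_ (fun i => ?_) i
        · exact map_add M.T _ _
        · rfl
      map_smul' := fun c f => by
        funext i
        refine Fin.cases ?_ (fun i => ?_) i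
        · exact map_smul M.T _ _
        · rfl }

theorem pow_T_comm {M N : EndoMod k} {f : M.carrier → N.carrier}
    (h : ∀ v, f (M.T v) = N.T (f v)) (q : ℕ) (v : M.carrier) :
    f ((M.T ^ q) v) = (N.T ^ q) (f v) := by
  induction q with
  | zero => rfl
  | succ q ih => rw [pow_succ', pow_succ', Module.End.mul_apply, Module.End.mul_apply, h, ih]

theorem res_congr (q : ℕ) (M N : EndoMod k) (h : Iso M N) : Iso (res q M) (res q N) := by
  obtain ⟨e, he⟩ := h
  exact ⟨e, pow_T_comm he q⟩

theorem res_prod (q : ℕ) (M N : EndoMod k) : Iso (res q (prod M N)) (prod (res q M) (res q N)) :=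
  ⟨LinearEquiv.refl k _, fun v => Prod.ext
    (pow_T_comm (M := prod M N) (N := M) (f := fun x : M.carrier × N.carrier => x.1)
      (fun _ => rfl) q v)
    (pow_T_comm (M := prod M N) (N := N) (f := fun x : M.carrier × N.carrier => x.2)
      (fun _ => rfl) q v)⟩

theorem ind_congr (n : ℕ) (M N : EndoMod k) (h : Iso M N) : Iso (ind n M) (ind n N) := by
  obtain ⟨e, he⟩ := h
  refine ⟨LinearEquiv.piCongrRight fun _ => e, fun v => ?_⟩
  funext i
  refine Fin.cases ?_ (fun i => ?_) i
  · exact he _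
  · rfl

theorem ind_prod (n : ℕ) (M N : EndoMod k) :
    Iso (ind n (prod M N)) (prod (ind n M) (ind n N)) := by
  refine ⟨{ toFun := fun f => (fun i => (f i).1, fun i => (f i).2)
            invFun := fun f i => (f.1 i, f.2 i)
            map_add' := fun _ _ => rfl
            map_smul' := fun _ _ => rfl }, fun v => Prod.ext ?_ ?_⟩ <;>
  · funext i
    refine Fin.cases rfl (fun i => rfl) i

/-- The action of `res` on additive invariants. -/
def resOp (k : Type u) [Field k] (q : ℕ) : AddMonoid.End (additiveInvariants k) :=
  pullback (res q) (res_congr q) (res_prod q)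

/-- The action of `ind` on additive invariants. -/
def indOp (k : Type u) [Field k] (n : ℕ) : AddMonoid.End (additiveInvariants k) :=
  pullback (ind n) (ind_congr n) (ind_prod n)

/-- The inclusion of `M` in the first summand of `ind n M`. -/
def toInd (n : ℕ) (M : EndoMod k) : M.carrier →ₗ[k] (ind n M).carrier :=
  LinearMap.single k (fun _ : Fin (n + 1) => M.carrier) 0

theorem ind_T_pow_toInd (n : ℕ) (M : EndoMod k) (m : M.carrier) (r : ℕ) (hr : r < n + 1) :
    ((ind n M).T ^ r) (toInd n M m) =
      (Pi.single ⟨r, hr⟩ m : Fin (n + 1) → M.carrier) := by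
  induction r with
  | zero => rfl
  | succ r ih =>
    rw [pow_succ', Module.End.mul_apply, ih (by omega)]
    funext i
    refine Fin.cases ?_ (fun i => ?_) i
    · change M.T ((Pi.single (⟨r, _⟩ : Fin (n + 1)) m : Fin (n + 1) → M.carrier) (Fin.last n)) = _
      rw [Pi.single_eq_of_ne, map_zero, Pi.single_eq_of_ne]
      · exact fun h => absurd (congrArg Fin.val h) (by simp)
      · exact fun h => absurd (congrArg Fin.val h) (by simp; omega)
    · change (Pi.single (⟨r, _⟩ : Fin (n + 1)) m : Fin (n + 1) → M.carrier) i.castSucc = _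
      rw [Pi.single_apply, Pi.single_apply]
      simp [Fin.ext_iff]

theorem ind_T_pow_self_toInd (n : ℕ) (M : EndoMod k) (m : M.carrier) :
    ((ind n M).T ^ (n + 1)) (toInd n M m) = toInd n M (M.T m) := by
  rw [pow_succ', Module.End.mul_apply, ind_T_pow_toInd n M m n (by omega)]
  funext i
  refine Fin.cases ?_ (fun i => ?_) i
  · change M.T ((Pi.single (Fin.last n) m : Fin (n + 1) → M.carrier) (Fin.last n)) =
      (Pi.single 0 (M.T m) : Fin (n + 1) → M.carrier) 0
    rw [Pi.single_eq_same, Pi.single_eq_same]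
  · change (Pi.single (Fin.last n) m : Fin (n + 1) → M.carrier) i.castSucc =
      (Pi.single 0 (M.T m) : Fin (n + 1) → M.carrier) i.succ
    rw [Pi.single_eq_of_ne (Fin.castSucc_ne_last i), Pi.single_eq_of_ne (Fin.succ_ne_zero i)]

/-- A property which is stable under addition and which holds for the images of the elements of the
first summand under the powers of `T` holds on all of `ind n M`. -/
theorem ind_induction {n : ℕ} {M : EndoMod k} {S : (ind n M).carrier → Prop}
    (hadd : ∀ v w, S v → S w → S (v + w)) (h : ∀ m r, S (((ind n M).T ^ r) (toInd n M m)))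
    (f : (ind n M).carrier) : S f := by
  classical
  have h1 : ∀ s : Finset (Fin (n + 1)),
      S (∑ i ∈ s, Pi.single i (f i) : Fin (n + 1) → M.carrier) := by
    intro s
    induction s using Finset.cons_induction with
    | empty =>
      have := h 0 0
      rw [map_zero, map_zero] at this
      exact this
    | cons a s ha ih =>
      rw [Finset.sum_cons]
      refine hadd _ _ ?_ ih
      rw [← ind_T_pow_toInd n M (f a) a a.2]
      exact h _ _
  have h2 := h1 Finset.univ
  have h3 : ∑ i, Pi.single i (f i) = (f : Fin (n + 1) → M.carrier) := Finset.univ_sum_single _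
  exact h3 ▸ h2

theorem ind_T_pow_self (n : ℕ) (M : EndoMod k) (f : Fin (n + 1) → M.carrier) :
    ((ind n M).T ^ (n + 1)) f = fun i => M.T (f i) := by
  let g : (ind n M).carrier →ₗ[k] (ind n M).carrier :=
    LinearMap.pi fun i => M.T ∘ₗ LinearMap.proj i
  have hg : ∀ v, g ((ind n M).T v) = (ind n M).T (g v) := by
    intro v
    funext i
    refine Fin.cases rfl (fun i => rfl) i
  refine ind_induction (S := fun f => ((ind n M).T ^ (n + 1)) f = g f) ?_ ?_ f
  · intro v w hv hw
    rw [map_add, hv, hw, map_add]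
  · intro m r
    rw [← Module.End.mul_apply, ← pow_add, add_comm, pow_add, Module.End.mul_apply,
      ind_T_pow_self_toInd, pow_T_comm hg]
    congr 1
    funext i
    change (Pi.single 0 (M.T m) : Fin (n + 1) → M.carrier) i =
      M.T ((Pi.single 0 m : Fin (n + 1) → M.carrier) i)
    rw [Pi.single_apply, Pi.single_apply]
    split_ifs <;> simp

/-- An induced module restricts to `n + 1` copies of the original one. -/
theorem indOp_mul_resOp (n : ℕ) :
    indOp k n * resOp k (n + 1) = ((n + 1 : ℕ) : AddMonoid.End _) := by
  refine AddMonoidHom.ext fun f => inv_ext fun M => ?_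
  have h : Iso (res (n + 1) (ind n M)) (pi fun _ : Fin (n + 1) => M) :=
    ⟨LinearEquiv.refl k _, fun v => ind_T_pow_self n M v⟩
  change f (res (n + 1) (ind n M)) = _
  rw [inv_iso f h, inv_pi, Finset.sum_const, Finset.card_univ, Fintype.card_fin]
  exact congrArg (fun g : additiveInvariants k => g M) (AddMonoid.End.natCast_apply (n + 1) f).symm

/-- Restriction along `T ↦ T ^ q` is compatible with tensor products, as `q` is a power of `p`. -/
theorem res_tensor (p : ℕ) [Fact p.Prime] [CharP k p] (e : ℕ) (M N : EndoMod k) :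
    (tensor M N).T ^ p ^ e = (tensor (res (p ^ e) M) (res (p ^ e) N)).T := by
  have hc : Commute (M.T.rTensor N.carrier) (N.T.lTensor M.carrier) := by
    refine TensorProduct.ext' fun m n => ?_
    rfl
  rcases subsingleton_or_nontrivial (M.carrier ⊗[k] N.carrier) with h | h
  · exact LinearMap.ext fun v => h.elim _ _
  have : CharP (Module.End k (M.carrier ⊗[k] N.carrier)) p :=
    charP_of_injective_algebraMap
      (algebraMap k (Module.End k (M.carrier ⊗[k] N.carrier))).injective p
  change (M.T.rTensor N.carrier + N.T.lTensor M.carrier) ^ p ^ e =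
    (M.T ^ p ^ e).rTensor N.carrier + (N.T ^ p ^ e).lTensor M.carrier
  rw [add_pow_char_pow_of_commute p e hc, ← LinearMap.rTensor_pow, ← LinearMap.lTensor_pow]

/-- Morphisms from `ind n M` to `N` correspond to maps from `M` to `N` compatible with `T` and
`T ^ (n + 1)`; a criterion for such a morphism to be an isomorphism. -/
theorem ind_iso {n : ℕ} {M N : EndoMod k} (h : M.carrier →ₗ[k] N.carrier)
    (hT : ∀ m, h (M.T m) = (N.T ^ (n + 1)) (h m))
    (hspan : ∀ S : Submodule k N.carrier, (∀ m, h m ∈ S) → (∀ v ∈ S, N.T v ∈ S) → S = ⊤)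
    (hdim : (n + 1) * Module.finrank k M.carrier = Module.finrank k N.carrier) :
    Iso (ind n M) N := by
  let F : (Fin (n + 1) → M.carrier) →ₗ[k] N.carrier :=
    ∑ i : Fin (n + 1), (N.T ^ (i : ℕ)) ∘ₗ h ∘ₗ LinearMap.proj i
  have hF : ∀ f, F f = ∑ i : Fin (n + 1), (N.T ^ (i : ℕ)) (h (f i)) := fun f => by simp [F]
  have hFT : ∀ f : Fin (n + 1) → M.carrier, F ((ind n M).T f) = N.T (F f) := by
    intro f
    refine (hF _).trans ?_
    rw [hF, Fin.sum_univ_succ, Fin.sum_univ_castSucc, map_add, map_sum, add_comm]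
    congr 1
    · refine Finset.sum_congr rfl fun i _ => ?_
      rw [Fin.val_succ, pow_succ', Module.End.mul_apply]
      rfl
    · change (N.T ^ 0) (h (M.T (f (Fin.last n)))) = _
      rw [hT, pow_succ', pow_zero]
      rfl
  have hsurj : LinearMap.range F = ⊤ := by
    refine hspan _ (fun m => ⟨Pi.single 0 m, ?_⟩) ?_
    · rw [hF, Finset.sum_eq_single 0]
      · rw [Pi.single_eq_same]
        rfl
      · intro i _ hi
        rw [Pi.single_eq_of_ne hi, map_zero, map_zero]
      · simp
    · rintro _ ⟨v, rfl⟩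
      exact ⟨_, hFT v⟩
  have hsurj' : Function.Surjective F := LinearMap.range_eq_top.1 hsurj
  have hfin : Module.finrank k (Fin (n + 1) → M.carrier) = Module.finrank k N.carrier := by
    rw [Module.finrank_pi_fintype, ← hdim]
    simp
  exact ⟨LinearEquiv.ofBijective F
    ⟨(LinearMap.injective_iff_surjective_of_finrank_eq_finrank hfin).2 hsurj', hsurj'⟩, hFT⟩

/-- The projection formula for `ind` and `res`. -/
theorem ind_tensor (p : ℕ) [Fact p.Prime] [CharP k p] {e n : ℕ} (hn : n + 1 = p ^ e)
    (M N : EndoMod k) : Iso (ind n (tensor M (res (n + 1) N))) (tensor (ind n M) N) := by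
  refine ind_iso (M := tensor M (res (n + 1) N)) (N := tensor (ind n M) N)
    ((toInd n M).rTensor N.carrier) ?_ ?_ ?_
  · refine tensor_comm_of_tmul (N := res (n + 1) N) (P := res (n + 1) (tensor (ind n M) N))
      ((toInd n M).rTensor N.carrier) fun m v => ?_
    have h1 := LinearMap.congr_fun (res_tensor p e (ind n M) N)
      (toInd n M m ⊗ₜ[k] (show N.carrier from v))
    rw [← hn] at h1
    refine Eq.trans ?_ h1.symm
    change (toInd n M (M.T m)) ⊗ₜ[k] (show N.carrier from v) +
        toInd n M m ⊗ₜ[k] (N.T ^ (n + 1)) (show N.carrier from v) =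
      ((ind n M).T ^ (n + 1)) (toInd n M m) ⊗ₜ[k] (show N.carrier from v) +
        toInd n M m ⊗ₜ[k] (N.T ^ (n + 1)) (show N.carrier from v)
    rw [ind_T_pow_self_toInd]
  · intro S h0 hS
    have h1 : ∀ r m v, (((ind n M).T ^ r) (toInd n M m)) ⊗ₜ[k] v ∈ S := by
      intro r
      induction r with
      | zero => exact fun m v => h0 (m ⊗ₜ v)
      | succ r ih =>
        intro m v
        have h2 := S.sub_mem (hS _ (ih m v)) (ih m (N.T v))
        have h3 : (tensor (ind n M) N).T (((ind n M).T ^ r) (toInd n M m) ⊗ₜ[k] v) =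
            (((ind n M).T ^ (r + 1)) (toInd n M m)) ⊗ₜ[k] v +
              ((ind n M).T ^ r) (toInd n M m) ⊗ₜ[k] N.T v := by
          rw [tensor_T_tmul, pow_succ', Module.End.mul_apply]
          rfl
        rw [h3] at h2
        have h4 := add_sub_cancel_right ((((ind n M).T ^ (r + 1)) (toInd n M m)) ⊗ₜ[k] v)
          (((ind n M).T ^ r) (toInd n M m) ⊗ₜ[k] N.T v)
        exact h4 ▸ h2
    refine eq_top_iff.2 fun w _ => ?_
    induction w using TensorProduct.induction_on with
    | zero => exact S.zero_mem
    | add v w hv hw => exact S.add_mem (hv trivial) (hw trivial)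
    | tmul f v =>
      refine ind_induction (S := fun f => f ⊗ₜ[k] v ∈ S) ?_ (fun m r => h1 r m v) f
      intro v w hv hw
      rw [add_tmul]
      exact S.add_mem hv hw
  · change (n + 1) * Module.finrank k (M.carrier ⊗[k] N.carrier) =
      Module.finrank k ((Fin (n + 1) → M.carrier) ⊗[k] N.carrier)
    rw [Module.finrank_tensorProduct, Module.finrank_tensorProduct, Module.finrank_pi_fintype]
    simp [mul_assoc]

/-- Induction preserves the dimension of the kernel of `T`. -/
theorem indOp_kerDim (n : ℕ) : indOp k n kerDim = kerDim := by
  refine inv_ext fun M => ?_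
  change (Module.finrank k (LinearMap.ker (ind n M).T) : ℤ) = Module.finrank k (LinearMap.ker M.T)
  congr 1
  have hT : ∀ f : Fin (n + 1) → M.carrier, (ind n M).T f = 0 ↔
      M.T (f (Fin.last n)) = 0 ∧ ∀ i : Fin n, f i.castSucc = 0 := by
    intro f
    constructor
    · exact fun h => ⟨congrFun h 0, fun i => congrFun h i.succ⟩
    · rintro ⟨h1, h2⟩
      funext i
      exact Fin.cases h1 h2 i
  refine LinearEquiv.finrank_eq
    { toFun := fun f => ⟨(f.1 : Fin (n + 1) → M.carrier) (Fin.last n), ((hT f.1).1 f.2).1⟩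
      invFun := fun m => ⟨(Pi.single (Fin.last n) m.1 : Fin (n + 1) → M.carrier), ?_⟩
      map_add' := fun _ _ => rfl
      map_smul' := fun _ _ => rfl
      left_inv := ?_
      right_inv := ?_ }
  · refine (hT _).2 ⟨?_, fun i => Pi.single_eq_of_ne (Fin.castSucc_ne_last i) _⟩
    rw [Pi.single_eq_same]
    exact m.2
  · intro f
    refine Subtype.ext (funext fun i => ?_)
    refine Fin.lastCases ?_ (fun i => ?_) i
    · exact Pi.single_eq_same _ _
    · exact (Pi.single_eq_of_ne (Fin.castSucc_ne_last i) _).trans (((hT f.1).1 f.2).2 i).symm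
  · intro m
    exact Subtype.ext (Pi.single_eq_same _ _)

/-! ### Powers of the class of an induced module -/

theorem tensorOp_mul_resOp (p : ℕ) [Fact p.Prime] [CharP k p] (e : ℕ) (M : EndoMod k) :
    tensorOp M * resOp k (p ^ e) = resOp k (p ^ e) * tensorOp (res (p ^ e) M) := by
  refine AddMonoidHom.ext fun f => inv_ext fun N => ?_
  change f (res (p ^ e) (tensor M N)) = f (tensor (res (p ^ e) M) (res (p ^ e) N))
  exact inv_iso f ⟨LinearEquiv.refl k (M.carrier ⊗[k] N.carrier),
    fun v => congrArg (fun g : Module.End k (M.carrier ⊗[k] N.carrier) => g v)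
      (res_tensor p e M N)⟩

/-- The projection formula in terms of operators on additive invariants. -/
theorem tensorOp_ind (p : ℕ) [Fact p.Prime] [CharP k p] {e n : ℕ} (hn : n + 1 = p ^ e)
    (M : EndoMod k) : tensorOp (ind n M) = resOp k (n + 1) * tensorOp M * indOp k n := by
  refine AddMonoidHom.ext fun f => inv_ext fun N => ?_
  exact (inv_iso f (ind_tensor p hn M N)).symm

section

variable (p : ℕ) [hp : Fact p.Prime] [CharP k p] {e n : ℕ}

theorem toOp_cls_ind_pow (hn : n + 1 = p ^ e) (M : EndoMod k) (m : ℕ) :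
    toOp (cls (ind n M) ^ (m + 1)) =
    ((n + 1 : ℕ) : AddMonoid.End (additiveInvariants k)) ^ m *
      (resOp k (n + 1) * toOp (cls M ^ (m + 1)) * indOp k n) := by
  induction m with
  | zero => simp [tensorOp_ind p hn]
  | succ m ih =>
    have hc : ∀ x : AddMonoid.End (additiveInvariants k), x * ((n + 1 : ℕ) :
        AddMonoid.End (additiveInvariants k)) = ((n + 1 : ℕ) :
        AddMonoid.End (additiveInvariants k)) * x := fun x => (Nat.cast_commute _ x).symm.eq
    rw [pow_succ, map_mul, ih, toOp_cls, tensorOp_ind p hn, pow_succ (cls M) (m + 1),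
      map_mul toOp (cls M ^ (m + 1)), toOp_cls]
    calc _ = ((n + 1 : ℕ) : AddMonoid.End (additiveInvariants k)) ^ m *
          (resOp k (n + 1) * toOp (cls M ^ (m + 1)) * (indOp k n * resOp k (n + 1)) *
            tensorOp M * indOp k n) := by simp only [mul_assoc]
      _ = _ := by
        rw [indOp_mul_resOp, hc, pow_succ ((n + 1 : ℕ) : AddMonoid.End (additiveInvariants k)) m]
        simp only [mul_assoc]

theorem rk_cls_ind_pow (hn : n + 1 = p ^ e) (M : EndoMod k) (m : ℕ) :
    rk (cls (ind n M) ^ (m + 1)) = (n + 1 : ℕ) ^ m * rk (cls M ^ (m + 1)) := by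
  have hunit : Iso (res (n + 1) (unit k)) (unit k) := by
    refine ⟨LinearEquiv.refl k k, fun v => ?_⟩
    change ((0 : Module.End k k) ^ (n + 1)) v = (0 : Module.End k k) v
    rw [zero_pow (by omega)]
  have h1 : rk (cls (ind n M) ^ (m + 1)) =
      (toOp (cls (ind n M) ^ (m + 1)) kerDim) (unit k) := rfl
  rw [h1, toOp_cls_ind_pow p hn, ← Nat.cast_pow]
  have h2 := AddMonoid.End.natCast_apply ((n + 1) ^ m)
    ((resOp k (n + 1) * toOp (cls M ^ (m + 1)) * indOp k n) kerDim)
  refine (congrArg (fun g : additiveInvariants k => g (unit k)) h2).trans ?_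
  change ((n + 1) ^ m) • ((toOp (cls M ^ (m + 1)) (indOp k n kerDim)) (res (n + 1) (unit k))) = _
  rw [indOp_kerDim, inv_iso _ hunit, nsmul_eq_mul]
  push_cast
  rfl

/-- If `N` restricts to a sum of copies of `M`, then tensoring with `N` and with the module induced
by `M` have the same effect on the latter. -/
theorem cls_ind_mul (hn : n + 1 = p ^ e) (M N : EndoMod k)
    (h : cls (res (n + 1) N) = (n + 1 : ℕ) * cls M) :
    cls (ind n M) * cls N = cls (ind n M) * cls (ind n M) := by
  rw [mul_comm _ (cls N)]
  refine toOp_injective ?_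
  have hc : ∀ x : AddMonoid.End (additiveInvariants k), x * ((n + 1 : ℕ) :
      AddMonoid.End (additiveInvariants k)) = ((n + 1 : ℕ) :
      AddMonoid.End (additiveInvariants k)) * x := fun x => (Nat.cast_commute _ x).symm.eq
  have h' : tensorOp (res (n + 1) N) = (n + 1 : ℕ) * tensorOp M := by
    have := congrArg toOp h
    rwa [map_mul, map_natCast] at this
  have h2 := tensorOp_mul_resOp p e N
  rw [← hn, h'] at h2
  rw [map_mul, map_mul, toOp_cls, toOp_cls, tensorOp_ind p hn]
  calc _ = (tensorOp N * resOp k (n + 1)) * tensorOp M * indOp k n := by simp only [mul_assoc]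
    _ = resOp k (n + 1) * tensorOp M * (indOp k n * resOp k (n + 1)) * tensorOp M * indOp k n := by
      rw [h2, indOp_mul_resOp, ← hc (tensorOp M)]
      simp only [mul_assoc]
    _ = _ := by simp only [mul_assoc]

end

theorem cls_ind_jordan (n i : ℕ) : cls (ind n (jordan k i)) = delta k ((n + 1) * i) := by
  have hpow : ∀ f, ((ind n (jordan k i)).T ^ ((n + 1) * i)) f = 0 := by
    intro f
    rw [pow_mul]
    have h := pow_T_comm (M := res (n + 1) (ind n (jordan k i)))
      (N := pi fun _ : Fin (n + 1) => jordan k i) (f := fun f => f) (ind_T_pow_self n _) i f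
    refine h.trans (funext fun j => ?_)
    have h2 := pow_T_comm (M := pi fun _ : Fin (n + 1) => jordan k i)
      (N := jordan k i) (f := fun f => f j) (fun _ => rfl) i f
    refine h2.trans ?_
    rw [jordan_T_pow]
    rfl
  rw [cls_eq_sum_delta _ ⟨_, LinearMap.ext hpow⟩ (fun _ : Unit => (n + 1) * i)
    (fun _ => toInd n (jordan k i) (jordanOne k i))
    (fun _ => hpow _)]
  · simp
  · intro f
    obtain ⟨c, w, hw⟩ := jordan_eq_smul_add i ((f : Fin (n + 1) → (jordan k i).carrier) 0)
    refine ⟨fun _ => c, (Fin.snoc (α := fun _ => (jordan k i).carrier)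
      (fun j : Fin n => (f : Fin (n + 1) → (jordan k i).carrier) j.succ) w :
        Fin (n + 1) → (jordan k i).carrier), ?_⟩
    rw [Fintype.sum_unique]
    funext j
    refine Fin.cases ?_ (fun j => ?_) j
    · refine hw.trans (congrArg₂ (· + ·) rfl (congrArg _ ?_))
      exact (Fin.snoc_last (α := fun _ => (jordan k i).carrier) _ _).symm
    · have h1 : (toInd n (jordan k i) (jordanOne k i) : Fin (n + 1) → (jordan k i).carrier) j.succ =
          0 := Pi.single_eq_of_ne (M := fun _ => (jordan k i).carrier)
            (Fin.succ_ne_zero j) (jordanOne k i)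
      have h2 : (Fin.snoc (α := fun _ => (jordan k i).carrier)
          (fun j : Fin n => (f : Fin (n + 1) → (jordan k i).carrier) j.succ) w :
            Fin (n + 1) → (jordan k i).carrier) j.castSucc =
              (f : Fin (n + 1) → (jordan k i).carrier) j.succ :=
        Fin.snoc_castSucc (α := fun _ => (jordan k i).carrier) w _ j
      refine (h2.symm.trans (zero_add _).symm).trans (congrArg₂ (· + ·) ?_ rfl)
      exact (smul_zero c).symm.trans (congrArg (fun z => c • z) h1.symm)
  · rw [Fintype.sum_unique]
    change _ = Module.finrank k (Fin (n + 1) → (jordan k i).carrier)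
    rw [Module.finrank_pi_fintype]
    have : Module.finrank k (jordan k i).carrier = i := finrank_jordan i
    simp [this]

/-! ### The module `k[x] ⧸ (x ^ q)` with `T = x ^ 2` -/

/-- Multiplication by `x ^ j` on `k[x] ⧸ (x ^ N)`: the blocks are generated by the `x ^ s` with
`s < j`. -/
theorem cls_ofAlg_X_pow {N j : ℕ} (hj : j ≠ 0) (l : ℕ → ℕ) (hl : ∀ s < j, N ≤ j * l s + s)
    (hsum : ∑ s ∈ Finset.range j, l s = N) (M : EndoMod k)
    (hM : Iso M (ofAlg (k[X] ⧸ Ideal.span {(X : k[X]) ^ N}) (Ideal.Quotient.mk _ (X ^ j)))) :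
    cls M = ∑ s ∈ Finset.range j, delta k (l s) := by
  have hzero : ∀ m, N ≤ m → Ideal.Quotient.mk (Ideal.span {(X : k[X]) ^ N}) (X ^ m) = 0 := by
    intro m hm
    exact Ideal.Quotient.eq_zero_iff_mem.2 (Ideal.mem_span_singleton.2 (pow_dvd_pow X hm))
  rw [cls_congr hM, ← Fin.sum_univ_eq_sum_range (fun s => delta k (l s))]
  refine cls_eq_sum_delta _ ?_ (fun s : Fin j => l s)
    (fun s => Ideal.Quotient.mk (Ideal.span {(X : k[X]) ^ N}) (X ^ (s : ℕ))) ?_ ?_ ?_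
  · refine ⟨N, LinearMap.ext fun (v : k[X] ⧸ Ideal.span {(X : k[X]) ^ N}) => ?_⟩
    have h : Ideal.Quotient.mk (Ideal.span {(X : k[X]) ^ N}) (X ^ j) ^ N * v = 0 := by
      rw [← map_pow, ← pow_mul, hzero _ (Nat.le_mul_of_pos_left _ (Nat.pos_of_ne_zero hj)),
        zero_mul]
    exact (ofAlg_T_pow _ N v).trans h
  · intro s
    refine (ofAlg_T_pow _ _ _).trans ?_
    rw [← map_pow, ← map_mul, ← pow_mul, ← pow_add]
    exact hzero _ (hl s s.2)
  · intro (v : k[X] ⧸ Ideal.span {(X : k[X]) ^ N})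
    obtain ⟨f, rfl⟩ := Ideal.Quotient.mk_surjective v
    refine ⟨fun s => f.coeff s, Ideal.Quotient.mk (Ideal.span {(X : k[X]) ^ N}) (f /ₘ X ^ j), ?_⟩
    have hf : f = ∑ s : Fin j, f.coeff s • X ^ (s : ℕ) + X ^ j * (f /ₘ X ^ j) := by
      conv_lhs => rw [← modByMonic_add_div f (X ^ j : k[X])]
      congr 1
      rw [Fin.sum_univ_eq_sum_range (fun s => f.coeff s • (X : k[X]) ^ s),
        (f %ₘ X ^ j).as_sum_range' j]
      · refine Finset.sum_congr rfl fun s hs => ?_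
        conv_rhs => rw [← modByMonic_add_div f (X ^ j : k[X])]
        rw [coeff_add, coeff_X_pow_mul', if_neg (by simpa using hs), add_zero, smul_X_eq_monomial]
      · refine (natDegree_modByMonic_lt _ (monic_X_pow j) fun h => hj ?_).trans_eq
          (natDegree_X_pow j)
        rw [← natDegree_X_pow (R := k) j, h, natDegree_one]
    have h2 := congrArg (Ideal.Quotient.mkₐ k (Ideal.span {(X : k[X]) ^ N})) hf
    rw [map_add, map_sum, map_mul] at h2
    simp only [map_smul] at h2
    exact h2
  · rw [Fin.sum_univ_eq_sum_range l, hsum]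
    exact (finrank_jordan N).symm

/-- The module `k[x] ⧸ (x ^ q)` on which `T` acts as multiplication by `x ^ 2`. -/
noncomputable def sqMod (k : Type u) [Field k] (q : ℕ) : EndoMod k :=
  ofAlg (k[X] ⧸ Ideal.span {(X : k[X]) ^ q}) (Ideal.Quotient.mk _ (X ^ 2))

theorem cls_sqMod (b : ℕ) : cls (sqMod k (2 * b + 1)) = delta k (b + 1) + delta k b := by
  rw [cls_ofAlg_X_pow (N := 2 * b + 1) (j := 2) (by omega) (fun s => if s = 0 then b + 1 else b)
    ?_ ?_ (sqMod k (2 * b + 1)) (Iso.refl _)]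
  · simp [Finset.sum_range_succ]
  · intro s hs
    split_ifs <;> omega
  · simp [Finset.sum_range_succ]
    ring

/-- Multiplication by `x ^ (2 * q)` on `k[x] ⧸ (x ^ (q * N))` is the sum of `q` copies of
multiplication by `x ^ 2` on `k[x] ⧸ (x ^ N)`. -/
theorem cls_res_sqMod (q b : ℕ) (hq : q ≠ 0) :
    cls (res q (sqMod k (q * (2 * b + 1)))) = q * cls (sqMod k (2 * b + 1)) := by
  rw [cls_sqMod, cls_ofAlg_X_pow (N := q * (2 * b + 1)) (j := q + q) (by omega)
    (fun s => if s < q then b + 1 else b)]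
  · rw [Finset.sum_range_add, Finset.sum_congr rfl (g := fun _ => delta k (b + 1)) (fun s hs => by
      rw [if_pos (Finset.mem_range.1 hs)])]
    simp
    ring
  · intro s hs
    split_ifs with h
    · nlinarith
    · nlinarith
  · rw [Finset.sum_range_add, Finset.sum_congr rfl (g := fun _ => b + 1) (fun s hs => by
      rw [if_pos (Finset.mem_range.1 hs)])]
    simp
    ring
  · refine ⟨LinearEquiv.refl k _,
      fun (v : k[X] ⧸ Ideal.span {(X : k[X]) ^ (q * (2 * b + 1))}) => ?_⟩
    refine (ofAlg_T_pow _ q v).trans ?_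
    have h : Ideal.Quotient.mk (Ideal.span {(X : k[X]) ^ (q * (2 * b + 1))}) (X ^ 2) ^ q * v =
        Ideal.Quotient.mk (Ideal.span {(X : k[X]) ^ (q * (2 * b + 1))}) (X ^ (q + q)) * v := by
      rw [← map_pow, ← pow_mul]
      exact congrArg (fun m => Ideal.Quotient.mk (Ideal.span {(X : k[X]) ^ (q * (2 * b + 1))})
        (X ^ m) * v) (two_mul q)
    exact h

/-! ### Modules annihilated by a power of `T` -/

/-- If `T ^ m = 0` on `M`, the cokernel of `T` on the tensor product of `M` with the block of size
`m` is isomorphic to `M`, by the map `f ⊗ v ↦ f (-T) v`. -/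
theorem rk_delta_mul_cls {m : ℕ} {M : EndoMod k} (hM : M.T ^ m = 0) :
    rk (delta k m * cls M) = Module.finrank k M.carrier := by
  let E : EndoMod k := ⟨Module.End k M.carrier, LinearMap.mulRight k (-M.T)⟩
  obtain ⟨F, hF, hF1⟩ := exists_jordan_lift E m (1 : Module.End k M.carrier) (by
    change (LinearMap.mulRight k (-M.T) ^ m) (1 : Module.End k M.carrier) = 0
    rw [LinearMap.pow_mulRight, LinearMap.mulRight_apply, one_mul, neg_pow, hM, mul_zero])
  let F' : (jordan k m).carrier →ₗ[k] Module.End k M.carrier := F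
  have hF' : ∀ f, F' ((jordan k m).T f) = F' f * -M.T := hF
  have hF1' : F' (jordanOne k m) = 1 := hF1
  let Ψ : (jordan k m).carrier ⊗[k] M.carrier →ₗ[k] M.carrier := TensorProduct.lift F'
  let T' : Module.End k ((jordan k m).carrier ⊗[k] M.carrier) := (tensor (jordan k m) M).T
  have hT' : ∀ f v, T' (f ⊗ₜ v) = (jordan k m).T f ⊗ₜ v + f ⊗ₜ M.T v := fun _ _ => rfl
  have hΨ1 : ∀ v, Ψ (jordanOne k m ⊗ₜ v) = v := by
    intro v
    rw [TensorProduct.lift.tmul, hF1', Module.End.one_apply]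
  have hΨT : ∀ z, Ψ (T' z) = 0 := by
    intro z
    induction z using TensorProduct.induction_on with
    | zero => rw [map_zero, map_zero]
    | add v w hv hw => rw [map_add, map_add, hv, hw, add_zero]
    | tmul f v =>
      rw [hT', map_add, TensorProduct.lift.tmul, TensorProduct.lift.tmul, hF',
        ← Module.End.mul_apply, ← LinearMap.add_apply, mul_neg, neg_add_cancel,
        LinearMap.zero_apply]
  have hmod : ∀ z, z - jordanOne k m ⊗ₜ[k] Ψ z ∈ LinearMap.range T' := by
    intro z
    induction z using TensorProduct.induction_on with
    | zero => rw [map_zero, tmul_zero, sub_zero]; exact zero_mem _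
    | add v w hv hw =>
      rw [map_add, tmul_add, add_sub_add_comm]
      exact add_mem hv hw
    | tmul f v =>
      let S : Submodule k (jordan k m).carrier :=
        { carrier := {f | ∀ v, f ⊗ₜ[k] v - jordanOne k m ⊗ₜ[k] F' f v ∈ LinearMap.range T'}
          zero_mem' := by
            intro v
            rw [map_zero, zero_tmul, LinearMap.zero_apply, tmul_zero, sub_zero]
            exact zero_mem _
          add_mem' := by
            intro f g hf hg v
            rw [map_add, add_tmul, LinearMap.add_apply, tmul_add, add_sub_add_comm]
            exact add_mem (hf v) (hg v)
          smul_mem' := by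
            intro c f hf v
            rw [map_smul, LinearMap.smul_apply, tmul_smul, ← smul_tmul', ← smul_sub]
            exact Submodule.smul_mem _ _ (hf v) }
      refine jordan_induction (S := S) ?_ ?_ f v
      · intro v
        rw [hF1', Module.End.one_apply, sub_self]
        exact zero_mem _
      · intro f hf v
        have h1 : T' (f ⊗ₜ v) ∈ LinearMap.range T' := ⟨_, rfl⟩
        have h2 := sub_mem h1 (hf (M.T v))
        rw [hT'] at h2
        rw [hF', mul_neg, LinearMap.neg_apply, Module.End.mul_apply, tmul_neg, sub_neg_eq_add]
        convert h2 using 1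
        abel
  have hker : LinearMap.ker Ψ = LinearMap.range T' := by
    apply le_antisymm
    · intro z hz
      have h := hmod z
      rwa [LinearMap.mem_ker.1 hz, tmul_zero, sub_zero] at h
    · rintro _ ⟨z, rfl⟩
      exact hΨT z
  have hsurj : LinearMap.range Ψ = ⊤ := LinearMap.range_eq_top.2 fun v => ⟨_, hΨ1 v⟩
  have h1 := LinearMap.finrank_range_add_finrank_ker Ψ
  have h2 := LinearMap.finrank_range_add_finrank_ker T'
  rw [hsurj, finrank_top, hker] at h1
  rw [delta, ← cls_tensor, rk_cls]
  change (Module.finrank k (LinearMap.ker T') : ℤ) = _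
  congr 1
  omega

/-- Tensor powers. -/
noncomputable def tpow (M : EndoMod k) : ℕ → EndoMod k
  | 0 => unit k
  | n + 1 => tensor M (tpow M n)

theorem cls_tpow (M : EndoMod k) (n : ℕ) : cls (tpow M n) = cls M ^ n := by
  induction n with
  | zero => rw [pow_zero, tpow, cls_unit]
  | succ n ih => rw [tpow, cls_tensor, ih, pow_succ']

theorem tpow_T_pow_eq_zero (p : ℕ) [hp : Fact p.Prime] [CharP k p] {e : ℕ} {M : EndoMod k}
    (hM : M.T ^ p ^ e = 0) (n : ℕ) : (tpow M n).T ^ p ^ e = 0 := by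
  induction n with
  | zero => exact zero_pow (pow_pos hp.out.pos e).ne'
  | succ n ih =>
    have h : (M.T ^ p ^ e).rTensor (tpow M n).carrier + ((tpow M n).T ^ p ^ e).lTensor M.carrier =
        (0 : Module.End k (M.carrier ⊗[k] (tpow M n).carrier)) := by
      rw [hM, ih, LinearMap.rTensor_zero, LinearMap.lTensor_zero, add_zero]
    exact (res_tensor p e M (tpow M n)).trans h

theorem finrank_tpow (M : EndoMod k) (n : ℕ) :
    Module.finrank k (tpow M n).carrier = Module.finrank k M.carrier ^ n := by
  induction n with
  | zero => exact (Module.finrank_self k).trans (pow_zero _).symm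
  | succ n ih =>
    change Module.finrank k (M.carrier ⊗[k] (tpow M n).carrier) = _
    rw [Module.finrank_tensorProduct, ih, pow_succ']

theorem sqMod_T_pow {q r : ℕ} (h : q ≤ 2 * r) : (sqMod k q).T ^ r = 0 := by
  refine LinearMap.ext fun (v : k[X] ⧸ Ideal.span {(X : k[X]) ^ q}) => ?_
  have h : Ideal.Quotient.mk (Ideal.span {(X : k[X]) ^ q}) (X ^ 2) ^ r * v = 0 := by
    rw [← map_pow, ← pow_mul, Ideal.Quotient.eq_zero_iff_mem.2
      (Ideal.mem_span_singleton.2 (pow_dvd_pow X h)), zero_mul]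
  exact (ofAlg_T_pow _ r v).trans h

/-! ### Relations in the representation ring -/

/-- The difference of the classes of consecutive Jordan blocks. -/
noncomputable def eps (k : Type u) [Field k] (n : ℕ) : RepRing k := delta k (n + 1) - delta k n

/-- The class `[k[x] ⧸ x ^ q] - [k[x] ⧸ x ^ (q - 1)]`; for a power `q` of the characteristic it is
an involution. -/
noncomputable def tau (k : Type u) [Field k] (q : ℕ) : RepRing k := delta k q - delta k (q - 1)

/-- The class of `k[x] ⧸ x ^ q` with `T = x ^ 2`, minus that of a single Jordan block. -/
noncomputable def vir (k : Type u) [Field k] (q : ℕ) : RepRing k := cls (sqMod k q) - delta k q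

theorem eps_zero : eps k 0 = 1 := by rw [eps, delta_zero, delta_one, sub_zero]

theorem add_pow_succ_of_mul_eq_zero {R : Type*} [CommRing R] {x y : R} (h : x * y = 0) (n : ℕ) :
    (x + y) ^ (n + 1) = x ^ (n + 1) + y ^ (n + 1) := by
  induction n with
  | zero => simp
  | succ n ih =>
    rw [pow_succ (x + y), ih]
    linear_combination (x ^ n + y ^ n) * h

theorem vir_eq {q b : ℕ} (hb : q = 2 * b + 1) :
    vir k q = delta k (b + 1) + delta k b - delta k q := by
  rw [vir, hb, cls_sqMod]

theorem natCast_ne_zero_of_lt (p : ℕ) [CharP k p] {i : ℕ} (h0 : i ≠ 0) (hi : i < p) :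
    (i : k) ≠ 0 := by
  rw [Ne, CharP.cast_eq_zero_iff k p]
  exact fun h => absurd (Nat.le_of_dvd (by omega) h) (by omega)

theorem rk_delta_mul_delta {q m : ℕ} (h : q ≤ m) : rk (delta k m * delta k q) = q := by
  rw [show delta k q = cls (jordan k q) from rfl, rk_delta_mul_cls]
  · exact congrArg _ (finrank_jordan q)
  · exact pow_eq_zero_of_le h (jordan_T_pow q)

section

variable (p : ℕ) [hp : Fact p.Prime] [CharP k p] (e : ℕ)

theorem delta_primePow_mul_delta {l : ℕ} (hl : l ≤ p ^ e) :
    delta k (p ^ e) * delta k l = l * delta k (p ^ e) := by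
  simpa using delta_mul_mul_delta (k := k) p e 1 hl

/-- Multiplication by `tau` reflects the sizes of the blocks, up to blocks of size `q = p ^ e`. -/
theorem tau_mul_delta {l : ℕ} (hl : l ≤ p ^ e) :
    tau k (p ^ e) * delta k l = delta k (p ^ e) - delta k (p ^ e - l) := by
  rcases Nat.eq_zero_or_pos l with rfl | hl0
  · simp [delta_zero]
  · rw [tau, sub_mul, delta_primePow_mul_delta p e hl, delta_sub_one_mul_delta p e hl0.ne' hl,
      Nat.cast_sub hl0]
    push_cast
    ring

theorem tau_mul_tau : tau k (p ^ e) * tau k (p ^ e) = 1 := by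
  have hq : 1 ≤ p ^ e := pow_pos hp.out.pos e
  conv_lhs => rw [tau, mul_sub]
  rw [← tau, tau_mul_delta p e le_rfl, tau_mul_delta p e (Nat.sub_le _ _), Nat.sub_self,
    Nat.sub_sub_self hq, delta_one, delta_zero]
  ring

theorem one_sub_tau_pow (n : ℕ) : (1 - tau k (p ^ e)) ^ (n + 1) = 2 ^ n * (1 - tau k (p ^ e)) := by
  induction n with
  | zero => simp
  | succ n ih =>
    rw [pow_succ (1 - tau k (p ^ e)), ih]
    linear_combination 2 ^ n * tau_mul_tau (k := k) p e

theorem delta_mul_vir {b : ℕ} (hb : p ^ e = 2 * b + 1) : delta k (p ^ e) * vir k (p ^ e) = 0 := by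
  rw [vir_eq hb, mul_sub, mul_add, delta_primePow_mul_delta p e (by omega),
    delta_primePow_mul_delta p e (by omega), delta_primePow_mul_delta p e le_rfl]
  have h : ((p ^ e : ℕ) : RepRing k) = 2 * b + 1 := by rw [hb]; push_cast; rfl
  rw [h]
  push_cast
  ring

theorem tau_mul_vir {b : ℕ} (hb : p ^ e = 2 * b + 1) :
    tau k (p ^ e) * vir k (p ^ e) = -vir k (p ^ e) := by
  rw [vir_eq hb, mul_sub, mul_add, tau_mul_delta p e (by omega), tau_mul_delta p e (by omega),
    tau_mul_delta p e le_rfl, Nat.sub_self, delta_zero, show p ^ e - (b + 1) = b by omega,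
    show p ^ e - b = b + 1 by omega]
  ring

theorem tau_mul_vir_pow {b : ℕ} (hb : p ^ e = 2 * b + 1) (n : ℕ) :
    tau k (p ^ e) * vir k (p ^ e) ^ (n + 1) = -vir k (p ^ e) ^ (n + 1) := by
  rw [pow_succ' (vir k (p ^ e)), ← mul_assoc, tau_mul_vir p e hb, neg_mul]

theorem eps_mul_delta (i : ℕ) {l : ℕ} (hl : l ≤ p ^ e) :
    eps k (p ^ e * i) * delta k l = delta k (p ^ e * i + l) - delta k (p ^ e * i) := by
  rcases Nat.eq_zero_or_pos l with rfl | hl0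
  · simp [delta_zero]
  · rw [eps, sub_mul, delta_mul_add_one_mul_delta p e i hl0.ne' hl, delta_mul_mul_delta p e i hl,
      Nat.cast_sub hl0]
    push_cast
    ring

theorem eps_mul_tau (i : ℕ) : eps k (p ^ e * i) * tau k (p ^ e) =
    delta k (p ^ e * (i + 1)) - delta k (p ^ e * (i + 1) - 1) := by
  have hq : 1 ≤ p ^ e := pow_pos hp.out.pos e
  rw [tau, mul_sub, eps_mul_delta p e i le_rfl, eps_mul_delta p e i (Nat.sub_le _ _),
    show p ^ e * i + (p ^ e - 1) = p ^ e * (i + 1) - 1 by rw [mul_add, mul_one]; omega, mul_add,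
    mul_one]
  ring

/-- Up to the twist by `tau`, the classes `eps k (p ^ e * i)` obey the recursion of Chebyshev
polynomials. -/
theorem eps_mul_eps (he : e ≠ 0) {i : ℕ} (hi : i + 2 < p) :
    eps k (p ^ e) * eps k (p ^ e * (i + 1)) =
      eps k (p ^ e * (i + 2)) + eps k (p ^ e * i) - eps k (p ^ e * (i + 1)) * tau k (p ^ e) := by
  have hq : 2 ≤ p ^ e := Nat.one_lt_pow he hp.out.one_lt
  have h1 := delta_add_one_mul_delta_mul_add_one p e he
    (natCast_ne_zero_of_lt (k := k) p (i := i + 1) (by omega) (by omega))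
    (natCast_ne_zero_of_lt (k := k) p (i := i + 2) (by omega) (by omega))
  have h2 := delta_add_one_mul_delta_mul p e
    (natCast_ne_zero_of_lt (k := k) p (i := i + 1) (by omega) (by omega))
  have h3 := delta_mul_delta_mul_add_one (k := k) p e (i + 1)
  have h4 := delta_mul_mul_delta (k := k) p e (i + 1) le_rfl
  rw [nsmul_eq_mul, Nat.cast_sub hq] at h1
  rw [Nat.cast_sub (by omega)] at h2 h3
  rw [eps_mul_tau, eps, eps, eps, eps]
  push_cast at h1 h2 h3 h4 ⊢
  rw [show i + 1 + 1 = i + 2 from rfl] at *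
  linear_combination h1 - h2 - h3 + h4

theorem eps_mul_eps' (he : e ≠ 0) {i : ℕ} (hi : i + 2 = p) :
    eps k (p ^ e) * eps k (p ^ e * (i + 1)) = eps k (p ^ e * i) := by
  have hq : 2 ≤ p ^ e := Nat.one_lt_pow he hp.out.one_lt
  have h1 := delta_add_one_mul_delta_mul_add_one' (k := k) p e he hi
  have h2 := delta_add_one_mul_delta_mul p e
    (natCast_ne_zero_of_lt (k := k) p (i := i + 1) (by omega) (by omega))
  have h3 := delta_mul_delta_mul_add_one (k := k) p e (i + 1)
  have h4 := delta_mul_mul_delta (k := k) p e (i + 1) le_rfl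
  rw [nsmul_eq_mul, Nat.cast_sub hq] at h1
  rw [Nat.cast_sub (by omega)] at h2 h3
  rw [eps, eps, eps]
  push_cast at h1 h2 h3 h4 ⊢
  rw [show i + 1 + 1 = i + 2 from rfl] at *
  linear_combination h1 - h2 - h3 + h4

/-! ### The rank of the powers of `vir` -/

theorem rk_delta_mul_pow_sqMod {m : ℕ} (hm : p ^ e ≤ m) (n : ℕ) :
    rk (delta k m * cls (sqMod k (p ^ e)) ^ n) = (p ^ e : ℕ) ^ n := by
  rw [← cls_tpow, rk_delta_mul_cls, finrank_tpow]
  · have : Module.finrank k (sqMod k (p ^ e)).carrier = p ^ e := finrank_jordan (p ^ e)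
    rw [this]
    push_cast
    rfl
  · exact pow_eq_zero_of_le hm
      (tpow_T_pow_eq_zero p (sqMod_T_pow (by omega)) n)

theorem delta_primePow_pow (n : ℕ) :
    delta k (p ^ e) ^ (n + 1) = ((p ^ e : ℕ) ^ n : RepRing k) * delta k (p ^ e) := by
  induction n with
  | zero => simp
  | succ n ih =>
    rw [pow_succ (delta k (p ^ e)), ih, mul_assoc, delta_primePow_mul_delta p e le_rfl]
    ring

theorem sqMod_pow {b : ℕ} (hb : p ^ e = 2 * b + 1) (n : ℕ) :
    cls (sqMod k (p ^ e)) ^ (n + 1) =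
      vir k (p ^ e) ^ (n + 1) + ((p ^ e : ℕ) ^ n : RepRing k) * delta k (p ^ e) := by
  rw [← delta_primePow_pow, ← add_pow_succ_of_mul_eq_zero, vir, sub_add_cancel]
  rw [mul_comm, delta_mul_vir p e hb]

theorem rk_natCast_pow_mul (m n : ℕ) (x : RepRing k) :
    rk ((m : RepRing k) ^ n * x) = (m : ℤ) ^ n * rk x := by
  rw [← Nat.cast_pow, ← nsmul_eq_mul, map_nsmul, nsmul_eq_mul]
  push_cast
  rfl

theorem rk_sqMod_pow {b : ℕ} (hb : p ^ e = 2 * b + 1) (n : ℕ) :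
    rk (cls (sqMod k (p ^ e)) ^ (n + 1)) = rk (vir k (p ^ e) ^ (n + 1)) + (p ^ e : ℕ) ^ n := by
  rw [sqMod_pow p e hb, map_add, rk_natCast_pow_mul, rk_delta (by omega), mul_one]

/-- By `rk_delta_mul_cls` the rank of the product of a block of size at least `q` with a module
annihilated by `T ^ q` does not depend on the size of the block. -/
theorem rk_eps_mul_vir_pow {b : ℕ} (hb : p ^ e = 2 * b + 1) {j : ℕ} (hj : j ≠ 0) (n : ℕ) :
    rk (eps k (p ^ e * j) * vir k (p ^ e) ^ (n + 1)) = 0 := by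
  have h : p ^ e ≤ p ^ e * j := Nat.le_mul_of_pos_right _ (by omega)
  rw [← sub_eq_of_eq_add (sqMod_pow (k := k) p e hb n), mul_sub, map_sub, mul_left_comm,
    rk_natCast_pow_mul, eps, sub_mul, sub_mul, map_sub, map_sub, rk_delta_mul_pow_sqMod p e h,
    rk_delta_mul_pow_sqMod p e (by omega), rk_delta_mul_delta h,
    rk_delta_mul_delta (by omega)]
  simp

/-! ### Passing from `q` to `q p` -/

theorem cls_ind_sqMod {n : ℕ} (hn : n + 1 = p ^ e) (a : ℕ) :
    cls (ind n (sqMod k (2 * a + 1))) = delta k (p ^ e * (a + 1)) + delta k (p ^ e * a) := by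
  rw [← hn, ← cls_ind_jordan, ← cls_ind_jordan]
  refine toOp_injective ?_
  have h := congrArg toOp (cls_sqMod (k := k) a)
  rw [map_add, toOp_cls] at h
  rw [map_add, toOp_cls, toOp_cls, toOp_cls, tensorOp_ind p hn, tensorOp_ind p hn,
    tensorOp_ind p hn, h, mul_add, add_mul]
  rfl

/-- The class of `k[x] ⧸ (x ^ (q * p))` with `T = x ^ 2`, where `q = p ^ e`, is the sum of the
class of a module induced from `k[x] ⧸ (x ^ p)` and of a class orthogonal to it. -/
theorem rk_sqMod_mul_pow {a b : ℕ} (ha : p = 2 * a + 1) (hb : p ^ e = 2 * b + 1) (d : ℕ) :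
    rk (cls (sqMod k (p ^ (e + 1))) ^ (d + 1)) =
      (p ^ e : ℕ) ^ d * rk (cls (sqMod k p) ^ (d + 1)) +
        rk (eps k (p ^ e * a) ^ (d + 1) * vir k (p ^ e) ^ (d + 1)) := by
  have hn : 2 * b + 1 = p ^ e := hb.symm
  have hw := cls_ind_sqMod (k := k) p e hn a
  have hN : p ^ (e + 1) = p ^ e * (2 * a + 1) := by rw [pow_succ, ← ha]
  have hq : p ^ (e + 1) = 2 * (p ^ e * a + b) + 1 := by
    rw [hN, mul_add, mul_one]
    nth_rewrite 2 [hb]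
    ring
  have hu : cls (sqMod k (p ^ (e + 1))) = cls (ind (2 * b) (sqMod k (2 * a + 1))) +
      eps k (p ^ e * a) * vir k (p ^ e) := by
    rw [hw, hq, cls_sqMod, vir_eq hb, mul_sub, mul_add (p ^ e) a 1, mul_one, mul_add,
      eps_mul_delta p e a (l := b + 1) (by omega), eps_mul_delta p e a (l := b) (by omega),
      eps_mul_delta p e a le_rfl, add_assoc (p ^ e * a)]
    ring
  have h0 : cls (ind (2 * b) (sqMod k (2 * a + 1))) * (eps k (p ^ e * a) * vir k (p ^ e)) = 0 := by
    have h1 := cls_ind_mul p hn (sqMod k (2 * a + 1)) (sqMod k (p ^ (e + 1))) (by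
      rw [hn, hN]
      exact cls_res_sqMod _ a (by omega))
    rw [hu, mul_add] at h1
    simpa using h1
  rw [hu, add_pow_succ_of_mul_eq_zero h0, map_add, mul_pow, rk_cls_ind_pow p hn, hn, ← ha]

end

end EndoMod

/-! ### Counting lattice paths -/

/-- The number of sequences of length `n` of elements of `D` such that in the sequence preceded by
`l` the absolute values of consecutive terms have sum at most `c`. -/
def pathCount (D : Finset ℤ) (c : ℤ) : ℕ → ℤ → ℕ
  | 0, _ => 1
  | n + 1, l => ∑ m ∈ D with |l| + |m| ≤ c, pathCount D c n m

/-- The indicator function of the lattice points of a square centred at `(a, a)`. -/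
def diamond (a i l : ℤ) : ℤ := if |l - a| + |i - a| ≤ a then 1 else 0

/-- The indicator function of the square satisfies a discrete wave equation inside the square, apart
from a reflection at the corners. -/
theorem diamond_wave {a i l : ℤ} (hi0 : 0 < i) (hi : i < 2 * a) (hl0 : 0 ≤ l) (hl : l ≤ 2 * a) :
    diamond a (i + 1) l + diamond a (i - 1) l + (if l = 0 ∨ l = 2 * a then diamond a i l else 0) =
      diamond a i (l - 1) + diamond a i (l + 1) := by
  unfold diamond
  rcases abs_cases (i - a) with h1 | h1 <;> rcases abs_cases (l - a) with h2 | h2 <;>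
  rcases abs_cases (i + 1 - a) with h3 | h3 <;> rcases abs_cases (i - 1 - a) with h4 | h4 <;>
  rcases abs_cases (l + 1 - a) with h5 | h5 <;> rcases abs_cases (l - 1 - a) with h6 | h6 <;>
  simp only [h1, h2, h3, h4, h5, h6] <;> first | omega

section

variable {R : Type*} [CommRing R]

/-- Summation by parts: the boundary terms vanish. -/
theorem sum_diamond_shift (a : ℕ) (i : ℤ) (G : ℕ → R) (h0 : G 0 = 0) (hG : G (2 * a + 2) = 0) :
    ∑ k ∈ Finset.range (2 * a + 1), (diamond a i k : R) * (G (k + 2) + G k) =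
      ∑ k ∈ Finset.range (2 * a + 1),
        ((diamond a i (k - 1) + diamond a i (k + 1) : ℤ) : R) * G (k + 1) := by
  have hout : ∀ l : ℤ, l < 0 ∨ 2 * a < l → diamond a i l = 0 := by
    intro l hl
    rw [diamond, if_neg]
    rcases abs_cases (i - a) with h1 | h1 <;> rcases abs_cases (l - a) with h2 | h2 <;> omega
  simp only [mul_add, Int.cast_add, add_mul, Finset.sum_add_distrib]
  congr 1
  · rw [Finset.sum_range_succ, Finset.sum_range_succ', hG,
      hout ((0 : ℕ) - 1) (Or.inl (by omega))]
    simp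
  · rw [Finset.sum_range_succ', Finset.sum_range_succ, h0,
      hout ((2 * a : ℕ) + 1) (Or.inr (by omega))]
    simp

/-- A product formula for sequences which satisfy the recursion of a reflected Chebyshev
sequence. -/
theorem mul_eq_sum_diamond {a : ℕ} (ha : a ≠ 0) (E : ℕ → R) (V : R) (hE0 : E 0 = 1)
    (hE : ∀ i, i + 2 ≤ 2 * a → E 1 * E (i + 1) * V = (E (i + 2) + E i + E (i + 1)) * V)
    (hEa : E 1 * E (2 * a) * V = E (2 * a - 1) * V) {j : ℕ} (hj : j ≤ 2 * a) :
    E a * (E j * V) = ∑ k ∈ Finset.range (2 * a + 1), (diamond a j k : R) * (E k * V) := by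
  -- the sequence `E k * V`, shifted by one and extended by zero at both ends
  let G : ℕ → R := fun k => if k = 0 ∨ k = 2 * a + 2 then 0 else E (k - 1) * V
  have hG0 : G 0 = 0 := if_pos (Or.inl rfl)
  have hGN : G (2 * a + 2) = 0 := if_pos (Or.inr rfl)
  have hG : ∀ k ≤ 2 * a, G (k + 1) = E k * V := fun k hk => if_neg (by omega)
  have hrec : ∀ k ≤ 2 * a, E 1 * G (k + 1) =
      G (k + 2) + G k + (if k = 0 ∨ k = 2 * a then 0 else G (k + 1)) := by
    intro k hk
    rw [hG k hk]
    split_ifs with h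
    · rcases h with rfl | rfl
      · rw [hG0, hG 1 (by omega), hE0]
        ring
      · rw [hGN, show 2 * a = 2 * a - 1 + 1 by omega, hG _ (by omega),
          show 2 * a - 1 + 1 = 2 * a by omega, ← hEa]
        ring
    · obtain ⟨k, rfl⟩ : ∃ i, k = i + 1 := ⟨k - 1, by omega⟩
      rw [hG k (by omega), hG (k + 2) (by omega),
        ← mul_assoc, hE k (by omega)]
      ring
  have key : ∀ j, (j ≤ 2 * a → E a * (E j * V) =
        ∑ k ∈ Finset.range (2 * a + 1), (diamond a j k : R) * G (k + 1)) ∧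
      (j + 1 ≤ 2 * a → E a * (E (j + 1) * V) =
        ∑ k ∈ Finset.range (2 * a + 1), (diamond a (j + 1 : ℕ) k : R) * G (k + 1)) := by
    intro j
    induction j with
    | zero =>
      constructor
      · intro _
        rw [Finset.sum_eq_single a]
        · simp [diamond, hE0, hG a (by omega)]
        · intro l _ hl
          have : diamond a (0 : ℕ) l = 0 := by
            rw [diamond, if_neg]
            rcases abs_cases ((0 : ℕ) - a : ℤ) with h1 | h1 <;>
              rcases abs_cases (l - a : ℤ) with h2 | h2 <;> omega
          rw [this, Int.cast_zero, zero_mul]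
        · exact fun h => absurd (Finset.mem_range.2 (by omega)) h
      · intro _
        have h1 := hrec a (by omega)
        rw [if_neg (by omega), hG a (by omega)] at h1
        rw [zero_add, mul_left_comm, h1]
        obtain ⟨b, rfl⟩ : ∃ b, a = b + 1 := ⟨a - 1, by omega⟩
        rw [← Finset.sum_subset (s₁ := {b, b + 1, b + 2})]
        · have h2 : ∀ l ∈ ({b, b + 1, b + 2} : Finset ℕ), diamond (b + 1 : ℕ) (1 : ℕ) l = 1 := by
            intro l hl
            simp only [Finset.mem_insert, Finset.mem_singleton] at hl
            rw [diamond, if_pos]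
            rcases abs_cases ((1 : ℕ) - (b + 1 : ℕ) : ℤ) with h1 | h1 <;>
              rcases abs_cases (l - (b + 1 : ℕ) : ℤ) with h2 | h2 <;> omega
          rw [Finset.sum_congr rfl fun l hl => by rw [h2 l hl, Int.cast_one, one_mul],
            Finset.sum_insert (by simp), Finset.sum_insert (by simp), Finset.sum_singleton]
          linear_combination -hG (b + 1) (by omega)
        · intro l hl
          simp only [Finset.mem_insert, Finset.mem_singleton] at hl
          rw [Finset.mem_range]
          omega
        · intro l _ hl
          simp only [Finset.mem_insert, Finset.mem_singleton] at hl
          have : diamond (b + 1 : ℕ) (1 : ℕ) l = 0 := by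
            rw [diamond, if_neg]
            rcases abs_cases ((1 : ℕ) - (b + 1 : ℕ) : ℤ) with h1 | h1 <;>
              rcases abs_cases (l - (b + 1 : ℕ) : ℤ) with h2 | h2 <;> omega
          rw [this, Int.cast_zero, zero_mul]
    | succ j ih =>
      refine ⟨ih.2, fun hj => ?_⟩
      have h1 := ih.1 (by omega)
      have h2 := ih.2 (by omega)
      have h3 : E 1 * (E a * (E (j + 1) * V)) = ∑ k ∈ Finset.range (2 * a + 1),
          ((diamond a (j + 1 : ℕ) (k - 1) + diamond a (j + 1 : ℕ) (k + 1) : ℤ) : R) * G (k + 1) +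
          ∑ k ∈ Finset.range (2 * a + 1), (diamond a (j + 1 : ℕ) k : R) *
            (if k = 0 ∨ k = 2 * a then 0 else G (k + 1)) := by
        rw [← sum_diamond_shift a _ G hG0 hGN, ← Finset.sum_add_distrib, h2, Finset.mul_sum]
        refine Finset.sum_congr rfl fun k hk => ?_
        rw [mul_left_comm, hrec k (by rw [Finset.mem_range] at hk; omega)]
        ring
      have h4 : E a * (E (j + 1 + 1) * V) = E 1 * (E a * (E (j + 1) * V)) - E a * (E j * V) -
          E a * (E (j + 1) * V) := by
        linear_combination -E a * hE j (by omega)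
      rw [h4, h3, h1, h2, ← Finset.sum_add_distrib, ← Finset.sum_sub_distrib,
        ← Finset.sum_sub_distrib]
      refine Finset.sum_congr rfl fun k hk => ?_
      rw [Finset.mem_range] at hk
      have h5 := diamond_wave (a := a) (i := (j + 1 : ℕ)) (l := k) (by omega) (by omega) (by omega)
        (by omega)
      rw [← h5, show ((j + 1 : ℕ) + 1 : ℤ) = (j + 1 + 1 : ℕ) by push_cast; ring,
        show ((j + 1 : ℕ) - 1 : ℤ) = (j : ℕ) by push_cast; ring]
      by_cases hk' : k = 0 ∨ k = 2 * a
      · rw [if_pos hk', if_pos (by omega)]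
        push_cast
        ring
      · rw [if_neg hk', if_neg (by omega)]
        push_cast
        ring
  rw [(key j).1 hj]
  refine Finset.sum_congr rfl fun k hk => ?_
  rw [hG k (by rw [Finset.mem_range] at hk; omega)]

end

theorem sum_Icc_neg {M : Type*} [AddCommMonoid M] (a : ℕ) (f : ℤ → M) :
    ∑ l ∈ Finset.Icc (-a : ℤ) a, f l = ∑ k ∈ Finset.range (2 * a + 1), f (k - a) := by
  refine Finset.sum_nbij' (fun l => (l + a).toNat) (fun k => k - a) ?_ ?_ ?_ ?_ ?_
  · intro l hl
    rw [Finset.mem_Icc] at hl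
    rw [Finset.mem_range]
    omega
  · intro k hk
    rw [Finset.mem_range] at hk
    rw [Finset.mem_Icc]
    omega
  · intro l hl
    rw [Finset.mem_Icc] at hl
    omega
  · intro k hk
    omega
  · intro l hl
    rw [Finset.mem_Icc] at hl
    congr 1
    omega

namespace EndoMod

variable {k : Type u} [Field k] (p : ℕ) [hp : Fact p.Prime] [CharP k p]

theorem eps_mul_eps_mul_vir_pow {e a b : ℕ} (he : e ≠ 0) (ha : p = 2 * a + 1)
    (hb : p ^ e = 2 * b + 1) (n : ℕ) {j : ℕ} (hj : j ≤ 2 * a) :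
    eps k (p ^ e * a) * (eps k (p ^ e * j) * vir k (p ^ e) ^ (n + 1)) =
      ∑ i ∈ Finset.range (2 * a + 1),
        (diamond a j i : RepRing k) * (eps k (p ^ e * i) * vir k (p ^ e) ^ (n + 1)) := by
  have ha0 : a ≠ 0 := by
    rintro rfl
    exact hp.out.ne_one ha
  refine mul_eq_sum_diamond ha0 (fun j => eps k (p ^ e * j)) _ (by simp [eps_zero]) ?_ ?_ hj
  · intro i hi
    have h1 := eps_mul_eps (k := k) p e he (i := i) (by omega)
    have h2 := tau_mul_vir_pow (k := k) p e hb n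
    simp only [mul_one]
    linear_combination vir k (p ^ e) ^ (n + 1) * h1 - eps k (p ^ e * (i + 1)) * h2
  · have h1 := eps_mul_eps' (k := k) p e he (i := 2 * a - 1) (by omega)
    rw [show 2 * a - 1 + 1 = 2 * a by omega] at h1
    simp only [mul_one]
    rw [h1]

theorem rk_eps_pow_succ_mul {e a b : ℕ} (he : e ≠ 0) (ha : p = 2 * a + 1) (hb : p ^ e = 2 * b + 1)
    (n m : ℕ) {j : ℕ} (hj : j ≤ 2 * a) :
    rk (eps k (p ^ e * a) ^ (m + 1) * (eps k (p ^ e * j) * vir k (p ^ e) ^ (n + 1))) =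
      ∑ i ∈ Finset.range (2 * a + 1), diamond a j i *
        rk (eps k (p ^ e * a) ^ m * (eps k (p ^ e * i) * vir k (p ^ e) ^ (n + 1))) := by
  rw [pow_succ, mul_assoc, eps_mul_eps_mul_vir_pow p he ha hb n hj]
  refine ((congrArg rk (Finset.mul_sum _ _ _)).trans (map_sum rk _ _)).trans ?_
  refine Finset.sum_congr rfl fun i _ => ?_
  rw [mul_left_comm, ← zsmul_eq_mul, map_zsmul, smul_eq_mul]

theorem rk_eps_mul_eps_mul {e a b : ℕ} (he : e ≠ 0) (ha : p = 2 * a + 1) (hb : p ^ e = 2 * b + 1)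
    (n : ℕ) {j : ℕ} (hj : j ≤ 2 * a) :
    rk (eps k (p ^ e * a) ^ 1 * (eps k (p ^ e * j) * vir k (p ^ e) ^ (n + 1))) =
      if j = a then rk (vir k (p ^ e) ^ (n + 1)) else 0 := by
  rw [rk_eps_pow_succ_mul p he ha hb n 0 hj, Finset.sum_eq_single 0]
  · rw [diamond, pow_zero, one_mul, mul_zero, eps_zero, one_mul]
    rcases abs_cases ((0 : ℕ) - a : ℤ) with h1 | h1 <;>
      rcases abs_cases (j - a : ℤ) with h2 | h2 <;> by_cases h : j = a
    all_goals first
      | rw [if_pos h, if_pos (by omega), one_mul]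
      | rw [if_neg h, if_neg (by omega), zero_mul]
  · intro i _ hi
    rw [pow_zero, one_mul, rk_eps_mul_vir_pow p e hb hi, mul_zero]
  · simp

/-- Iterating the product formula counts lattice paths. -/
theorem rk_eps_pow_mul_eq_pathCount {e a b : ℕ} (he : e ≠ 0) (ha : p = 2 * a + 1)
    (hb : p ^ e = 2 * b + 1) (n m : ℕ) : ∀ {j : ℕ}, j ≤ 2 * a →
    rk (eps k (p ^ e * a) ^ (m + 2) * (eps k (p ^ e * j) * vir k (p ^ e) ^ (n + 1))) =
      pathCount (Finset.Icc (-a) a) a m (j - a) * rk (vir k (p ^ e) ^ (n + 1)) := by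
  induction m with
  | zero =>
    intro j hj
    rw [rk_eps_pow_succ_mul p he ha hb n _ hj, Finset.sum_eq_single a]
    · rw [rk_eps_mul_eps_mul p he ha hb n (by omega), if_pos rfl, pathCount, Nat.cast_one, diamond,
        if_pos]
      rcases abs_cases (j - a : ℤ) with h2 | h2 <;> rw [sub_self, abs_zero] <;> omega
    · intro i hi hia
      rw [rk_eps_mul_eps_mul p he ha hb n (by rw [Finset.mem_range] at hi; omega), if_neg hia,
        mul_zero]
    · exact fun h => absurd (Finset.mem_range.2 (by omega)) h
  | succ m ih =>
    intro j hj
    rw [rk_eps_pow_succ_mul p he ha hb n _ hj, pathCount, Finset.sum_filter, sum_Icc_neg,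
      Nat.cast_sum, Finset.sum_mul]
    refine Finset.sum_congr rfl fun i hi => ?_
    rw [ih (by rw [Finset.mem_range] at hi; omega), diamond, add_comm |(i - a : ℤ)|]
    split_ifs <;> simp

/-- The number of lattice paths which controls the growth of the ranks. -/
theorem rk_eps_pow_mul_vir_pow {e a b : ℕ} (he : e ≠ 0) (ha : p = 2 * a + 1)
    (hb : p ^ e = 2 * b + 1) (n m : ℕ) :
    rk (eps k (p ^ e * a) ^ (m + 3) * vir k (p ^ e) ^ (n + 1)) =
      pathCount (Finset.Icc (-a) a) a m 0 * rk (vir k (p ^ e) ^ (n + 1)) := by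
  rw [pow_succ, mul_assoc, rk_eps_pow_mul_eq_pathCount p he ha hb n m (by omega), sub_self]

theorem rk_eps_pow_one_mul_vir_pow {e a b : ℕ} (ha : p = 2 * a + 1)
    (hb : p ^ e = 2 * b + 1) (n : ℕ) :
    rk (eps k (p ^ e * a) ^ 1 * vir k (p ^ e) ^ (n + 1)) = 0 := by
  rw [pow_one, rk_eps_mul_vir_pow p e hb]
  rintro rfl
  exact hp.out.ne_one ha

theorem rk_eps_pow_two_mul_vir_pow {e a b : ℕ} (he : e ≠ 0) (ha : p = 2 * a + 1)
    (hb : p ^ e = 2 * b + 1) (n : ℕ) :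
    rk (eps k (p ^ e * a) ^ 2 * vir k (p ^ e) ^ (n + 1)) = rk (vir k (p ^ e) ^ (n + 1)) := by
  rw [pow_succ, mul_assoc, rk_eps_mul_eps_mul p he ha hb n (by omega), if_pos rfl]

/-! ### The ranks of the powers of `vir k p` -/

theorem delta_mul_one_sub_tau {n : ℕ} (hn : n ≤ p) :
    delta k n * (1 - tau k p) = delta k n - delta k p + delta k (p - n) := by
  have h := tau_mul_delta (k := k) p 1 (l := n) (by simpa using hn)
  rw [pow_one] at h
  linear_combination -h

/-- The recursion `delta_two_mul_delta` determines the product. As it involves two previous terms,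
the statement is proved for two consecutive values of `l`. -/
theorem eps_mul_delta_mul_one_sub_tau {a : ℕ} (ha : p = 2 * a + 1) (l : ℕ) :
    (l ≤ a → eps k l * (delta k a * (1 - tau k p)) = delta k (a - l) * (1 - tau k p)) ∧
      (l + 1 ≤ a → eps k (l + 1) * (delta k a * (1 - tau k p)) =
        delta k (a - (l + 1)) * (1 - tau k p)) := by
  have h2 : ∀ n, n + 1 < p → delta k 2 * delta k (n + 1) = delta k (n + 2) + delta k n :=
    fun n hn => delta_two_mul_delta (natCast_ne_zero_of_lt (k := k) p (by omega) hn)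
  induction l with
  | zero =>
    refine ⟨fun _ => by rw [eps_zero, one_mul, Nat.sub_zero], fun h => ?_⟩
    -- the reflection `delta a ↔ delta (a + 1)` fixes the classes multiplied by `1 - tau`
    have h3 : delta k (a + 1) * (1 - tau k p) = delta k a * (1 - tau k p) := by
      rw [delta_mul_one_sub_tau p (by omega), delta_mul_one_sub_tau p (by omega),
        show p - (a + 1) = a by omega, show p - a = a + 1 by omega]
      ring
    obtain ⟨c, rfl⟩ : ∃ c, a = c + 1 := ⟨a - 1, by omega⟩
    rw [eps, zero_add, delta_one, add_tsub_cancel_right]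
    linear_combination h3 + (1 - tau k p) * h2 c (by omega)
  | succ l ih =>
    refine ⟨ih.2, fun h => ?_⟩
    have h3 := ih.1 (by omega)
    have h4 := ih.2 (by omega)
    have h5 := h2 (a - (l + 1 + 1)) (by omega)
    rw [show a - (l + 1 + 1) + 1 = a - (l + 1) by omega,
      show a - (l + 1 + 1) + 2 = a - l by omega] at h5
    have h6 := h2 l (by omega)
    have h7 := h2 (l + 1) (by omega)
    rw [eps] at h3 h4 ⊢
    linear_combination (delta k 2) * h4 - h3 + (1 - tau k p) * h5 +
      delta k a * (1 - tau k p) * (h6 - h7)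

theorem sum_range_eps (n : ℕ) : ∑ j ∈ Finset.range n, eps k j = delta k n := by
  refine (Finset.sum_range_sub (fun j => delta k j) n).trans ?_
  rw [delta_zero, sub_zero]

/-- Multiplication by `delta k (c + 1)` maps `eps k l * (1 - tau k p)` to the sum of the elements
`eps k j * (1 - tau k p)` with `l + j ≤ c`, so that its iterates count lattice paths. -/
theorem rk_delta_pow_mul {c : ℕ} (hc : p = 2 * (c + 1) + 1) (m : ℕ) : ∀ {l : ℕ}, l ≤ c →
    rk (delta k (c + 1) ^ (m + 1) * (eps k l * (1 - tau k p))) =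
      pathCount (Finset.Icc 0 c) c m l := by
  have hrec : ∀ l ≤ c, delta k (c + 1) * (eps k l * (1 - tau k p)) =
      delta k (c + 1 - l) * (1 - tau k p) := by
    intro l hl
    rw [mul_left_comm, (eps_mul_delta_mul_one_sub_tau p hc l).1 (by omega)]
  induction m with
  | zero =>
    intro l hl
    rw [zero_add, pow_one, hrec l hl, delta_mul_one_sub_tau p (by omega), map_add, map_sub,
      rk_delta (by omega), rk_delta (by omega), rk_delta (by omega)]
    simp [pathCount]
  | succ m ih =>
    intro l hl
    have h1 : delta k (c + 1) ^ (m + 2) * (eps k l * (1 - tau k p)) =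
        ∑ j ∈ Finset.range (c + 1 - l),
          delta k (c + 1) ^ (m + 1) * (eps k j * (1 - tau k p)) := by
      rw [pow_succ _ (m + 1), mul_assoc, hrec l hl, ← sum_range_eps (c + 1 - l)]
      refine (congrArg (_ * ·) (Finset.sum_mul _ _ _)).trans (Finset.mul_sum _ _ _)
    rw [h1, map_sum, pathCount, Nat.cast_sum]
    refine Finset.sum_nbij' (fun j => (j : ℤ)) (fun j => j.toNat) ?_ ?_ ?_ ?_ ?_
    · intro j hj
      rw [Finset.mem_range] at hj
      rw [Finset.mem_filter, Finset.mem_Icc, Nat.abs_cast, Nat.abs_cast]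
      omega
    · intro j hj
      rw [Finset.mem_filter, Finset.mem_Icc, Nat.abs_cast] at hj
      rw [Finset.mem_range]
      rcases abs_cases j with h | h <;> omega
    · exact fun j _ => Int.toNat_natCast j
    · intro j hj
      rw [Finset.mem_filter, Finset.mem_Icc] at hj
      exact Int.toNat_of_nonneg hj.1.1
    · intro j hj
      rw [Finset.mem_range] at hj
      exact ih (by omega)

theorem rk_vir_pow {c : ℕ} (hc : p = 2 * (c + 1) + 1) (d : ℕ) :
    rk (vir k p ^ (d + 1)) = 2 ^ d * pathCount (Finset.Icc 0 c) c d 0 := by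
  have h1 : vir k p = delta k (c + 1) * (1 - tau k p) := by
    rw [vir_eq hc, delta_mul_one_sub_tau p (by omega), show p - (c + 1) = c + 1 + 1 by omega]
    ring
  have h2 := one_sub_tau_pow (k := k) p 1 d
  rw [pow_one] at h2
  have h3 := rk_delta_pow_mul (k := k) p hc d (Nat.zero_le c)
  rw [eps_zero, one_mul] at h3
  have h4 := rk_natCast_pow_mul (k := k) 2 d (delta k (c + 1) ^ (d + 1) * (1 - tau k p))
  rw [h3] at h4
  rw [h1, mul_pow, h2, mul_left_comm]
  exact_mod_cast h4

/-- The ratio of the ranks of the `(d + 1)`-th powers of `eps k (q * a) * vir k q` and of `vir k q`.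
It counts the paths of length `d + 1` from `-a` to itself in the graph on the integers between `-a`
and `a` in which `l` and `m` are adjacent if `|l| + |m| ≤ a`. The only neighbour of `-a` is `0`, so
that `d - 2` vertices remain to be chosen; in the cases `d = 0` and `d = 1` there are no such paths
and one such path, respectively. -/
noncomputable def extPathCount (a : ℕ) : ℕ → ℕ
  | 0 => 0
  | 1 => 1
  | n + 2 => pathCount (Finset.Icc (-a) a) a n 0

theorem rk_eps_pow_mul_vir_pow_eq {e a b : ℕ} (he : e ≠ 0) (ha : p = 2 * a + 1)
    (hb : p ^ e = 2 * b + 1) (n : ℕ) : ∀ d,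
    rk (eps k (p ^ e * a) ^ (d + 1) * vir k (p ^ e) ^ (n + 1)) =
      extPathCount a d * rk (vir k (p ^ e) ^ (n + 1))
  | 0 => by rw [zero_add, rk_eps_pow_one_mul_vir_pow p ha hb, extPathCount, Nat.cast_zero, zero_mul]
  | 1 => by
    rw [rk_eps_pow_two_mul_vir_pow p he ha hb, extPathCount, Nat.cast_one, one_mul]
  | m + 2 => rk_eps_pow_mul_vir_pow p he ha hb n m

theorem rk_cls_sqMod_one_pow (k : Type u) [Field k] (n : ℕ) : rk (cls (sqMod k 1) ^ n) = 1 := by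
  have h := cls_sqMod (k := k) 0
  rw [delta_zero, add_zero, zero_add, delta_one, mul_zero, zero_add] at h
  rw [h, one_pow, ← delta_one, rk_delta one_ne_zero]

/-- The closed form of the ranks of the powers of the classes `cls (sqMod k (p ^ e))`. -/
theorem rk_cls_sqMod_pow {c : ℕ} (hc : p = 2 * (c + 1) + 1) (d e : ℕ) :
    (rk (cls (sqMod k (p ^ e)) ^ (d + 1)) - (p ^ e : ℕ) ^ d) *
        ((p : ℤ) ^ d - extPathCount (c + 1) d) =
      2 ^ d * pathCount (Finset.Icc 0 c) c d 0 *
        (((p ^ e : ℕ) : ℤ) ^ d - (extPathCount (c + 1) d) ^ e) := by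
  have hodd : ∀ e, ∃ b, p ^ e = 2 * b + 1 := fun e => Odd.pow ⟨c + 1, hc⟩
  have h1 := rk_sqMod_pow (k := k) p 1 (b := c + 1) (by rw [pow_one, hc]) d
  rw [pow_one, rk_vir_pow p hc] at h1
  induction e with
  | zero =>
    rw [pow_zero, rk_cls_sqMod_one_pow]
    simp
  | succ e ih =>
    rcases Nat.eq_zero_or_pos e with rfl | he
    · rw [zero_add, pow_one, h1]
      ring
    · obtain ⟨b, hb⟩ := hodd e
      have h2 := rk_sqMod_mul_pow (k := k) p e hc hb d
      rw [rk_eps_pow_mul_vir_pow_eq p he.ne' hc hb d d] at h2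
      have h3 := rk_sqMod_pow (k := k) p e hb d
      rw [h2, h1]
      rw [h3] at ih
      push_cast at ih ⊢
      linear_combination (extPathCount (c + 1) d : ℤ) * ih

end EndoMod

/-! ### Integer points of the Fibonacci polytopes -/

/-- The sequences counted by `pathCount D c n l`. -/
def pathSet (D : Finset ℤ) (c : ℤ) (n : ℕ) (l : ℤ) : Set (Fin n → ℤ) :=
  {z | (∀ i, z i ∈ D) ∧
    ∀ i : Fin n, |(Fin.cons l z : Fin (n + 1) → ℤ) i.castSucc| + |z i| ≤ c}

theorem cons_mem_pathSet {D : Finset ℤ} {c : ℤ} {n : ℕ} {l m : ℤ} {z : Fin n → ℤ} :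
    (Fin.cons m z : Fin (n + 1) → ℤ) ∈ pathSet D c (n + 1) l ↔
      (m ∈ D ∧ |l| + |m| ≤ c) ∧ z ∈ pathSet D c n m := by
  simp only [pathSet, Set.mem_ofPred_eq, Fin.forall_fin_succ, Fin.cons_zero, Fin.cons_succ,
    Fin.castSucc_zero, ← Fin.succ_castSucc]
  tauto

theorem finite_pathSet (D : Finset ℤ) (c : ℤ) (n : ℕ) (l : ℤ) : (pathSet D c n l).Finite :=
  (Fintype.piFinset fun _ : Fin n => D).finite_toSet.subset fun _ hz =>
    Finset.mem_coe.2 (Fintype.mem_piFinset.2 hz.1)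

theorem ncard_pathSet (D : Finset ℤ) (c : ℤ) (n : ℕ) (l : ℤ) :
    (pathSet D c n l).ncard = pathCount D c n l := by
  induction n generalizing l with
  | zero =>
    have : pathSet D c 0 l = {Fin.elim0} := by
      ext z
      simp [pathSet, Subsingleton.elim z Fin.elim0]
    rw [this, Set.ncard_singleton, pathCount]
  | succ n ih =>
    let e : pathSet D c (n + 1) l ≃
        Σ m : {m // m ∈ D.filter fun m => |l| + |m| ≤ c}, pathSet D c n m :=
      { toFun := fun z =>
          have h := cons_mem_pathSet.1 ((Fin.cons_self_tail z.1).symm ▸ z.2)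
          ⟨⟨z.1 0, Finset.mem_filter.2 h.1⟩, ⟨Fin.tail z.1, h.2⟩⟩
        invFun := fun x =>
          ⟨Fin.cons x.1.1 x.2.1, cons_mem_pathSet.2 ⟨Finset.mem_filter.1 x.1.2, x.2.2⟩⟩
        left_inv := fun z => Subtype.ext (Fin.cons_self_tail z.1)
        right_inv := fun _ => rfl }
    have hfin : ∀ m, Finite (pathSet D c n m) := fun m => (finite_pathSet D c n m).to_subtype
    rw [← Nat.card_coe_set_eq, Nat.card_congr e, Nat.card_sigma, pathCount,
      ← Finset.sum_coe_sort _ (pathCount D c n)]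
    refine Finset.sum_congr rfl fun m _ => ?_
    rw [Nat.card_coe_set_eq, ih]

theorem mem_pathSet_zero {D : Finset ℤ} {c : ℤ} (hD : ∀ m ∈ D, |m| ≤ c) {n : ℕ} {z : Fin n → ℤ} :
    z ∈ pathSet D c n 0 ↔
      (∀ i, z i ∈ D) ∧ ∀ i j : Fin n, (j : ℕ) = (i : ℕ) + 1 → |z i| + |z j| ≤ c := by
  refine and_congr_right fun hz => ⟨fun h i j hij => ?_, fun h i => ?_⟩
  · have h1 := h j
    rwa [show j.castSucc = i.succ from Fin.ext hij, Fin.cons_succ] at h1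
  · rcases n with _ | n
    · exact i.elim0
    · refine Fin.cases ?_ (fun i => ?_) i
      · rw [Fin.castSucc_zero, Fin.cons_zero, abs_zero, zero_add]
        exact hD _ (hz 0)
      · rw [← Fin.succ_castSucc, Fin.cons_succ]
        exact h _ _ (by simp)

theorem latticeCount_extFibonacciPolytope (c n : ℕ) :
    latticeCount c (extFibonacciPolytope n) = pathCount (Finset.Icc (-c) c) c n 0 := by
  rw [← ncard_pathSet, latticeCount]
  congr 1
  ext z
  rw [mem_pathSet_zero (by simp [abs_le]), Set.mem_ofPred_eq]
  have hcast : ∀ x : ℤ, |(x : ℝ)| = ((|x| : ℤ) : ℝ) := fun x => (Int.cast_abs).symm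
  have hI : ∀ x : ℤ, x ∈ Finset.Icc (-c : ℤ) c ↔ |x| ≤ c := fun x => by rw [Finset.mem_Icc, abs_le]
  constructor
  · rintro ⟨x, ⟨hx1, hx2⟩, hx⟩
    have hx' : ∀ i, (z i : ℝ) = c * x i := fun i => (congrFun hx i).symm
    have hc : (0 : ℝ) ≤ c := Nat.cast_nonneg c
    refine ⟨fun i => ?_, fun i j hij => ?_⟩
    · have h1 : |(z i : ℝ)| ≤ c := by
        rw [hx', abs_mul, abs_of_nonneg hc]
        exact mul_le_of_le_one_right hc (abs_le.2 (hx1 i))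
      rw [hI]
      rw [hcast] at h1
      exact_mod_cast h1
    · have h1 : |(z i : ℝ)| + |(z j : ℝ)| ≤ c := by
        rw [hx', hx', abs_mul, abs_mul, abs_of_nonneg hc, ← mul_add]
        exact mul_le_of_le_one_right hc (hx2 i j hij)
      rw [hcast, hcast] at h1
      exact_mod_cast h1
  · rintro ⟨h1, h2⟩
    rcases Nat.eq_zero_or_pos c with rfl | hc
    · refine ⟨0, ⟨by simp, by simp⟩, funext fun i => ?_⟩
      have := (hI _).1 (h1 i)
      simp only [Nat.cast_zero, abs_nonpos_iff] at this
      simp [this]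
    · have hc : (0 : ℝ) < c := Nat.cast_pos.2 hc
      refine ⟨fun i => z i / c, ⟨fun i => ?_, fun i j hij => ?_⟩, funext fun i => ?_⟩
      · have h3 : |(z i : ℝ)| ≤ c := by
          rw [hcast]
          exact_mod_cast (hI _).1 (h1 i)
        refine abs_le.1 ?_
        rwa [abs_div, abs_of_pos hc, div_le_one hc]
      · have h3 : |(z i : ℝ)| + |(z j : ℝ)| ≤ c := by
          rw [hcast, hcast]
          exact_mod_cast h2 i j hij
        rwa [abs_div, abs_div, abs_of_pos hc, ← add_div, div_le_one hc]
      · exact mul_div_cancel₀ _ hc.ne'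

theorem latticeCount_fibonacciPolytope (c n : ℕ) :
    latticeCount c (fibonacciPolytope n) = pathCount (Finset.Icc 0 c) c n 0 := by
  rw [← ncard_pathSet, latticeCount]
  congr 1
  ext z
  rw [mem_pathSet_zero (by
    intro m hm
    rw [Finset.mem_Icc] at hm
    exact abs_le.2 ⟨by omega, hm.2⟩), Set.mem_ofPred_eq]
  have hc : (0 : ℝ) ≤ c := Nat.cast_nonneg c
  constructor
  · rintro ⟨x, ⟨hx1, hx2⟩, hx⟩
    have hx' : ∀ i, (z i : ℝ) = c * x i := fun i => (congrFun hx i).symm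
    have h0 : ∀ i, 0 ≤ z i := fun i => by
      have : (0 : ℝ) ≤ z i := by
        rw [hx']
        exact mul_nonneg hc (hx1 i).1
      exact_mod_cast this
    refine ⟨fun i => Finset.mem_Icc.2 ⟨h0 i, ?_⟩, fun i j hij => ?_⟩
    · have h1 : (z i : ℝ) ≤ c := by
        rw [hx']
        exact mul_le_of_le_one_right hc (hx1 i).2
      exact_mod_cast h1
    · have h1 : (z i : ℝ) + z j ≤ c := by
        rw [hx', hx', ← mul_add]
        exact mul_le_of_le_one_right hc (hx2 i j hij)
      rw [abs_of_nonneg (h0 i), abs_of_nonneg (h0 j)]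
      exact_mod_cast h1
  · rintro ⟨h1, h2⟩
    simp only [Finset.mem_Icc] at h1
    rcases Nat.eq_zero_or_pos c with rfl | hc
    · refine ⟨0, ⟨by simp, by simp⟩, funext fun i => ?_⟩
      have : z i = 0 := le_antisymm (by simpa using (h1 i).2) (h1 i).1
      simp [this]
    · have hc : (0 : ℝ) < c := Nat.cast_pos.2 hc
      refine ⟨fun i => z i / c, ⟨fun i => ⟨?_, ?_⟩, fun i j hij => ?_⟩, funext fun i => ?_⟩
      · exact div_nonneg (by exact_mod_cast (h1 i).1) hc.le
      · rw [div_le_one hc]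
        exact_mod_cast (h1 i).2
      · have h3 := h2 i j hij
        rw [abs_of_nonneg (h1 i).1, abs_of_nonneg (h1 j).1] at h3
        change (z i : ℝ) / c + z j / c ≤ 1
        rw [← add_div, div_le_one hc]
        exact_mod_cast h3
      · exact mul_div_cancel₀ _ hc.ne'

theorem pathCount_le (D : Finset ℤ) (c : ℤ) (n : ℕ) (l : ℤ) : pathCount D c n l ≤ D.card ^ n := by
  induction n generalizing l with
  | zero => rw [pathCount, pow_zero]
  | succ n ih =>
    rw [pathCount]
    calc _ ≤ ∑ m ∈ D, pathCount D c n m := Finset.sum_le_sum_of_subset (Finset.filter_subset _ _)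
      _ ≤ ∑ _m ∈ D, D.card ^ n := Finset.sum_le_sum fun m _ => ih m
      _ = D.card ^ (n + 1) := by rw [Finset.sum_const, smul_eq_mul, pow_succ']

theorem EndoMod.extPathCount_lt {a : ℕ} (ha : a ≠ 0) : ∀ d, extPathCount a d < (2 * a + 1) ^ d
  | 0 => by simp [extPathCount]
  | 1 => by
    rw [extPathCount, pow_one]
    omega
  | n + 2 => by
    refine (pathCount_le _ _ n 0).trans_lt ?_
    rw [Int.card_Icc, show ((a : ℤ) + 1 - -a).toNat = 2 * a + 1 by omega]
    exact Nat.pow_lt_pow_right (by omega) (by omega)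

theorem EndoMod.extFibonacciCountSubTwo_eq (a : ℕ) :
    ∀ d, extFibonacciCountSubTwo a d = extPathCount a d
  | 0 => rfl
  | 1 => rfl
  | n + 2 => latticeCount_extFibonacciPolytope a n

/-! ### Power series modulo powers of the variables -/

section

variable {k : Type u} [Field k]

/-- The step from `s` to `insert i s` splits off the monomials divisible by `X i ^ q`. -/
theorem mem_span_X_pow_of_coeff_eq_zero {σ : Type*} [DecidableEq σ] (q : ℕ) (s : Finset σ) :
    ∀ {g : MvPowerSeries σ k},
    (∀ m : σ →₀ ℕ, (∀ i ∈ s, m i < q) → MvPowerSeries.coeff m g = 0) →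
    g ∈ Ideal.span (Set.range fun i => (MvPowerSeries.X i : MvPowerSeries σ k) ^ q) := by
  induction s using Finset.induction_on with
  | empty =>
    intro g h
    have : g = 0 := MvPowerSeries.ext fun m => h m (by simp)
    rw [this]
    exact zero_mem _
  | insert i s hi ih =>
    intro g h
    let g₁ : MvPowerSeries σ k := fun m => if m i < q then 0 else MvPowerSeries.coeff m g
    have h1 : g₁ ∈ Ideal.span (Set.range fun i => (MvPowerSeries.X i : MvPowerSeries σ k) ^ q) := by
      have h2 : (MvPowerSeries.X i : MvPowerSeries σ k) ^ q ∣ g₁ :=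
        MvPowerSeries.X_pow_dvd_iff.2 fun m hm => if_pos hm
      obtain ⟨c, hc⟩ := h2
      rw [hc]
      exact Ideal.mul_mem_right _ _ (Ideal.subset_span ⟨i, rfl⟩)
    have h2 : g - g₁ ∈ Ideal.span
        (Set.range fun i => (MvPowerSeries.X i : MvPowerSeries σ k) ^ q) := by
      refine ih fun m hm => ?_
      rw [map_sub]
      have h3 : MvPowerSeries.coeff m g₁ = if m i < q then 0 else MvPowerSeries.coeff m g := rfl
      rw [h3]
      split_ifs with h4
      · rw [h m (by simpa using ⟨h4, hm⟩), sub_zero]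
      · rw [sub_self]
    exact (sub_add_cancel g g₁) ▸ add_mem h2 h1

theorem mem_span_X_pow_iff {σ : Type*} [Fintype σ] (q : ℕ) {g : MvPowerSeries σ k} :
    g ∈ Ideal.span (Set.range fun i => (MvPowerSeries.X i : MvPowerSeries σ k) ^ q) ↔
      ∀ m : σ →₀ ℕ, (∀ i, m i < q) → MvPowerSeries.coeff m g = 0 := by
  classical
  refine ⟨fun h m hm => ?_, fun h =>
    mem_span_X_pow_of_coeff_eq_zero q Finset.univ fun m hm => h m fun i => hm i (Finset.mem_univ i)⟩
  obtain ⟨c, rfl⟩ := Ideal.mem_span_range_iff_exists_fun.1 h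
  rw [map_sum]
  refine Finset.sum_eq_zero fun i _ => ?_
  exact MvPowerSeries.X_pow_dvd_iff.1 (dvd_mul_left _ _) m (hm i)

end

namespace EndoMod

variable {k : Type u} [Field k]

open Polynomial TensorProduct

/-- The monomial with exponents `α` in the tensor power of `k[x] ⧸ (x ^ q)`. -/
noncomputable def boxVec (k : Type u) [Field k] (q : ℕ) :
    ∀ n, (Fin n → ℕ) → (tpow (sqMod k q) n).carrier
  | 0, _ => (1 : k)
  | n + 1, α => (Ideal.Quotient.mk (Ideal.span {(X : k[X]) ^ q}) (X ^ α 0)) ⊗ₜ[k]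
      boxVec k q n (Fin.tail α)

theorem boxVec_eq_zero {q n : ℕ} {α : Fin n → ℕ} (h : ∃ i, q ≤ α i) : boxVec k q n α = 0 := by
  induction n with
  | zero => exact h.choose.elim0
  | succ n ih =>
    rw [Fin.exists_fin_succ] at h
    change (Ideal.Quotient.mk (Ideal.span {(X : k[X]) ^ q}) (X ^ α 0)) ⊗ₜ[k]
      boxVec k q n (Fin.tail α) = 0
    rcases h with h | h
    · rw [Ideal.Quotient.eq_zero_iff_mem.2 (Ideal.mem_span_singleton.2 (pow_dvd_pow X h)),
        zero_tmul]
    · rw [ih (α := Fin.tail α) h, tmul_zero]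

theorem tpow_T_boxVec {q n : ℕ} (α : Fin n → ℕ) :
    (tpow (sqMod k q) n).T (boxVec k q n α) =
      ∑ i, boxVec k q n (Function.update α i (α i + 2)) := by
  induction n with
  | zero => exact (Finset.sum_of_isEmpty _).symm
  | succ n ih =>
    rw [Fin.sum_univ_succ]
    change (Ideal.Quotient.mk (Ideal.span {(X : k[X]) ^ q}) (X ^ 2) *
        Ideal.Quotient.mk (Ideal.span {(X : k[X]) ^ q}) (X ^ α 0)) ⊗ₜ[k]
          boxVec k q n (Fin.tail α) +
        (Ideal.Quotient.mk (Ideal.span {(X : k[X]) ^ q}) (X ^ α 0)) ⊗ₜ[k]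
          (tpow (sqMod k q) n).T (boxVec k q n (Fin.tail α)) = _
    rw [ih, tmul_sum, ← map_mul, ← pow_add, add_comm 2]
    refine congrArg₂ (· + ·) ?_ (Finset.sum_congr rfl fun i _ => ?_)
    · change _ = (Ideal.Quotient.mk (Ideal.span {(X : k[X]) ^ q})
        (X ^ (Function.update α 0 (α 0 + 2)) 0)) ⊗ₜ[k]
          boxVec k q n (Fin.tail (Function.update α 0 _))
      rw [Function.update_self, Fin.tail_update_zero]
    · change _ = (Ideal.Quotient.mk (Ideal.span {(X : k[X]) ^ q})
        (X ^ (Function.update α i.succ (α i.succ + 2)) 0)) ⊗ₜ[k]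
          boxVec k q n (Fin.tail (Function.update α i.succ _))
      rw [Function.update_of_ne (Fin.succ_ne_zero i).symm, Fin.tail_update_succ]
      rfl

theorem span_boxVec (q n : ℕ) :
    Submodule.span k (Set.range (boxVec k q n)) = ⊤ := by
  induction n with
  | zero =>
    refine eq_top_iff.2 fun (v : k) _ => ?_
    have h : v • boxVec k q 0 Fin.elim0 ∈ Submodule.span k (Set.range (boxVec k q 0)) :=
      Submodule.smul_mem _ _ (Submodule.subset_span ⟨_, rfl⟩)
    have h2 : v • boxVec k q 0 Fin.elim0 = v := mul_one v
    rwa [h2] at h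
  | succ n ih =>
    let S : Submodule k ((k[X] ⧸ Ideal.span {(X : k[X]) ^ q}) ⊗[k] (tpow (sqMod k q) n).carrier) :=
      Submodule.span k (Set.range (boxVec k q (n + 1)))
    have h1 : ∀ (α : Fin n → ℕ) (f : k[X]),
        Ideal.Quotient.mk (Ideal.span {(X : k[X]) ^ q}) f ⊗ₜ[k] boxVec k q n α ∈ S := by
      intro α f
      let L : k[X] →ₗ[k] (k[X] ⧸ Ideal.span {(X : k[X]) ^ q}) ⊗[k] (tpow (sqMod k q) n).carrier :=
        (TensorProduct.mk k _ _).flip (boxVec k q n α) ∘ₗ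
          (Ideal.Quotient.mkₐ k (Ideal.span {(X : k[X]) ^ q})).toLinearMap
      change L f ∈ S
      induction f using Polynomial.induction_on' with
      | add f g hf hg => rw [map_add]; exact add_mem hf hg
      | monomial m c =>
        rw [← smul_X_eq_monomial, map_smul]
        exact S.smul_mem c (Submodule.subset_span ⟨Fin.cons m α, rfl⟩)
    have h2 : ∀ (v : (tpow (sqMod k q) n).carrier) (f : k[X] ⧸ Ideal.span {(X : k[X]) ^ q}),
        f ⊗ₜ[k] v ∈ S := by
      intro v f
      obtain ⟨f, rfl⟩ := Ideal.Quotient.mk_surjective f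
      have hv : v ∈ Submodule.span k (Set.range (boxVec k q n)) := ih ▸ Submodule.mem_top
      induction hv using Submodule.span_induction with
      | zero => rw [tmul_zero]; exact zero_mem _
      | add v w _ _ hv hw => rw [tmul_add]; exact add_mem hv hw
      | smul c v _ hv => rw [tmul_smul]; exact S.smul_mem c hv
      | mem v hv =>
        obtain ⟨α, rfl⟩ := hv
        exact h1 α f
    refine eq_top_iff.2 fun w _ => ?_
    change w ∈ S
    induction w using TensorProduct.induction_on with
    | zero => exact zero_mem _
    | add v w hv hw => exact add_mem (hv trivial) (hw trivial)
    | tmul f v => exact h2 v f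

theorem span_boxVec_fin (q n : ℕ) :
    Submodule.span k (Set.range fun α : Fin n → Fin q => boxVec k q n fun i => α i) = ⊤ := by
  rw [eq_top_iff, ← span_boxVec q n, Submodule.span_le]
  rintro _ ⟨α, rfl⟩
  by_cases h : ∃ i, q ≤ α i
  · rw [boxVec_eq_zero h]
    exact zero_mem _
  · push Not at h
    exact Submodule.subset_span ⟨fun i => ⟨α i, h i⟩, rfl⟩

theorem finrank_tpow_sqMod (q n : ℕ) : Module.finrank k (tpow (sqMod k q) n).carrier = q ^ n := by
  rw [finrank_tpow]
  exact congrArg (· ^ n) (finrank_jordan q)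

theorem linearIndependent_boxVec (q n : ℕ) :
    LinearIndependent k fun α : Fin n → Fin q => boxVec k q n fun i => α i :=
  linearIndependent_of_top_le_span_of_card_eq_finrank (span_boxVec_fin q n).ge (by
    rw [finrank_tpow_sqMod]
    simp)

/-- The reduction of power series in `n` variables modulo the `q`-th powers of the variables, with
values in the tensor power of `k[x] ⧸ (x ^ q)`. -/
noncomputable def toBox (k : Type u) [Field k] (q n : ℕ) :
    MvPowerSeries (Fin n) k →ₗ[k] (tpow (sqMod k q) n).carrier :=
  ∑ α : Fin n → Fin q,
    (MvPowerSeries.coeff (Finsupp.equivFunOnFinite.symm fun i => (α i : ℕ))).smulRight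
      (boxVec k q n fun i => α i)

theorem toBox_apply (q n : ℕ) (g : MvPowerSeries (Fin n) k) : toBox k q n g =
    ∑ α : Fin n → Fin q, MvPowerSeries.coeff (Finsupp.equivFunOnFinite.symm fun i => (α i : ℕ)) g •
      boxVec k q n fun i => α i := by
  simp [toBox]

theorem toBox_eq_zero_iff {q n : ℕ} {g : MvPowerSeries (Fin n) k} : toBox k q n g = 0 ↔
    g ∈ Ideal.span (Set.range fun i => (MvPowerSeries.X i : MvPowerSeries (Fin n) k) ^ q) := by
  rw [mem_span_X_pow_iff, toBox_apply]
  constructor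
  · intro h m hm
    have h1 := Fintype.linearIndependent_iff.1 (linearIndependent_boxVec q n) _ h
      fun i => ⟨m i, hm i⟩
    rw [← h1]
    exact congrArg (fun e => MvPowerSeries.coeff e g) (Finsupp.ext fun i => rfl)
  · intro h
    refine Finset.sum_eq_zero fun α _ => ?_
    rw [h _ fun i => (α i).2, zero_smul]

theorem toBox_monomial (q : ℕ) {n : ℕ} (β : Fin n →₀ ℕ) (c : k) :
    toBox k q n (MvPowerSeries.monomial β c) = c • boxVec k q n β := by
  classical
  by_cases h : ∃ i, q ≤ β i
  · rw [boxVec_eq_zero h, smul_zero, toBox_eq_zero_iff, mem_span_X_pow_iff]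
    intro m hm
    rw [MvPowerSeries.coeff_monomial_ne]
    rintro rfl
    obtain ⟨i, hi⟩ := h
    exact absurd (hm i) (by omega)
  · push Not at h
    rw [toBox_apply, Finset.sum_eq_single fun i => ⟨β i, h i⟩]
    · have : Finsupp.equivFunOnFinite.symm (fun i => β i) = β := Finsupp.ext fun i => rfl
      rw [this, MvPowerSeries.coeff_monomial_same]
    · intro α _ hα
      rw [MvPowerSeries.coeff_monomial_ne, zero_smul]
      rintro rfl
      exact hα rfl
    · simp

theorem toBox_surjective (q n : ℕ) : Function.Surjective (toBox k q n) := by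
  rw [← LinearMap.range_eq_top, eq_top_iff, ← span_boxVec q n, Submodule.span_le]
  rintro _ ⟨α, rfl⟩
  refine ⟨MvPowerSeries.monomial (Finsupp.equivFunOnFinite.symm α) 1, ?_⟩
  rw [toBox_monomial, one_smul]
  rfl

/-- Multiplication by the sum of the squares of the variables corresponds to `T`. -/
theorem toBox_mul (q : ℕ) {n : ℕ} (g : MvPowerSeries (Fin n) k) :
    toBox k q n ((∑ i, MvPowerSeries.X i ^ 2) * g) = (tpow (sqMod k q) n).T (toBox k q n g) := by
  have hmon : ∀ (β : Fin n →₀ ℕ) (c : k),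
      toBox k q n ((∑ i, MvPowerSeries.X i ^ 2) * MvPowerSeries.monomial β c) =
        (tpow (sqMod k q) n).T (toBox k q n (MvPowerSeries.monomial β c)) := by
    intro β c
    rw [toBox_monomial, map_smul, tpow_T_boxVec, Finset.sum_mul, map_sum, Finset.smul_sum]
    refine Finset.sum_congr rfl fun i _ => ?_
    rw [MvPowerSeries.X_pow_eq, MvPowerSeries.monomial_mul_monomial, one_mul, toBox_monomial]
    congr 2
    funext j
    by_cases hj : j = i
    · subst hj
      simp [add_comm]
    · simp [Function.update_of_ne hj, Ne.symm hj]
  -- both sides depend only on the coefficients of `g` at the exponents less than `q`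
  let g' : MvPowerSeries (Fin n) k := ∑ α : Fin n → Fin q, MvPowerSeries.monomial
    (Finsupp.equivFunOnFinite.symm fun i => (α i : ℕ))
    (MvPowerSeries.coeff (Finsupp.equivFunOnFinite.symm fun i => (α i : ℕ)) g)
  have h1 : toBox k q n (g - g') = 0 := by
    rw [map_sub, map_sum, toBox_apply, sub_eq_zero]
    refine Finset.sum_congr rfl fun α _ => ?_
    rw [toBox_monomial]
    rfl
  have h2 : toBox k q n ((∑ i, MvPowerSeries.X i ^ 2) * (g - g')) = 0 :=
    toBox_eq_zero_iff.2 (Ideal.mul_mem_left _ _ (toBox_eq_zero_iff.1 h1))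
  have h3 : toBox k q n ((∑ i, MvPowerSeries.X i ^ 2) * g') =
      (tpow (sqMod k q) n).T (toBox k q n g') := by
    rw [Finset.mul_sum, map_sum, map_sum, map_sum]
    exact Finset.sum_congr rfl fun α _ => hmon _ _
  rw [mul_sub, map_sub, sub_eq_zero] at h2
  rw [map_sub, sub_eq_zero] at h1
  rw [h2, h1, h3]

/-! ### The length of the quotient -/

/-- If the surjective linear map `θ` on power series kills exactly the ideal generated by the `q`-th
powers and the sum of squares, its target has the dimension of the kernel of `T`. -/
theorem finrank_eq_rk {q n : ℕ} {V : Type*} [AddCommGroup V] [Module k V]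
    (θ : MvPowerSeries (Fin n) k →ₗ[k] V) (hθ : Function.Surjective θ)
    (hker : ∀ g, θ g = 0 ↔ ∃ h, g - (∑ i, MvPowerSeries.X i ^ 2) * h ∈
      Ideal.span (Set.range fun i => (MvPowerSeries.X i : MvPowerSeries (Fin n) k) ^ q)) :
    Module.Finite k V ∧ (Module.finrank k V : ℤ) = rk (cls (sqMod k q) ^ n) := by
  let T := (tpow (sqMod k q) n).T
  let ψ := (LinearMap.range T).mkQ ∘ₗ toBox k q n
  have hψ : Function.Surjective ψ :=
    ((LinearMap.range T).mkQ_surjective).comp (toBox_surjective q n)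
  have hk : LinearMap.ker θ = LinearMap.ker ψ := by
    ext g
    rw [LinearMap.mem_ker, hker, LinearMap.mem_ker, LinearMap.comp_apply, Submodule.mkQ_apply,
      Submodule.Quotient.mk_eq_zero]
    constructor
    · rintro ⟨h, hh⟩
      rw [← toBox_eq_zero_iff, map_sub, toBox_mul, sub_eq_zero] at hh
      exact ⟨_, hh.symm⟩
    · rintro ⟨v, hv⟩
      obtain ⟨h, rfl⟩ := toBox_surjective q n v
      refine ⟨h, ?_⟩
      rw [← toBox_eq_zero_iff, map_sub, toBox_mul, sub_eq_zero]
      exact hv.symm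
  let E : V ≃ₗ[k] ((tpow (sqMod k q) n).carrier ⧸ LinearMap.range T) :=
    (θ.quotKerEquivOfSurjective hθ).symm ≪≫ₗ Submodule.quotEquivOfEq _ _ hk ≪≫ₗ
      ψ.quotKerEquivOfSurjective hψ
  refine ⟨Module.Finite.equiv E.symm, ?_⟩
  rw [← cls_tpow, rk_cls, E.finrank_eq]
  have h1 := LinearMap.finrank_range_add_finrank_ker T
  have h2 := (LinearMap.range T).finrank_quotient_add_finrank
  congr 1
  change _ = Module.finrank k (LinearMap.ker T)
  omega

end EndoMod

/-- Over a local `k`-algebra with residue field `k`, length is the dimension over `k`. -/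
theorem length_eq_finrank {k R : Type*} [Field k] [CommRing R] [IsLocalRing R] [Algebra k R]
    (hk : Function.Surjective (algebraMap k (IsLocalRing.ResidueField R))) (M : Type*)
    [AddCommGroup M] [Module R M] [Module k M] [IsScalarTower k R M] [Module.Finite k M] :
    Module.length R M = Module.finrank k M := by
  have hN : IsNoetherian R M := isNoetherian_of_tower k inferInstance
  have hA : IsArtinian R M := isArtinian_of_tower k inferInstance
  have hM : IsFiniteLength R M := isFiniteLength_iff_isNoetherian_isArtinian.2 ⟨hN, hA⟩
  clear hN hA
  revert ‹Module k M›
  induction hM with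
  | of_subsingleton =>
    intro _ _ _
    rw [Module.length_eq_zero, Module.finrank_zero_of_subsingleton, Nat.cast_zero]
  | @of_simple_quotient M _ _ N hs hN ih =>
    intro _ _ _
    have : Module.Finite k N := inferInstanceAs (Module.Finite k (N.restrictScalars k))
    have h1 := (N.restrictScalars k).finrank_quotient_add_finrank
    have h2 : Module.finrank k (M ⧸ N) = 1 := by
      obtain ⟨I, hI, ⟨e⟩⟩ := isSimpleModule_iff_quot_maximal.1 hs
      obtain rfl := IsLocalRing.eq_maximalIdeal hI
      rw [(e.restrictScalars k).finrank_eq]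
      exact (LinearEquiv.ofBijective (Algebra.linearMap k (IsLocalRing.ResidueField R))
        ⟨(algebraMap k (IsLocalRing.ResidueField R)).injective, hk⟩).finrank_eq.symm.trans
          (Module.finrank_self k)
    have h3 := Module.length_eq_add_of_exact N.subtype N.mkQ N.subtype_injective
      N.mkQ_surjective (LinearMap.exact_subtype_mkQ N)
    rw [h3, ih, Module.length_eq_one, ← h1]
    change _ = ((Module.finrank k (M ⧸ N) + Module.finrank k N : ℕ) : ℕ∞)
    rw [h2]
    push_cast
    exact add_comm _ _

/-! ### The quadric -/

section

variable {k : Type u} [Field k]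

theorem mem_span_X_iff {n : ℕ} {g : MvPowerSeries (Fin n) k} :
    g ∈ Ideal.span (Set.range fun i => (MvPowerSeries.X i : MvPowerSeries (Fin n) k)) ↔
      MvPowerSeries.constantCoeff g = 0 := by
  have h := mem_span_X_pow_iff (k := k) (σ := Fin n) 1 (g := g)
  simp only [pow_one] at h
  rw [h]
  constructor
  · exact fun h => h 0 fun i => zero_lt_one
  · intro h m hm
    obtain rfl : m = 0 := Finsupp.ext fun i => by simpa using hm i
    exact h

theorem constantCoeff_sumSquares (d : ℕ) : MvPowerSeries.constantCoeff (sumSquares k d) = 0 := by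
  simp [sumSquares]

theorem sumSquares_ne_zero (d : ℕ) : sumSquares k d ≠ 0 := by
  classical
  intro h
  have h1 := congrArg (MvPowerSeries.coeff (Finsupp.single 0 2)) h
  rw [sumSquares, map_sum, map_zero, Finset.sum_eq_single 0] at h1
  · rw [MvPowerSeries.X_pow_eq, MvPowerSeries.coeff_monomial_same] at h1
    exact one_ne_zero h1
  · intro i _ hi
    rw [MvPowerSeries.X_pow_eq, MvPowerSeries.coeff_monomial_ne]
    intro h2
    have h3 := DFunLike.congr_fun h2 0
    simp [hi] at h3
  · simp

theorem mk_mem_maximalIdeal_iff {d : ℕ} {g : MvPowerSeries (Fin (d + 1)) k} :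
    Ideal.Quotient.mk (Ideal.span {sumSquares k d}) g ∈
      IsLocalRing.maximalIdeal (QuadricRing k d) ↔ MvPowerSeries.constantCoeff g = 0 := by
  rw [IsLocalRing.mem_maximalIdeal, mem_nonunits_iff, not_iff_comm]
  constructor
  · intro h
    exact (MvPowerSeries.isUnit_iff_constantCoeff.2 (isUnit_iff_ne_zero.2 h)).map _
  · intro h h0
    obtain ⟨u, hu⟩ := h.exists_right_inv
    obtain ⟨u, rfl⟩ := Ideal.Quotient.mk_surjective u
    rw [← map_mul, ← map_one (Ideal.Quotient.mk _), Ideal.Quotient.eq,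
      Ideal.mem_span_singleton] at hu
    obtain ⟨c, hc⟩ := hu
    have h1 := congrArg MvPowerSeries.constantCoeff hc
    simp [h0, constantCoeff_sumSquares] at h1

theorem residueField_surjective (d : ℕ) :
    Function.Surjective (algebraMap k (IsLocalRing.ResidueField (QuadricRing k d))) := by
  intro r
  obtain ⟨r, rfl⟩ := IsLocalRing.residue_surjective r
  obtain ⟨g, rfl⟩ := Ideal.Quotient.mk_surjective r
  refine ⟨MvPowerSeries.constantCoeff g, ?_⟩
  have h : Ideal.Quotient.mk (Ideal.span {sumSquares k d})
      (MvPowerSeries.C (MvPowerSeries.constantCoeff g) - g) ∈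
        IsLocalRing.maximalIdeal (QuadricRing k d) := by
    rw [mk_mem_maximalIdeal_iff, map_sub, MvPowerSeries.constantCoeff_C, sub_self]
  rw [map_sub] at h
  exact Ideal.Quotient.eq.2 h

theorem charP_quadricRing (p : ℕ) [CharP k p] (d : ℕ) : CharP (QuadricRing k d) p :=
  charP_of_injective_algebraMap (algebraMap k (QuadricRing k d)).injective p

/-- As `q`-th powers are additive, the `q`-th powers of the generators `X i` of the maximal ideal
generate its Frobenius power. -/
theorem frobeniusPowerIdeal_maximalIdeal (p : ℕ) [Fact p.Prime] [CharP k p] (d e : ℕ) :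
    frobeniusPowerIdeal (IsLocalRing.maximalIdeal (QuadricRing k d)) (p ^ e) =
      (Ideal.span (Set.range fun i =>
        (MvPowerSeries.X i : MvPowerSeries (Fin (d + 1)) k) ^ p ^ e)).map
        (Ideal.Quotient.mk (Ideal.span {sumSquares k d})) := by
  have := charP_quadricRing (k := k) p d
  apply le_antisymm
  · refine Ideal.span_le.2 ?_
    rintro _ ⟨x, hx, rfl⟩
    obtain ⟨g, rfl⟩ := Ideal.Quotient.mk_surjective x
    have h1 := mem_span_X_iff.2 (mk_mem_maximalIdeal_iff.1 hx)
    obtain ⟨c, rfl⟩ := Ideal.mem_span_range_iff_exists_fun.1 h1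
    change Ideal.Quotient.mk _ _ ^ p ^ e ∈ _
    rw [map_sum, sum_pow_char_pow]
    refine Ideal.sum_mem _ fun i _ => ?_
    rw [map_mul, mul_pow, ← map_pow (Ideal.Quotient.mk _) (MvPowerSeries.X i)]
    exact Ideal.mul_mem_left _ _ (Ideal.mem_map_of_mem _ (Ideal.subset_span ⟨i, rfl⟩))
  · rw [Ideal.map_span, Ideal.span_le]
    rintro _ ⟨_, ⟨i, rfl⟩, rfl⟩
    refine Ideal.subset_span ⟨Ideal.Quotient.mk _ (MvPowerSeries.X i), ?_, (map_pow _ _ _).symm⟩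
    exact mk_mem_maximalIdeal_iff.2 (MvPowerSeries.constantCoeff_X i)

/-- The lengths whose growth defines the Hilbert--Kunz multiplicity are the ranks of the powers of
the class of `k[x] ⧸ (x ^ q)` with `T = x ^ 2`. -/
theorem length_quotient_frobeniusPowerIdeal (p : ℕ) [Fact p.Prime] [CharP k p] (d e : ℕ) :
    ∃ l : ℕ, Module.length (QuadricRing k d) (QuadricRing k d ⧸
        frobeniusPowerIdeal (IsLocalRing.maximalIdeal (QuadricRing k d)) (p ^ e)) = l ∧
      (l : ℤ) = EndoMod.rk (EndoMod.cls (EndoMod.sqMod k (p ^ e)) ^ (d + 1)) := by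
  let K := frobeniusPowerIdeal (IsLocalRing.maximalIdeal (QuadricRing k d)) (p ^ e)
  let θ : MvPowerSeries (Fin (d + 1)) k →ₐ[k] QuadricRing k d ⧸ K :=
    (Ideal.Quotient.mkₐ k K).comp (Ideal.Quotient.mkₐ k (Ideal.span {sumSquares k d}))
  have hθ : Function.Surjective θ :=
    (Ideal.Quotient.mkₐ_surjective k K).comp (Ideal.Quotient.mkₐ_surjective k _)
  obtain ⟨hfin, hrk⟩ := EndoMod.finrank_eq_rk (q := p ^ e) θ.toLinearMap hθ (by
    intro g
    change Ideal.Quotient.mk K (Ideal.Quotient.mk (Ideal.span {sumSquares k d}) g) = 0 ↔ _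
    rw [Ideal.Quotient.eq_zero_iff_mem]
    change _ ∈ frobeniusPowerIdeal _ _ ↔ _
    rw [frobeniusPowerIdeal_maximalIdeal,
      Ideal.mem_map_iff_of_surjective _ Ideal.Quotient.mk_surjective]
    constructor
    · rintro ⟨j, hj, h⟩
      rw [eq_comm, Ideal.Quotient.eq, Ideal.mem_span_singleton] at h
      obtain ⟨c, hc⟩ := h
      refine ⟨c, ?_⟩
      rwa [← sumSquares, ← hc, sub_sub_cancel]
    · rintro ⟨h, hh⟩
      refine ⟨_, hh, ?_⟩
      rw [Ideal.Quotient.eq, sub_sub_cancel_left, neg_mem_iff]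
      exact Ideal.mem_span_singleton.2 ⟨h, rfl⟩)
  exact ⟨_, length_eq_finrank (k := k) (residueField_surjective d) _, hrk⟩

/-! ### The dimension of the quadric -/

theorem le_ringKrullDim_mvPowerSeries (n : ℕ) : (n : WithBot ℕ∞) ≤
    ringKrullDim (MvPowerSeries (Fin n) k) := by
  induction n with
  | zero =>
    rw [ringKrullDim_eq_of_ringEquiv (MvPowerSeries.isEmptyEquiv (σ := Fin 0) (R := k)).toRingEquiv]
    exact (ringKrullDim_eq_zero_of_field k).ge
  | succ n ih =>
    rw [ringKrullDim_eq_of_ringEquiv (MvPowerSeries.finSuccEquiv k n).toRingEquiv]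
    refine le_trans ?_ ringKrullDim_succ_le_ringKrullDim_powerseries
    push_cast
    gcongr

theorem ringKrullDim_mvPowerSeries (n : ℕ) :
    ringKrullDim (MvPowerSeries (Fin n) k) = n := by
  refine le_antisymm ?_ (le_ringKrullDim_mvPowerSeries n)
  refine (ringKrullDim_le_spanFinrank_maximalIdeal (MvPowerSeries (Fin n) k)).trans ?_
  have h : IsLocalRing.maximalIdeal (MvPowerSeries (Fin n) k) =
      Ideal.span (Set.range fun i => (MvPowerSeries.X i : MvPowerSeries (Fin n) k)) := by
    ext g
    rw [mem_span_X_iff, IsLocalRing.mem_maximalIdeal, mem_nonunits_iff,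
      MvPowerSeries.isUnit_iff_constantCoeff, isUnit_iff_ne_zero, not_not]
  have h1 : (IsLocalRing.maximalIdeal (MvPowerSeries (Fin n) k)).spanFinrank ≤ n := by
    rw [h]
    refine (Submodule.spanFinrank_span_le_ncard_of_finite (Set.finite_range _)).trans ?_
    rw [← Set.image_univ]
    refine (Set.ncard_image_le Set.finite_univ).trans ?_
    simp
  exact_mod_cast h1

theorem ringKrullDim_quadricRing (d : ℕ) : ringKrullDim (QuadricRing k d) = d := by
  have h := ringKrullDim_quotient_span_singleton_succ_eq_ringKrullDim_of_mem_nonZeroDivisors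
    (x := sumSquares k d) (mem_nonZeroDivisors_of_ne_zero (sumSquares_ne_zero d)) (by
      rw [IsLocalRing.mem_maximalIdeal, mem_nonunits_iff, MvPowerSeries.isUnit_iff_constantCoeff,
        constantCoeff_sumSquares]
      exact not_isUnit_zero)
  rw [ringKrullDim_mvPowerSeries, Nat.cast_succ] at h
  exact ENat.WithBot.add_one_cancel.1 h

end

theorem mainTheorem1 (k : Type*) [Field k] (p : ℕ) [CharP k p] (hp : 2 < p)
    (a : ℕ) (ha : p = 2 * a + 1) (d : ℕ) :
    HasHilbertKunzMultiplicity (QuadricRing k d) p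
      (1 + 2 ^ d * (latticeCount (a - 1) (fibonacciPolytope d) : ℝ) /
        ((2 * (a : ℝ) + 1) ^ d - (extFibonacciCountSubTwo a d : ℝ))) := by
  have hprime : p.Prime := (CharP.char_is_prime_or_zero k p).resolve_right (by omega)
  have : Fact p.Prime := ⟨hprime⟩
  choose l hl hrk using length_quotient_frobeniusPowerIdeal (k := k) p d
  obtain ⟨c, rfl⟩ : ∃ c, a = c + 1 := ⟨a - 1, by omega⟩
  refine ⟨hprime, charP_quadricRing p d, fun e => ?_, d, ringKrullDim_quadricRing d, ?_⟩
  · rw [hl]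
    exact ENat.natCast_ne_top _
  simp only [hl, ENat.toNat_natCast]
  rw [EndoMod.extFibonacciCountSubTwo_eq, add_tsub_cancel_right, latticeCount_fibonacciPolytope]
  have hY := EndoMod.extPathCount_lt (a := c + 1) (by omega) d
  rw [← ha] at hY
  have hp2 : (2 * ((c + 1 : ℕ) : ℝ) + 1) = p := by rw [ha]; push_cast; ring
  rw [hp2]
  set Y : ℕ := EndoMod.extPathCount (c + 1) d
  set P : ℕ := pathCount (Finset.Icc 0 c) c d 0
  have hY' : (Y : ℝ) < (p : ℝ) ^ d := by exact_mod_cast hY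
  have hp0 : (0 : ℝ) < p := by exact_mod_cast hprime.pos
  have hpd : (0 : ℝ) < (p : ℝ) ^ d := pow_pos hp0 d
  have hform : ∀ e, (l e : ℝ) / (p : ℝ) ^ (e * d) =
      1 + 2 ^ d * P / ((p : ℝ) ^ d - Y) * (1 - ((Y : ℝ) / p ^ d) ^ e) := by
    intro e
    have h := EndoMod.rk_cls_sqMod_pow (k := k) p ha d e
    rw [← hrk] at h
    have h' : ((l e : ℝ) - ((p : ℝ) ^ e) ^ d) * ((p : ℝ) ^ d - Y) =
        2 ^ d * P * (((p : ℝ) ^ e) ^ d - (Y : ℝ) ^ e) := by exact_mod_cast h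
    have h1 : (p : ℝ) ^ d - Y ≠ 0 := by linarith
    have h2 : ((p : ℝ) ^ e) ^ d = ((p : ℝ) ^ d) ^ e := by rw [← pow_mul, ← pow_mul, mul_comm]
    rw [div_pow, pow_mul, h2] at *
    field_simp
    linear_combination h'
  simp only [hform]
  have hlim : Filter.Tendsto (fun e : ℕ => ((Y : ℝ) / p ^ d) ^ e) Filter.atTop (𝓝 0) :=
    tendsto_pow_atTop_nhds_zero_of_lt_one (by positivity) ((div_lt_one hpd).2 hY')
  have := ((hlim.const_sub 1).const_mul (2 ^ d * (P : ℝ) / ((p : ℝ) ^ d - Y))).const_add 1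
  simpa using this
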